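/- **Theorem (global existence for the semilinear Lagrangian system).** Let $\alpha,\beta,\gamma,\Gamma\in\mathbb R$ and $\lambda>0$. For a quintuple $X=(Z,K,V,W,Q)$ of functions of $\xi\in\mathbb R$ and $t\ge 0$ put $y=Z+\xi+\Gamma t$, $$H(K)=(\alpha+\Gamma)K+\tfrac{\beta e^{-2\lambda t}}{3}K^3+\tfrac{\gamma e^{-3\lambda t}}{4}K^4,\qquad f=-H(K)Q(1-V)+e^{-\lambda t}K^2Q(1-V)+\tfrac{e^{-\lambda t}}2QV,$$ $$P(\xi)=\tfrac12\int_{\mathbb R}e^{-|y(\xi)-y(\eta)|}f(\eta)\,d\eta,\qquad G(\xi)=-\tfrac12\int_{\mathbb R}\operatorname{sgn}(\xi-\eta)\,e^{-|y(\xi)-y(\eta)|}f(\eta)\,d\eta ,$$ and consider the system $$\begin{aligned}Z_t&=e^{-\lambda t}K,\qquad K_t=-G,\\ V_t&=2W\big(e^{-\lambda t}K^2(1-V)-H(K)(1-V)-\tfrac{e^{-\lambda t}}2V-P(1-V)\big),\\ W_t&=(1-2V)\big(e^{-\lambda t}K^2(1-V)-H(K)(1-V)-\tfrac{e^{-\lambda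 t}}2V-P(1-V)\big),\\ Q_t&=2WQ\big(\tfrac{e^{-\lambda t}}2+e^{-\lambda t}K^2-H(K)-P\big).\end{aligned}\tag{KZ}$$ For $\bar k\in H^1(\mathbb R)$ let $\bar y(\xi)$ be defined by $\int_0^{\bar y(\xi)}\bar k_x^2\,dx+\bar y(\xi)=\xi$, and take the initial data $$\bar Z=\bar y-\xi,\quad \bar K=\bar k\circ\bar y,\quad \bar V=\frac{\bar k_x^2\circ\bar y}{1+\bar k_x^2\circ\bar y},\quad \bar W=\frac{\bar k_x\circ\bar y}{1+\bar k_x^2\circ\bar y},\quad \bar Q=1.\tag{K0}$$ Let $\Omega=(H^1\cap W^{1,\infty})\times(H^1\cap W^{1,\infty})\times(L^2\cap L^\infty)\times(L^2\cap L^\infty)\times L^\infty$, normed by the sum of the norms of the components. A solution on $[0,T]$ of (KZ)–(K0) is an $X$ with $X(0)=\bar X$ such that $(Z-\bar Z,K,V,W,Q)$ is bounded on $[0,T]$ with values in $\Omega$ and such that, for almost every $\xi$, the equations (KZ) hold for every $t\in[0,T]$. There is a constant $C>0$ depending only on $\alpha,\beta,\gamma,\Gamma,\lambda$ such that for every $\bar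 k\in H^1(\mathbb R)$ there is a global solution $X$: it solves (KZ)–(K0) on $[0,T]$ for every $T>0$, that is, $(Z-\bar Z,K,V,W,Q)\in L^\infty_{loc}([0,\infty);\Omega)$. It is unique, and every solution on an interval $[0,T]$ is the restriction of $X$. Moreover, with $E=\int_{\mathbb R}(\bar k^2+\bar k_x^2)\,dx$ and $A=E^{1/2}+E+E^{3/2}+E^2$, for every $t\ge0$: 1. $W^2+V^2=V$, $y_\xi=Q(1-V)$ and $K_\xi=WQ$ almost everywhere (weak derivatives in $\xi$); 2. $K^2Q(1-V)+QV$ is integrable and $\int_{\mathbb R}\big(K^2Q(1-V)+QV\big)(t,\xi)\,d\xi=E$ (the solution is conservative); 3. $\|P(t)\|_{L^\infty},\|G(t)\|_{L^\infty}\le CA$, and the norms of $P(t)$ and $G(t)$ in $H^1\cap W^{1,\infty}$ are bounded on every bounded time interval; 4. $e^{-C(1+A)t}\le Q(t,\xi)\le e^{C(1+A)t}$ for almost every $\xi$. -/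

import Mathlib

open MeasureTheory Set Filter Topology
open scoped ENNReal ContDiff

noncomputable section

namespace LagrangianCH

/-- `g` is the weak (distributional) derivative of `f` on the real line. -/
structure HasWeakDeriv (f g : ℝ → ℝ) : Prop where
  locallyIntegrable : LocallyIntegrable f volume
  locallyIntegrable_deriv : LocallyIntegrable g volume
  integral_eq : ∀ φ : ℝ → ℝ, ContDiff ℝ ∞ φ → HasCompactSupport φ →
    ∫ x, f x * deriv φ x = -∫ x, g x * φ x

/-- The `L² ∩ L^∞` norm. -/
def interNorm (f : ℝ → ℝ) : ℝ≥0∞ := eLpNorm f 2 volume + eLpNorm f ⊤ volume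

/-- The norm of `H¹ ∩ W^{1,∞}`: the `L² ∩ L^∞` norm of `f` plus that of its weak derivative
(which is unique up to null sets); it is `∞` when `f` has no weak derivative. -/
def sobolevNorm (f : ℝ → ℝ) : ℝ≥0∞ :=
  ⨅ (g : ℝ → ℝ) (_ : HasWeakDeriv f g), (interNorm f + interNorm g)

/-- The constants of the equation. -/
structure Params where
  α : ℝ
  β : ℝ
  γ : ℝ
  Γ : ℝ
  lam : ℝ

/-- A quintuple of functions of the Lagrangian variable `ξ`. -/
structure State where
  Z : ℝ → ℝ
  K : ℝ → ℝ
  V : ℝ → ℝ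
  W : ℝ → ℝ
  Q : ℝ → ℝ

/-- The norm of
`Ω = (H¹ ∩ W^{1,∞}) × (H¹ ∩ W^{1,∞}) × (L² ∩ L^∞) × (L² ∩ L^∞) × L^∞`. -/
def omegaNorm (X : State) : ℝ≥0∞ :=
  sobolevNorm X.Z + sobolevNorm X.K + interNorm X.V + interNorm X.W + eLpNorm X.Q ⊤ volume

/-- Membership in `Ω`. -/
structure MemOmega (X : State) : Prop where
  aesm_Z : AEStronglyMeasurable X.Z volume
  aesm_K : AEStronglyMeasurable X.K volume
  aesm_V : AEStronglyMeasurable X.V volume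
  aesm_W : AEStronglyMeasurable X.W volume
  aesm_Q : AEStronglyMeasurable X.Q volume
  norm_lt_top : omegaNorm X < ⊤

/-- Two quintuples agree almost everywhere. -/
def State.AEEq (X Y : State) : Prop :=
  X.Z =ᵐ[volume] Y.Z ∧ X.K =ᵐ[volume] Y.K ∧ X.V =ᵐ[volume] Y.V ∧
    X.W =ᵐ[volume] Y.W ∧ X.Q =ᵐ[volume] Y.Q

/-- `X` with its first component measured relative to the function `Z₀`. -/
def State.relZ (X : State) (Z₀ : ℝ → ℝ) : State :=
  { X with Z := fun ξ => X.Z ξ - Z₀ ξ }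

variable (p : Params)

/-- `H(K) = (α + Γ) K + (β e^{-2λt} / 3) K³ + (γ e^{-3λt} / 4) K⁴`. -/
def hamil (t K : ℝ) : ℝ :=
  (p.α + p.Γ) * K + p.β * Real.exp (-2 * p.lam * t) / 3 * K ^ 3
    + p.γ * Real.exp (-3 * p.lam * t) / 4 * K ^ 4

/-- The characteristic `y(t, ξ) = Z(t, ξ) + ξ + Γ t`. -/
def charY (t : ℝ) (X : State) (ξ : ℝ) : ℝ := X.Z ξ + ξ + p.Γ * t

/-- `(-H(K) + e^{-λt} K²) Q (1 - V) + (e^{-λt} / 2) Q V`. -/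
def source (t : ℝ) (X : State) (η : ℝ) : ℝ :=
  -hamil p t (X.K η) * X.Q η * (1 - X.V η)
    + Real.exp (-p.lam * t) * X.K η ^ 2 * X.Q η * (1 - X.V η)
    + Real.exp (-p.lam * t) / 2 * X.Q η * X.V η

/-- The nonlocal term `P`. -/
def lagP (t : ℝ) (X : State) (ξ : ℝ) : ℝ :=
  1 / 2 * ∫ η, Real.exp (-|charY p t X ξ - charY p t X η|) * source p t X η

/-- The nonlocal term `G`, that is `P_x` along the characteristics. -/
def lagG (t : ℝ) (X : State) (ξ : ℝ) : ℝ :=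
  -(1 / 2) * ∫ η, Real.sign (ξ - η) * Real.exp (-|charY p t X ξ - charY p t X η|)
    * source p t X η

/-- The common factor
`e^{-λt} K² (1 - V) - H(K) (1 - V) - (e^{-λt} / 2) V - P (1 - V)`
of the equations for `V` and `W`. -/
def factorVW (t : ℝ) (X : State) (ξ : ℝ) : ℝ :=
  Real.exp (-p.lam * t) * X.K ξ ^ 2 * (1 - X.V ξ) - hamil p t (X.K ξ) * (1 - X.V ξ)
    - Real.exp (-p.lam * t) / 2 * X.V ξ - lagP p t X ξ * (1 - X.V ξ)

/-- The right-hand side of the semilinear system `X_t = F(t, X)`. -/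
def field (t : ℝ) (X : State) : State where
  Z ξ := Real.exp (-p.lam * t) * X.K ξ
  K ξ := -lagG p t X ξ
  V ξ := 2 * X.W ξ * factorVW p t X ξ
  W ξ := (1 - 2 * X.V ξ) * factorVW p t X ξ
  Q ξ := 2 * X.W ξ * X.Q ξ *
    (Real.exp (-p.lam * t) / 2 + Real.exp (-p.lam * t) * X.K ξ ^ 2
      - hamil p t (X.K ξ) - lagP p t X ξ)

/-- The initial characteristic `ȳ`: the inverse of `y ↦ ∫₀^y k_x² dx + y`. -/
def initialY (kx : ℝ → ℝ) : ℝ → ℝ :=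
  Function.invFun fun y : ℝ => (∫ x in (0 : ℝ)..y, kx x ^ 2) + y

/-- For square integrable `k_x`, the defining equation of `ȳ` holds. -/
theorem initialY_spec {kx : ℝ → ℝ} (hkx : MemLp kx 2 volume) (ξ : ℝ) :
    (∫ x in (0 : ℝ)..initialY kx ξ, kx x ^ 2) + initialY kx ξ = ξ := by
  have hint : Integrable (fun x => kx x ^ 2) volume := hkx.integrable_sq
  have hcont : Continuous fun y : ℝ => (∫ x in (0 : ℝ)..y, kx x ^ 2) + y :=
    (intervalIntegral.continuous_primitive
      (fun a b => hint.intervalIntegrable) 0).add continuous_id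
  have htop : Tendsto (fun y : ℝ => (∫ x in (0 : ℝ)..y, kx x ^ 2) + y) atTop atTop := by
    refine tendsto_atTop_mono' _ ?_ tendsto_id
    filter_upwards [eventually_ge_atTop (0 : ℝ)] with y hy
    have := intervalIntegral.integral_nonneg (μ := volume) hy
      (fun x _ => sq_nonneg (kx x))
    simp only [id]
    linarith
  have hbot : Tendsto (fun y : ℝ => (∫ x in (0 : ℝ)..y, kx x ^ 2) + y) atBot atBot := by
    refine tendsto_atBot_mono' _ ?_ tendsto_id
    filter_upwards [eventually_le_atBot (0 : ℝ)] with y hy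
    have := intervalIntegral.integral_nonneg (μ := volume) hy
      (fun x _ => sq_nonneg (kx x))
    rw [intervalIntegral.integral_symm]
    simp only [id]
    linarith
  exact Function.invFun_eq (hcont.surjective htop hbot ξ)

/-- The initial data belonging to `k̄` with weak derivative `k̄_x`. The last component is
`(1 + k̄_x² ∘ ȳ) ȳ_ξ = 1`. -/
def initialState (k kx : ℝ → ℝ) : State where
  Z ξ := initialY kx ξ - ξ
  K ξ := k (initialY kx ξ)
  V ξ := kx (initialY kx ξ) ^ 2 / (1 + kx (initialY kx ξ) ^ 2)
  W ξ := kx (initialY kx ξ) / (1 + kx (initialY kx ξ) ^ 2)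
  Q _ := 1

/-- `X` is a solution on `[0, T]` of the semilinear system with the initial data belonging to
`k̄`: it is bounded on `[0, T]` with values in `(Z̄, 0, 0, 0, 0) + Ω`, it has the right initial
value, and for almost every `ξ` the equations hold at every time. -/
structure IsSolutionOn (k kx : ℝ → ℝ) (T : ℝ) (X : ℝ → State) : Prop where
  memOmega : ∀ t ∈ Icc 0 T, MemOmega ((X t).relZ (initialState k kx).Z)
  bounded : ∃ M : ℝ≥0∞, M < ⊤ ∧
    ∀ t ∈ Icc 0 T, omegaNorm ((X t).relZ (initialState k kx).Z) ≤ M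
  initial : (X 0).AEEq (initialState k kx)
  equation : ∀ᵐ ξ ∂(volume : Measure ℝ), ∀ t ∈ Icc 0 T,
    HasDerivWithinAt (fun s => (X s).Z ξ) ((field p t (X t)).Z ξ) (Icc 0 T) t ∧
    HasDerivWithinAt (fun s => (X s).K ξ) ((field p t (X t)).K ξ) (Icc 0 T) t ∧
    HasDerivWithinAt (fun s => (X s).V ξ) ((field p t (X t)).V ξ) (Icc 0 T) t ∧
    HasDerivWithinAt (fun s => (X s).W ξ) ((field p t (X t)).W ξ) (Icc 0 T) t ∧
    HasDerivWithinAt (fun s => (X s).Q ξ) ((field p t (X t)).Q ξ) (Icc 0 T) t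

/-- A global solution: a solution on `[0, T]` for every `T > 0`. -/
def IsGlobalSolution (k kx : ℝ → ℝ) (X : ℝ → State) : Prop :=
  ∀ T : ℝ, 0 < T → IsSolutionOn p k kx T X

/-- The density `K² Q (1 - V) + Q V` of the conserved energy. -/
def energyDensity (X : State) (ξ : ℝ) : ℝ :=
  X.K ξ ^ 2 * X.Q ξ * (1 - X.V ξ) + X.Q ξ * X.V ξ

/-- The `H¹` energy `∫ (k² + k_x²) dx`. -/
def energy (k kx : ℝ → ℝ) : ℝ := ∫ x, (k x ^ 2 + kx x ^ 2)

/-- `E^{1/2} + E + E^{3/2} + E²`. -/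
def energyPoly (E : ℝ) : ℝ := E ^ (1 / 2 : ℝ) + E + E ^ (3 / 2 : ℝ) + E ^ 2

end LagrangianCH

end

/-!
The system is an ordinary differential equation in a space of functions of `ξ`, and the point of
the argument is that its solutions exist for all times although the right-hand side is only locally
Lipschitz.

Working with representatives, a *classical* solution (`ClassicalOn`) satisfies the equations at
every `ξ` and is bounded by a constant `R`. As long as `Z - Z̄` is bounded, the kernel
`e^{-|y(ξ) - y(η)|}` is comparable to `e^{-|ξ - η|}` (`Admissible.exp_charY_le`), so that the
right-hand side is bounded and Lipschitz in the supremum norm on bounded sets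
(`Admissible.exists_field_const`). The Picard-Lindelöf theorem for the truncated system then gives a
classical solution up to any time for which an a priori bound is known
(`exists_classicalOn_of_bound`).

The a priori bound comes from the structure of the system. The identity `W² + V² = V` is preserved
pointwise (`ClassicalOn.constraint`). Every quantity of interest stays below a constant multiple of
one fixed function `domFun` in `L² ∩ L^∞` (`ClassicalOn.exists_domAt`): the exponential kernel,
being concentrated near the diagonal, preserves bounds by slowly varying functions. The relations
`y_ξ = Q (1 - V)` and `K_ξ = W Q` propagate because their defects over all intervals satisfy a
closed system of linear differential inequalities (`ClassicalOn.isPrim`). They give the derivatives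
of `P` and `G` in terms of each other (`ClassicalOn.isPrim_lagP_lagG`) and turn the time derivative of the energy density
into the `ξ`-derivative of an integrable flux, so the energy is constant
(`ClassicalOn.integral_energyDensity`). Conservation of energy gives `K² ≤ E`
(`ClassicalOn.abs_K_le`), hence the polynomial bounds on `P` and `G`, the exponential bounds on `Q`
and the linear growth of `Z`, none of which refers to `R`.

Initial data belonging to `k̄ ∈ H¹` have the required properties because `ȳ` carries Lebesgue
measure to `(1 + k̄_x²) dx` (`map_initialY`). Uniqueness in the larger class of solutions with values
in the state space follows from the same Lipschitz bound on a set of full measure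
(`closeAt_zero_of_solvesAt`). Throughout, weak derivatives are handled through `IsPrim`, the
relation between a locally absolutely continuous function and its derivative, and suprema over `ξ`,
which need not be measurable or attained, through the Grönwall lemma `gronwall_family`.
-/

noncomputable section

namespace LagrangianCH

/-! ### Primitives of locally integrable functions -/

/-- `F` is a primitive of the locally integrable function `f`, that is, `F` is locally absolutely
continuous with almost everywhere derivative `f`. -/
structure IsPrim (F f : ℝ → ℝ) : Prop where
  locallyIntegrable : LocallyIntegrable f volume
  integral_eq : ∀ a b, ∫ x in a..b, f x = F b - F a

namespace IsPrim

variable {F G f g : ℝ → ℝ}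

theorem intervalIntegrable (h : IsPrim F f) (a b : ℝ) : IntervalIntegrable f volume a b :=
  (h.locallyIntegrable.integrableOn_isCompact isCompact_uIcc).intervalIntegrable

theorem eq_add (h : IsPrim F f) (a : ℝ) : F = fun x => F a + ∫ t in a..x, f t := by
  funext x
  rw [h.integral_eq]; ring

theorem continuous (h : IsPrim F f) : Continuous F := by
  rw [h.eq_add 0]
  exact continuous_const.add
    (intervalIntegral.continuous_primitive (fun a b => h.intervalIntegrable a b) 0)

theorem absolutelyContinuous (h : IsPrim F f) (a b : ℝ) : AbsolutelyContinuousOnInterval F a b := by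
  rw [h.eq_add a]
  have h1 := (h.intervalIntegrable a b).absolutelyContinuousOnInterval_intervalIntegral
    (c := a) (by simp)
  have h2 : AbsolutelyContinuousOnInterval (fun _ : ℝ => F a) a b :=
    (contDiff_const.contDiffOn).absolutelyContinuousOnInterval
  exact h2.add h1

theorem ae_hasDerivAt (h : IsPrim F f) : ∀ᵐ x, HasDerivAt F (f x) x := by
  filter_upwards [LocallyIntegrable.ae_hasDerivAt_integral h.locallyIntegrable] with x hx
  rw [h.eq_add 0]
  exact (hx 0).const_add _

/-- The fundamental theorem of calculus for absolutely continuous functions. -/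
theorem of_absolutelyContinuous (hF : ∀ a b, AbsolutelyContinuousOnInterval F a b)
    (hf : LocallyIntegrable f volume) (hd : ∀ᵐ x, HasDerivAt F (f x) x) : IsPrim F f := by
  refine ⟨hf, fun a b => ?_⟩
  rw [← (hF a b).integral_deriv_eq_sub]
  apply intervalIntegral.integral_congr_ae
  filter_upwards [hd] with x hx _
  exact hx.deriv.symm

theorem congr_deriv (h : IsPrim F f) (hfg : f =ᵐ[volume] g) : IsPrim F g := by
  refine ⟨h.locallyIntegrable.congr hfg, fun a b => ?_⟩
  rw [← h.integral_eq]
  apply intervalIntegral.integral_congr_ae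
  filter_upwards [hfg] with x hx _ using hx.symm

theorem add (hF : IsPrim F f) (hG : IsPrim G g) :
    IsPrim (fun x => F x + G x) (fun x => f x + g x) := by
  refine ⟨hF.locallyIntegrable.add hG.locallyIntegrable, fun a b => ?_⟩
  rw [intervalIntegral.integral_add (hF.intervalIntegrable a b) (hG.intervalIntegrable a b),
    hF.integral_eq, hG.integral_eq]
  ring

theorem const_mul (hF : IsPrim F f) (c : ℝ) : IsPrim (fun x => c * F x) (fun x => c * f x) := by
  refine ⟨hF.locallyIntegrable.smul c, fun a b => ?_⟩
  rw [intervalIntegral.integral_const_mul, hF.integral_eq]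
  ring

theorem neg (hF : IsPrim F f) : IsPrim (fun x => -F x) (fun x => -f x) := by
  simpa using hF.const_mul (-1)

theorem sub (hF : IsPrim F f) (hG : IsPrim G g) :
    IsPrim (fun x => F x - G x) (fun x => f x - g x) := by
  simpa [sub_eq_add_neg] using hF.add hG.neg

theorem const (c : ℝ) : IsPrim (fun _ => c) (fun _ => 0) :=
  ⟨locallyIntegrable_zero, by simp⟩

theorem add_const (hF : IsPrim F f) (c : ℝ) : IsPrim (fun x => F x + c) f := by
  simpa using hF.add (const c)

theorem id : IsPrim (fun x => x) (fun _ => 1) :=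
  ⟨continuous_const.locallyIntegrable, by simp⟩

theorem mul (hF : IsPrim F f) (hG : IsPrim G g) :
    IsPrim (fun x => F x * G x) (fun x => f x * G x + F x * g x) := by
  refine of_absolutelyContinuous
    (fun a b => (hF.absolutelyContinuous a b).fun_mul (hG.absolutelyContinuous a b)) ?_ ?_
  · refine LocallyIntegrable.add ?_ ?_
    · exact hF.locallyIntegrable.mul_continuous hG.continuous
    · exact hG.locallyIntegrable.continuous_mul hF.continuous
  · filter_upwards [hF.ae_hasDerivAt, hG.ae_hasDerivAt] with x h1 h2
    exact h1.mul h2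

/-- The chain rule for a continuously differentiable outer function. -/
theorem comp (hF : IsPrim F f) {φ φ' : ℝ → ℝ} (hφ : ∀ x, HasDerivAt φ (φ' x) x)
    (hφ' : Continuous φ') : IsPrim (fun x => φ (F x)) (fun x => φ' (F x) * f x) := by
  have hC1 : ContDiff ℝ 1 φ := by
    rw [contDiff_one_iff_deriv]
    have : deriv φ = φ' := funext fun x => (hφ x).deriv
    exact ⟨fun x => (hφ x).differentiableAt, this ▸ hφ'⟩
  refine of_absolutelyContinuous (fun a b => ?_) ?_ ?_
  · obtain ⟨r, hr⟩ : ∃ r, F '' uIcc a b ⊆ Icc (-r) r := by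
      obtain ⟨r, hr⟩ := (isCompact_uIcc.image hF.continuous).isBounded.subset_closedBall 0
      exact ⟨r, by simpa [Real.closedBall_eq_Icc] using hr⟩
    obtain ⟨K, hK⟩ := hC1.contDiffOn.exists_lipschitzOnWith (s := Icc (-r) r) (by decide)
      (convex_Icc _ _) isCompact_Icc
    have hac := hF.absolutelyContinuous a b
    rw [absolutelyContinuousOnInterval_iff] at hac ⊢
    intro ε hε
    obtain ⟨δ, hδ, h⟩ := hac (ε / (K + 1)) (by positivity)
    refine ⟨δ, hδ, fun E hE hEδ => ?_⟩
    have h1 := h E hE hEδ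
    have h2 : ∑ i ∈ Finset.range E.1, dist (φ (F (E.2 i).1)) (φ (F (E.2 i).2)) ≤
        K * ∑ i ∈ Finset.range E.1, dist (F (E.2 i).1) (F (E.2 i).2) := by
      rw [Finset.mul_sum]
      refine Finset.sum_le_sum fun i hi => ?_
      have hm := hE.1 i hi
      exact hK.dist_le_mul _ (hr (mem_image_of_mem _ hm.1)) _ (hr (mem_image_of_mem _ hm.2))
    refine h2.trans_lt ?_
    have h3 : (0 : ℝ) ≤ ∑ i ∈ Finset.range E.1, dist (F (E.2 i).1) (F (E.2 i).2) :=
      Finset.sum_nonneg fun _ _ => dist_nonneg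
    rw [lt_div_iff₀ (by positivity)] at h1
    nlinarith
  · exact hF.locallyIntegrable.continuous_mul (hφ'.comp hF.continuous)
  · filter_upwards [hF.ae_hasDerivAt] with x hx
    exact (hφ (F x)).comp x hx

theorem pow (hF : IsPrim F f) (n : ℕ) :
    IsPrim (fun x => F x ^ n) (fun x => n * F x ^ (n - 1) * f x) :=
  hF.comp (φ := fun x => x ^ n) (φ' := fun x => n * x ^ (n - 1)) (fun x => hasDerivAt_pow n x)
    (by fun_prop)

theorem exp (hF : IsPrim F f) :
    IsPrim (fun x => Real.exp (F x)) (fun x => Real.exp (F x) * f x) :=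
  hF.comp Real.hasDerivAt_exp Real.continuous_exp

theorem of_locallyIntegrable (hf : LocallyIntegrable f volume) (a : ℝ) :
    IsPrim (fun x => ∫ t in a..x, f t) f :=
  ⟨hf, fun b c => by
    have hi : ∀ b c, IntervalIntegrable f volume b c := fun b c =>
      (hf.integrableOn_isCompact isCompact_uIcc).intervalIntegrable
    exact (intervalIntegral.integral_interval_sub_left (hi _ _) (hi _ _)).symm⟩

theorem abs_sub_le (hF : IsPrim F f) {C : ℝ} (hC : ∀ x, |f x| ≤ C) (a b : ℝ) :
    |F b - F a| ≤ C * |b - a| := by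
  rw [← hF.integral_eq]
  exact intervalIntegral.norm_integral_le_of_norm_le_const (f := f) fun x _ => hC x

theorem tendsto_atTop (hF : IsPrim F f) (hf : Integrable f volume) (hFi : Integrable F volume) :
    Tendsto F atTop (𝓝 0) := by
  have h1 : Tendsto F atTop (𝓝 (F 0 + ∫ x in Ioi 0, f x)) := by
    have h := intervalIntegral_tendsto_integral_Ioi (0 : ℝ) hf.integrableOn tendsto_id
    have h' := h.const_add (F 0)
    refine h'.congr fun x => ?_
    simp only [_root_.id]
    rw [hF.integral_eq]; ring
  have h2 : F 0 + ∫ x in Ioi 0, f x = 0 := by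
    refine IntegrableAtFilter.eq_zero_of_tendsto (μ := volume) ⟨univ, univ_mem, hFi.integrableOn⟩
      (fun s hs => ?_) h1
    rcases mem_atTop_sets.1 hs with ⟨b, hb⟩
    rw [← top_le_iff, ← Real.volume_Ici (a := b)]
    exact measure_mono hb
  rwa [h2] at h1

theorem comp_neg (hF : IsPrim F f) : IsPrim (fun x => F (-x)) (fun x => -f (-x)) := by
  refine ⟨?_, fun a b => ?_⟩
  · refine LocallyIntegrable.neg ?_
    have := (Homeomorph.neg ℝ).isOpenEmbedding
    intro x
    obtain ⟨U, hU, hUi⟩ := hF.locallyIntegrable (-x)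
    refine ⟨Neg.neg ⁻¹' U, (continuous_neg.tendsto x) hU, ?_⟩
    exact ((Measure.measurePreserving_neg volume).integrableOn_comp_preimage
      (Homeomorph.neg ℝ).measurableEmbedding).2 hUi
  · rw [intervalIntegral.integral_neg, intervalIntegral.integral_comp_neg, hF.integral_eq]
    ring

theorem tendsto_atBot (hF : IsPrim F f) (hf : Integrable f volume) (hFi : Integrable F volume) :
    Tendsto F atBot (𝓝 0) := by
  have h := hF.comp_neg.tendsto_atTop hf.comp_neg.neg hFi.comp_neg
  have := h.comp tendsto_neg_atBot_atTop
  simpa [Function.comp_def] using this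

theorem integral_eq_zero (hF : IsPrim F f) (hf : Integrable f volume)
    (hFi : Integrable F volume) : ∫ x, f x = 0 := by
  have h1 := intervalIntegral_tendsto_integral hf tendsto_neg_atTop_atBot tendsto_id
  have h2 : Tendsto (fun x : ℝ => ∫ t in (-x)..x, f t) atTop (𝓝 (0 - 0)) := by
    simp_rw [hF.integral_eq]
    exact (hF.tendsto_atTop hf hFi).sub
      ((hF.tendsto_atBot hf hFi).comp tendsto_neg_atTop_atBot)
  simpa using tendsto_nhds_unique h1 h2

/-- A function in `H¹` is bounded. -/
theorem exists_bound (hF : IsPrim F f) (hF2 : Integrable (fun x => F x ^ 2) volume)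
    (hf2 : Integrable (fun x => f x ^ 2) volume) : ∃ B : ℝ, ∀ ξ, |F ξ| ≤ B := by
  have hint : Integrable (fun x => F x ^ 2 + f x ^ 2) := hF2.add hf2
  have hprim := hF.pow 2
  refine ⟨Real.sqrt (F 0 ^ 2 + ∫ x, (F x ^ 2 + f x ^ 2)), fun ξ => Real.abs_le_sqrt ?_⟩
  have h1 := hprim.integral_eq 0 ξ
  have h2 : |∫ x in (0 : ℝ)..ξ, ((2 : ℕ) : ℝ) * F x ^ (2 - 1) * f x| ≤
      ∫ x, (F x ^ 2 + f x ^ 2) := by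
    rw [← Real.norm_eq_abs]
    refine (intervalIntegral.norm_integral_le_integral_norm_uIoc).trans ?_
    refine (setIntegral_mono_on₀ ?_ hint.integrableOn measurableSet_uIoc.nullMeasurableSet
      fun x _ => ?_).trans ?_
    · exact ((hprim.intervalIntegrable 0 ξ).def').norm
    · rw [Real.norm_eq_abs, abs_le]
      simp only [Nat.cast_ofNat, Nat.add_one_sub_one, pow_one]
      constructor <;> nlinarith [sq_nonneg (F x + f x), sq_nonneg (F x - f x)]
    · exact setIntegral_le_integral hint (Eventually.of_forall fun x => by positivity)
  rw [h1] at h2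
  linarith [(abs_le.1 h2).2]

theorem hasWeakDeriv (hF : IsPrim F f) : HasWeakDeriv F f := by
  refine ⟨hF.continuous.locallyIntegrable, hF.locallyIntegrable, fun φ hφ hc => ?_⟩
  have hφp : IsPrim φ (deriv φ) := by
    refine ⟨(hφ.continuous_deriv (by simp)).locallyIntegrable, fun a b => ?_⟩
    exact intervalIntegral.integral_deriv_eq_sub
      (fun x _ => (hφ.differentiable (by simp)).differentiableAt)
      ((hφ.continuous_deriv (by simp)).intervalIntegrable _ _)
  have hm := hF.mul hφp
  have hi1 : Integrable (fun x => f x * φ x) := by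
    have := hF.locallyIntegrable.integrable_smul_left_of_hasCompactSupport hφ.continuous hc
    simpa [mul_comm] using this
  have hi2 : Integrable (fun x => F x * deriv φ x) :=
    (hF.continuous.mul (hφ.continuous_deriv (by simp))).integrable_of_hasCompactSupport
      hc.deriv.mul_left
  have hi3 : Integrable (fun x => F x * φ x) :=
    (hF.continuous.mul hφ.continuous).integrable_of_hasCompactSupport hc.mul_left
  have h0 := hm.integral_eq_zero (hi1.add hi2) hi3
  rw [integral_add hi1 hi2] at h0
  linarith

end IsPrim

/-- A function with a weak derivative agrees almost everywhere with a primitive of that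
derivative (the lemma of du Bois-Reymond). -/
theorem HasWeakDeriv.exists_isPrim {k g : ℝ → ℝ} (h : HasWeakDeriv k g) :
    ∃ k', k =ᵐ[volume] k' ∧ IsPrim k' g := by
  set F : ℝ → ℝ := fun x => ∫ t in (0 : ℝ)..x, g t
  have hF : IsPrim F g := IsPrim.of_locallyIntegrable h.locallyIntegrable_deriv 0
  have hFw := hF.hasWeakDeriv
  obtain ⟨ψ₀, hψ₀c, hψ₀s, hψ₀i⟩ : ∃ ψ₀ : ℝ → ℝ, HasCompactSupport ψ₀ ∧ ContDiff ℝ ∞ ψ₀ ∧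
      ∫ x, ψ₀ x = 1 := by
    let b : ContDiffBump (0 : ℝ) := ⟨1, 2, by norm_num, by norm_num⟩
    exact ⟨b.normed volume, b.hasCompactSupport_normed, b.contDiff_normed, b.integral_normed⟩
  set d : ℝ → ℝ := fun x => k x - F x
  have hd : LocallyIntegrable d := h.locallyIntegrable.sub hFw.locallyIntegrable
  have hint : ∀ (u ψ : ℝ → ℝ), LocallyIntegrable u volume → ContDiff ℝ ∞ ψ → HasCompactSupport ψ →
      Integrable (fun x => u x * ψ x) := by
    intro u ψ hu hψ hc
    have := hu.integrable_smul_left_of_hasCompactSupport hψ.continuous hc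
    simpa [mul_comm] using this
  have hd0 : ∀ φ : ℝ → ℝ, ContDiff ℝ ∞ φ → HasCompactSupport φ → ∫ x, d x * deriv φ x = 0 := by
    intro φ hφ hc
    have hφ' : ContDiff ℝ ∞ (deriv φ) := by
      have := (contDiff_succ_iff_deriv (n := ∞) (f := φ)).1 (by simpa using hφ)
      exact this.2.2
    simp only [d, sub_mul]
    rw [integral_sub (hint _ _ h.locallyIntegrable hφ' hc.deriv)
      (hint _ _ hFw.locallyIntegrable hφ' hc.deriv), h.integral_eq φ hφ hc,
      hFw.integral_eq φ hφ hc, sub_self]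
  set c := ∫ x, d x * ψ₀ x
  have hconst : ∀ᵐ x, d x = c := by
    refine ae_eq_of_integral_contDiff_smul_eq hd (locallyIntegrable_const c) fun ψ hψ hc => ?_
    set s := ∫ x, ψ x
    -- the primitive of `ψ - s ψ₀` is a test function because this difference has mean zero
    set θ : ℝ → ℝ := fun x => ψ x - s * ψ₀ x
    have hθs : ContDiff ℝ ∞ θ := hψ.sub (contDiff_const.mul hψ₀s)
    have hθc : HasCompactSupport θ := hc.sub hψ₀c.mul_left
    have hθi : Integrable θ := hθs.continuous.integrable_of_hasCompactSupport hθc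
    have hθ0 : ∫ x, θ x = 0 := by
      simp only [θ]
      rw [integral_sub (hψ.continuous.integrable_of_hasCompactSupport hc)
        ((hψ₀s.continuous.integrable_of_hasCompactSupport hψ₀c).const_mul s),
        integral_const_mul, hψ₀i]
      simp [s]
    obtain ⟨R, hz⟩ : ∃ R, ∀ x, R ≤ |x| → θ x = 0 := by
      obtain ⟨R, hR⟩ := hθc.isCompact.isBounded.subset_closedBall 0
      refine ⟨R + 1, fun x hx => ?_⟩
      by_contra hne
      have := hR (subset_tsupport θ hne)
      simp only [mem_closedBall_zero_iff, Real.norm_eq_abs] at this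
      linarith
    set φ : ℝ → ℝ := fun x => ∫ t in (-R)..x, θ t
    have hφd : ∀ x, HasDerivAt φ (θ x) x := fun x =>
      (hθs.continuous.integral_hasStrictDerivAt (-R) x).hasDerivAt
    have hφderiv : deriv φ = θ := funext fun x => (hφd x).deriv
    have hφs : ContDiff ℝ ∞ φ := by
      have := (contDiff_succ_iff_deriv (n := ∞) (f := φ)).2
        ⟨fun x => (hφd x).differentiableAt, by simp, by rw [hφderiv]; exact hθs⟩
      simpa using this
    have hφc : HasCompactSupport φ := by
      refine HasCompactSupport.of_support_subset_isCompact (K := Icc (-R) R) isCompact_Icc ?_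
      intro x hx
      by_contra hxn
      apply hx
      rw [mem_Icc, not_and_or, not_le, not_le] at hxn
      rcases hxn with hxn | hxn
      · refine intervalIntegral.integral_zero_ae (Eventually.of_forall fun t ht => hz t ?_)
        rw [uIoc_of_ge hxn.le] at ht
        exact le_abs.2 (Or.inr (by linarith [ht.2]))
      · have : ∫ t in (-R)..x, θ t = ∫ t, θ t := by
          refine intervalIntegral.integral_eq_integral_of_support_subset fun t ht => ?_
          have : |t| < R := lt_of_not_ge fun h => ht (hz t h)
          rw [abs_lt] at this
          exact ⟨this.1, by linarith⟩
        exact this.trans hθ0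
    have := hd0 φ hφs hφc
    rw [hφderiv] at this
    simp only [θ, mul_sub] at this
    rw [integral_sub (hint _ _ hd hψ hc)] at this
    · simp only [smul_eq_mul]
      have e1 : ∀ x, d x * (s * ψ₀ x) = s * (d x * ψ₀ x) := fun x => by ring
      simp_rw [e1] at this
      rw [integral_const_mul] at this
      rw [integral_mul_const]
      simp_rw [mul_comm (ψ _)]
      change _ = s * c
      linarith
    · exact hint _ _ hd (contDiff_const.mul hψ₀s) hψ₀c.mul_left
  refine ⟨fun x => F x + c, ?_, hF.add_const c⟩
  filter_upwards [hconst] with x hx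
  simp only [d] at hx
  linarith

/-! ### Differential inequalities and differentiation under the integral sign -/

/-- If `|φ'| ≤ B'` in the interior of a time interval, then `|φ|` grows at most as fast as `B`. -/
theorem abs_le_add_of_deriv_le {T : ℝ} {φ φ' B B' : ℝ → ℝ} (hφ : ContinuousOn φ (Icc 0 T))
    (hφ' : ∀ t ∈ Ioo 0 T, HasDerivAt φ (φ' t) t) (hB : ∀ t, HasDerivAt B (B' t) t)
    (h : ∀ t ∈ Ioo 0 T, |φ' t| ≤ B' t) {t : ℝ} (ht : t ∈ Icc 0 T) :
    |φ t| ≤ |φ 0| + (B t - B 0) := by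
  have hBc : Continuous B := continuous_iff_continuousAt.2 fun t => (hB t).continuousAt
  have h0 : (0 : ℝ) ∈ Icc 0 T := ⟨le_rfl, ht.1.trans ht.2⟩
  have key : ∀ σ : ℝ, |σ| = 1 → σ * φ t - B t ≤ σ * φ 0 - B 0 := by
    intro σ hσ
    have hanti : AntitoneOn (fun t => σ * φ t - B t) (Icc 0 T) := by
      refine antitoneOn_of_deriv_nonpos (convex_Icc _ _) ((hφ.const_mul σ |>.congr
        (fun _ _ => rfl)).sub hBc.continuousOn) ?_ ?_
      · intro s hs
        rw [interior_Icc] at hs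
        exact (((hφ' s hs).const_mul σ).sub (hB s)).differentiableAt.differentiableWithinAt
      · intro s hs
        rw [interior_Icc] at hs
        rw [(((hφ' s hs).const_mul σ).fun_sub (hB s)).deriv]
        have h1 := h s hs
        have h2 : σ * φ' s ≤ |φ' s| := by
          calc σ * φ' s ≤ |σ * φ' s| := le_abs_self _
            _ = |φ' s| := by rw [abs_mul, hσ, one_mul]
        linarith
    exact hanti h0 ht ht.1
  have h1 := key 1 (by simp)
  have h2 := key (-1) (by simp)
  rw [abs_le]
  constructor
  · linarith [neg_abs_le (φ 0), le_abs_self (φ 0)]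
  · linarith [neg_abs_le (φ 0), le_abs_self (φ 0)]

/-- Grönwall's lemma for a family of functions which is controlled uniformly relative to the
weights `w`: if a bound `ρ w` on the whole family at one time yields the bound `L ρ w` on the time
derivatives, then the bound `a w` at time `0` spreads to `2 a e^{2Lt} w`. The family may be
infinite, and no measurability of a supremum over the family is needed. -/
theorem gronwall_family {ι : Type*} {T : ℝ} {φ φ' : ι → ℝ → ℝ} {w : ι → ℝ} {a M L : ℝ}
    (hL : 0 < L) (ha : 0 ≤ a) (hM0 : 0 ≤ M) (hw : ∀ i, 0 ≤ w i)
    (hcont : ∀ i, ContinuousOn (φ i) (Icc 0 T))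
    (hderiv : ∀ i, ∀ t ∈ Ioo 0 T, HasDerivAt (φ i) (φ' i t) t)
    (h0 : ∀ i, |φ i 0| ≤ a * w i) (hM : ∀ i, ∀ t ∈ Icc 0 T, |φ i t| ≤ M * w i)
    (hstep : ∀ t ∈ Ioo 0 T, ∀ ρ, 0 ≤ ρ → (∀ i, |φ i t| ≤ ρ * w i) →
      ∀ i, |φ' i t| ≤ L * ρ * w i) (i : ι) {t : ℝ} (ht : t ∈ Icc 0 T) :
    |φ i t| ≤ 2 * a * Real.exp (2 * L * t) * w i := by
  have main : ∀ n : ℕ, ∀ i, ∀ t ∈ Icc 0 T,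
      |φ i t| ≤ (2 * a + M / 2 ^ n) * Real.exp (2 * L * t) * w i := by
    intro n
    induction n with
    | zero =>
      intro i t ht
      have h1 : 1 ≤ Real.exp (2 * L * t) := Real.one_le_exp (by have := ht.1; positivity)
      refine (hM i t ht).trans (mul_le_mul_of_nonneg_right ?_ (hw i))
      simp only [pow_zero, div_one]
      nlinarith
    | succ n ih =>
      intro i t ht
      set ρ := 2 * a + M / 2 ^ n with hρ
      have hρ0 : 0 ≤ ρ := by positivity
      -- the factor `1 / 2` gained in each step is `∫₀ᵗ L e^{2Ls} ds ≤ e^{2Lt} / 2`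
      have hB : ∀ t, HasDerivAt (fun t => ρ / 2 * w i * Real.exp (2 * L * t))
          (L * (ρ * Real.exp (2 * L * t)) * w i) t := fun t => by
        have : HasDerivAt (fun t : ℝ => 2 * L * t) (2 * L) t := by
          simpa using (hasDerivAt_id t).const_mul (2 * L)
        exact (this.exp.const_mul (ρ / 2 * w i)).congr_deriv (by ring)
      have h1 := abs_le_add_of_deriv_le (hcont i) (hderiv i) hB (fun s hs =>
        hstep s hs _ (by positivity) (fun j => ih j s (Ioo_subset_Icc_self hs)) i) ht
      have h2 : 1 ≤ Real.exp (2 * L * t) := Real.one_le_exp (by have := ht.1; positivity)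
      have h3 := h0 i
      simp only [mul_zero, Real.exp_zero, mul_one] at h1
      have h4 : (2 * a + M / 2 ^ (n + 1)) = a + ρ / 2 := by
        rw [hρ, pow_succ]; ring
      rw [h4]
      have h5 : a * w i ≤ a * Real.exp (2 * L * t) * w i :=
        mul_le_mul_of_nonneg_right (le_mul_of_one_le_right ha h2) (hw i)
      have h6 : 0 ≤ ρ / 2 * w i := by have := hw i; positivity
      nlinarith
  have hlim : Tendsto (fun n : ℕ => (2 * a + M / 2 ^ n) * Real.exp (2 * L * t) * w i) atTop
      (𝓝 ((2 * a + 0) * Real.exp (2 * L * t) * w i)) := by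
    refine ((Tendsto.const_add _ ?_).mul_const _).mul_const _
    have := (tendsto_pow_atTop_nhds_zero_of_lt_one (r := (1 / 2 : ℝ)) (by norm_num)
      (by norm_num)).const_mul M
    simpa [div_eq_mul_inv] using this
  rw [add_zero] at hlim
  exact ge_of_tendsto' hlim fun n => main n i t ht

/-- The solution of a linear equation `q' = a q` with `q 0 = 1` and `|a| ≤ c` lies between
`e^{-ct}` and `e^{ct}`. No regularity of `a` in time is assumed. -/
theorem exp_bounds_of_deriv_eq_mul {T c : ℝ} {q a : ℝ → ℝ} (hq : ContinuousOn q (Icc 0 T))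
    (hq' : ∀ t ∈ Ioo 0 T, HasDerivAt q (a t * q t) t) (ha : ∀ t ∈ Ioo 0 T, |a t| ≤ c)
    (h0 : q 0 = 1) {t : ℝ} (ht : t ∈ Icc 0 T) :
    Real.exp (-(c * t)) ≤ q t ∧ q t ≤ Real.exp (c * t) := by
  have h00 : (0 : ℝ) ∈ Icc 0 T := ⟨le_rfl, ht.1.trans ht.2⟩
  have hder : ∀ σ : ℝ, ∀ s ∈ Ioo 0 T, HasDerivAt (fun s => q s ^ 2 * Real.exp (2 * σ * s))
      (2 * (a s + σ) * (q s ^ 2 * Real.exp (2 * σ * s))) s := by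
    intro σ s hs
    have h1 : HasDerivAt (fun t : ℝ => 2 * σ * t) (2 * σ) s := by
      simpa using (hasDerivAt_id s).const_mul (2 * σ)
    refine (((hq' s hs).fun_pow 2).fun_mul h1.exp).congr_deriv ?_
    simp only [Nat.cast_ofNat, Nat.add_one_sub_one, pow_one]
    ring
  have hcont : ∀ σ : ℝ, ContinuousOn (fun s => q s ^ 2 * Real.exp (2 * σ * s)) (Icc 0 T) :=
    fun σ => (hq.pow 2).mul (by fun_prop)
  have hmono : MonotoneOn (fun s => q s ^ 2 * Real.exp (2 * c * s)) (Icc 0 T) := by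
    refine monotoneOn_of_deriv_nonneg (convex_Icc _ _) (hcont c) ?_ ?_
    · intro s hs
      rw [interior_Icc] at hs
      exact (hder c s hs).differentiableAt.differentiableWithinAt
    · intro s hs
      rw [interior_Icc] at hs
      rw [(hder c s hs).deriv]
      have := (abs_le.1 (ha s hs)).1
      have : 0 ≤ a s + c := by linarith
      positivity
  have hanti : AntitoneOn (fun s => q s ^ 2 * Real.exp (2 * (-c) * s)) (Icc 0 T) := by
    refine antitoneOn_of_deriv_nonpos (convex_Icc _ _) (hcont (-c)) ?_ ?_
    · intro s hs
      rw [interior_Icc] at hs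
      exact (hder (-c) s hs).differentiableAt.differentiableWithinAt
    · intro s hs
      rw [interior_Icc] at hs
      rw [(hder (-c) s hs).deriv]
      have := (abs_le.1 (ha s hs)).2
      have h2 : a s + -c ≤ 0 := by linarith
      have h3 : 0 ≤ q s ^ 2 * Real.exp (2 * (-c) * s) := by positivity
      nlinarith
  have hlow : ∀ s ∈ Icc 0 T, Real.exp (-(c * s)) ≤ |q s| := by
    intro s hs
    have h1 := hmono h00 hs hs.1
    simp only [h0, one_pow, mul_zero, Real.exp_zero, mul_one] at h1
    rw [← Real.sqrt_sq_eq_abs]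
    refine Real.le_sqrt_of_sq_le ?_
    have h2 : Real.exp (-(c * s)) ^ 2 * Real.exp (2 * c * s) = 1 := by
      rw [← Real.exp_nat_mul, ← Real.exp_add]
      simp only [Nat.cast_ofNat]
      ring_nf
      exact Real.exp_zero
    have h3 := Real.exp_pos (2 * c * s)
    nlinarith
  have hpos : 0 < q t := by
    by_contra hneg
    push Not at hneg
    have hivt := intermediate_value_Icc' ht.1 (hq.mono (Icc_subset_Icc_right ht.2))
    obtain ⟨s, hs, hs0⟩ := hivt ⟨hneg, by rw [h0]; exact zero_le_one⟩
    have h1 := hlow s ⟨hs.1, hs.2.trans ht.2⟩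
    rw [hs0, abs_zero] at h1
    exact absurd h1 (not_le.2 (Real.exp_pos _))
  refine ⟨(hlow t ht).trans_eq (abs_of_pos hpos), ?_⟩
  have h1 := hanti h00 ht ht.1
  simp only [h0, one_pow, mul_zero, Real.exp_zero, mul_one] at h1
  refine abs_le_of_sq_le_sq' ?_ (Real.exp_pos _).le |>.2
  have h2 : Real.exp (c * t) ^ 2 * Real.exp (2 * (-c) * t) = 1 := by
    rw [← Real.exp_nat_mul, ← Real.exp_add]
    simp only [Nat.cast_ofNat]
    ring_nf
    exact Real.exp_zero
  have h3 := Real.exp_pos (2 * (-c) * t)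
  nlinarith

/-- Differentiation under the integral sign on a compact time interval. -/
theorem integral_param {μ : Measure ℝ} {T : ℝ} {g g' : ℝ → ℝ → ℝ} {b : ℝ → ℝ}
    (hm : ∀ t ∈ Icc 0 T, AEStronglyMeasurable (g t) μ) (h0 : Integrable (g 0) μ)
    (hd : ∀ ξ, ∀ t ∈ Icc 0 T, HasDerivWithinAt (fun s => g s ξ) (g' t ξ) (Icc 0 T) t)
    (hb : ∀ t ∈ Icc 0 T, ∀ ξ, |g' t ξ| ≤ b ξ) (hbi : Integrable b μ)
    (hm' : ∀ t ∈ Icc 0 T, AEStronglyMeasurable (g' t) μ) :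
    (∀ t ∈ Icc 0 T, Integrable (g t) μ) ∧ ContinuousOn (fun t => ∫ ξ, g t ξ ∂μ) (Icc 0 T) ∧
      ∀ t ∈ Ioo 0 T, HasDerivAt (fun t => ∫ ξ, g t ξ ∂μ) (∫ ξ, g' t ξ ∂μ) t := by
  have hbd : ∀ t ∈ Icc 0 T, ∀ ξ, ‖g t ξ‖ ≤ ‖g 0 ξ‖ + T * b ξ := by
    intro t ht ξ
    have h1 := (convex_Icc 0 T).norm_image_sub_le_of_norm_hasDerivWithin_le (hd ξ)
      (fun s hs => hb s hs ξ) ⟨le_rfl, ht.1.trans ht.2⟩ ht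
    have h2 : 0 ≤ b ξ := (abs_nonneg _).trans (hb t ht ξ)
    have h3 : b ξ * ‖t - 0‖ ≤ T * b ξ := by
      rw [sub_zero, Real.norm_of_nonneg ht.1, mul_comm]
      exact mul_le_mul_of_nonneg_right ht.2 h2
    have h4 := norm_sub_norm_le (g t ξ) (g 0 ξ)
    linarith
  have hbi' : Integrable (fun ξ => ‖g 0 ξ‖ + T * b ξ) μ := h0.norm.add (hbi.const_mul T)
  have hint : ∀ t ∈ Icc 0 T, Integrable (g t) μ := fun t ht =>
    hbi'.mono' (hm t ht) (Eventually.of_forall (hbd t ht))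
  refine ⟨hint, ?_, ?_⟩
  · exact continuousOn_of_dominated hm (fun t ht => Eventually.of_forall (hbd t ht)) hbi'
      (Eventually.of_forall fun ξ t ht => (hd ξ t ht).continuousWithinAt)
  · intro t ht
    have hnhds : Ioo 0 T ∈ 𝓝 t := Ioo_mem_nhds ht.1 ht.2
    refine (hasDerivAt_integral_of_dominated_loc_of_deriv_le hnhds ?_
      (hint t (Ioo_subset_Icc_self ht)) (hm' t (Ioo_subset_Icc_self ht)) ?_ hbi ?_).2
    · filter_upwards [hnhds] with s hs using hm s (Ioo_subset_Icc_self hs)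
    · exact Eventually.of_forall fun ξ s hs => hb s (Ioo_subset_Icc_self hs) ξ
    · exact Eventually.of_forall fun ξ s hs =>
        (hd ξ s (Ioo_subset_Icc_self hs)).hasDerivAt (Icc_mem_nhds hs.1 hs.2)

/-! ### Lipschitz bounds for polynomial expressions -/

/-- A continuously differentiable function of finitely many variables is bounded and Lipschitz on
cubes. -/
theorem exists_lipschitz_cube {n : ℕ} {φ : (Fin n → ℝ) → ℝ} (hφ : ContDiff ℝ 1 φ) (R : ℝ) :
    ∃ L : ℝ, 0 < L ∧ ∀ u v : Fin n → ℝ, (∀ i, |u i| ≤ R) → (∀ i, |v i| ≤ R) →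
      |φ u| ≤ L ∧ ∀ δ, 0 ≤ δ → (∀ i, |u i - v i| ≤ δ) → |φ u - φ v| ≤ L * δ := by
  obtain ⟨K, hK⟩ := hφ.contDiffOn.exists_lipschitzOnWith (s := Metric.closedBall 0 (max R 0))
    (by decide) (convex_closedBall _ _) (isCompact_closedBall _ _)
  obtain ⟨B, hB⟩ := (isCompact_closedBall (0 : Fin n → ℝ) (max R 0)).exists_bound_of_continuousOn
    hφ.continuous.continuousOn
  have hmem : ∀ u : Fin n → ℝ, (∀ i, |u i| ≤ R) → u ∈ Metric.closedBall 0 (max R 0) := by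
    intro u hu
    rw [mem_closedBall_zero_iff, pi_norm_le_iff_of_nonneg (le_max_right _ _)]
    exact fun i => (hu i).trans (le_max_left _ _)
  refine ⟨max (K : ℝ) (max B 1), by positivity, fun u v hu hv => ⟨?_, fun δ hδ h => ?_⟩⟩
  · exact (hB u (hmem u hu)).trans ((le_max_left _ _).trans (le_max_right _ _))
  · have h1 := hK.dist_le_mul _ (hmem u hu) _ (hmem v hv)
    have h2 : dist u v ≤ δ := (dist_pi_le_iff hδ).2 h
    calc |φ u - φ v| ≤ K * dist u v := h1
      _ ≤ max (K : ℝ) (max B 1) * δ := by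
        gcongr
        exact le_max_left _ _

/-! ### The exponential kernel -/

theorem integral_exp_neg_mul_abs {q : ℝ} (hq : 0 < q) : ∫ x : ℝ, Real.exp (-(q * |x|)) = 2 / q := by
  rw [integral_comp_abs (f := fun x => Real.exp (-(q * x)))]
  have := integral_exp_mul_Ioi (a := -q) (by linarith) 0
  simp only [neg_mul] at this
  rw [this]
  simp
  ring

theorem integrable_exp_neg_mul_abs {q : ℝ} (hq : 0 < q) :
    Integrable fun x : ℝ => Real.exp (-(q * |x|)) := by
  by_contra h
  have h1 := integral_exp_neg_mul_abs hq
  rw [integral_undef h] at h1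
  have : 0 < 2 / q := by positivity
  linarith

theorem integrable_kernel {q : ℝ} (hq : 0 < q) (ξ : ℝ) :
    Integrable fun η : ℝ => Real.exp (-(q * |ξ - η|)) :=
  (integrable_exp_neg_mul_abs hq).comp_sub_left ξ

theorem integral_kernel {q : ℝ} (hq : 0 < q) (ξ : ℝ) :
    ∫ η : ℝ, Real.exp (-(q * |ξ - η|)) = 2 / q := by
  rw [integral_sub_left_eq_self (fun x : ℝ => Real.exp (-(q * |x|))) volume ξ,
    integral_exp_neg_mul_abs hq]

/-- Polynomial growth costs half of the decay rate. -/
theorem one_add_mul_exp_neg_le {q x : ℝ} (hq : 0 < q) (hx : 0 ≤ x) :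
    (1 + x) * Real.exp (-(q * x)) ≤ (1 + 2 / q) * Real.exp (-(q / 2 * x)) := by
  have h1 : Real.exp (-(q * x)) = Real.exp (-(q / 2 * x)) * Real.exp (-(q / 2 * x)) := by
    rw [← Real.exp_add]; ring_nf
  have h2 : (1 + x) * Real.exp (-(q / 2 * x)) ≤ 1 + 2 / q := by
    rw [Real.exp_neg, ← div_eq_mul_inv, div_le_iff₀ (Real.exp_pos _)]
    have h3 := Real.add_one_le_exp (q / 2 * x)
    have h4 : 0 ≤ 2 / q := by positivity
    have h5 : (1 + 2 / q) * (q / 2 * x + 1) = 1 + x + 2 / q + q / 2 * x := by field_simp; ring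
    have h6 : 0 ≤ q / 2 * x := by positivity
    nlinarith
  rw [h1, ← mul_assoc]
  exact mul_le_mul_of_nonneg_right h2 (Real.exp_pos _).le

theorem abs_exp_neg_abs_sub_le {a b D : ℝ} (ha : Real.exp (-|a|) ≤ D) (hb : Real.exp (-|b|) ≤ D) :
    |Real.exp (-|a|) - Real.exp (-|b|)| ≤ D * |a - b| := by
  have key : ∀ a b : ℝ, Real.exp (-|a|) ≤ D →
      Real.exp (-|a|) - Real.exp (-|b|) ≤ D * |a - b| := by
    intro a b ha
    have h1 : Real.exp (-|b|) = Real.exp (-|a|) * Real.exp (-(|b| - |a|)) := by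
      rw [← Real.exp_add]; ring_nf
    have h2 := Real.add_one_le_exp (-(|b| - |a|))
    have h3 : |b| - |a| ≤ |a - b| := by rw [abs_sub_comm]; exact abs_sub_abs_le_abs_sub b a
    have h4 := Real.exp_pos (-|a|)
    have h5 := abs_nonneg (a - b)
    rw [h1]
    nlinarith
  rw [abs_le]
  constructor
  · have := key b a hb
    rw [abs_sub_comm] at this
    linarith
  · exact key a b ha

/-! ### The nonlocal terms -/

/-- The integral operator behind `P` and `G`. The factor `s` is `1` for `P` and the sign of
`ξ - η` for `G`. -/
def nonlocal (s y f : ℝ → ℝ) (ξ : ℝ) : ℝ := ∫ η, s η * Real.exp (-|y ξ - y η|) * f η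

theorem lagP_eq_nonlocal (p : Params) (t : ℝ) (X : State) (ξ : ℝ) :
    lagP p t X ξ = 1 / 2 * nonlocal (fun _ => 1) (charY p t X) (source p t X) ξ := by
  simp [lagP, nonlocal]

theorem lagG_eq_nonlocal (p : Params) (t : ℝ) (X : State) (ξ : ℝ) :
    lagG p t X ξ =
      -(1 / 2) * nonlocal (fun η => Real.sign (ξ - η)) (charY p t X) (source p t X) ξ := rfl

theorem abs_sign_le (x : ℝ) : |Real.sign x| ≤ 1 := by
  rcases Real.sign_apply_eq x with h | h | h <;> simp [h]

theorem measurable_sign : Measurable Real.sign := by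
  have : Real.sign = fun x : ℝ => if x < 0 then (-1 : ℝ) else if 0 < x then 1 else 0 := by
    funext x; rfl
  rw [this]
  exact Measurable.ite measurableSet_Iio measurable_const
    (Measurable.ite measurableSet_Ioi measurable_const measurable_const)

section nonlocal

variable {s y y' f f' w d : ℝ → ℝ} {q D F F' ξ : ℝ}

theorem abs_nonlocal_le (hs : ∀ η, |s η| ≤ 1)
    (hy : ∀ᵐ η, Real.exp (-|y ξ - y η|) ≤ D * Real.exp (-(q * |ξ - η|)))
    (hf : ∀ᵐ η, |f η| ≤ w η) (hw : Integrable fun η => Real.exp (-(q * |ξ - η|)) * w η) :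
    |nonlocal s y f ξ| ≤ D * ∫ η, Real.exp (-(q * |ξ - η|)) * w η := by
  rw [← integral_const_mul, nonlocal, ← Real.norm_eq_abs]
  refine norm_integral_le_of_norm_le (hw.const_mul D) ?_
  filter_upwards [hy, hf] with η h1 h2
  rw [Real.norm_eq_abs, abs_mul, abs_mul, abs_of_pos (Real.exp_pos _)]
  calc |s η| * Real.exp (-|y ξ - y η|) * |f η| ≤ 1 * Real.exp (-|y ξ - y η|) * |f η| := by
        gcongr; exact hs η
    _ ≤ (D * Real.exp (-(q * |ξ - η|))) * w η := by
        rw [one_mul]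
        exact mul_le_mul h1 h2 (abs_nonneg _) ((Real.exp_pos _).le.trans h1)
    _ = _ := by ring

theorem integrable_nonlocal (hq : 0 < q) (hs : ∀ η, |s η| ≤ 1) (hsm : Measurable s)
    (hy : ∀ᵐ η, Real.exp (-|y ξ - y η|) ≤ D * Real.exp (-(q * |ξ - η|)))
    (hym : AEStronglyMeasurable y volume) (hf : ∀ᵐ η, |f η| ≤ F)
    (hfm : AEStronglyMeasurable f volume) :
    Integrable fun η => s η * Real.exp (-|y ξ - y η|) * f η := by
  refine Integrable.mono' (((integrable_kernel hq ξ).const_mul D).mul_const F) ?_ ?_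
  · refine (hsm.aestronglyMeasurable.mul ?_).mul hfm
    have h1 : AEStronglyMeasurable (fun η => y ξ - y η) volume :=
      aestronglyMeasurable_const.sub hym
    exact (show Continuous fun x : ℝ => Real.exp (-|x|) by fun_prop).comp_aestronglyMeasurable h1
  · filter_upwards [hy, hf] with η h1 h2
    rw [Real.norm_eq_abs, abs_mul, abs_mul, abs_of_pos (Real.exp_pos _)]
    calc |s η| * Real.exp (-|y ξ - y η|) * |f η| ≤ 1 * Real.exp (-|y ξ - y η|) * |f η| := by
          gcongr; exact hs η
      _ ≤ (D * Real.exp (-(q * |ξ - η|))) * F := by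
          rw [one_mul]
          exact mul_le_mul h1 h2 (abs_nonneg _) ((Real.exp_pos _).le.trans h1)

theorem abs_nonlocal_sub_le (hq : 0 < q) (hs : ∀ η, |s η| ≤ 1) (hsm : Measurable s)
    (hy : ∀ᵐ η, Real.exp (-|y ξ - y η|) ≤ D * Real.exp (-(q * |ξ - η|)))
    (hy' : ∀ᵐ η, Real.exp (-|y' ξ - y' η|) ≤ D * Real.exp (-(q * |ξ - η|)))
    (hym : AEStronglyMeasurable y volume) (hym' : AEStronglyMeasurable y' volume)
    (hf : ∀ᵐ η, |f η| ≤ F) (hf' : ∀ᵐ η, |f' η| ≤ F)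
    (hfm : AEStronglyMeasurable f volume) (hfm' : AEStronglyMeasurable f' volume)
    (hff : ∀ᵐ η, |f η - f' η| ≤ F')
    (hd : ∀ᵐ η, |(y ξ - y η) - (y' ξ - y' η)| ≤ d η)
    (hdi : Integrable fun η => Real.exp (-(q * |ξ - η|)) * (d η * F + F')) :
    |nonlocal s y f ξ - nonlocal s y' f' ξ| ≤
      D * ∫ η, Real.exp (-(q * |ξ - η|)) * (d η * F + F') := by
  unfold nonlocal
  rw [← integral_sub (integrable_nonlocal hq hs hsm hy hym hf hfm)
    (integrable_nonlocal hq hs hsm hy' hym' hf' hfm'), ← integral_const_mul,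
    ← Real.norm_eq_abs]
  refine norm_integral_le_of_norm_le (hdi.const_mul D) ?_
  filter_upwards [hy, hy', hf, hff, hd] with η h1 h2 h3 h4 h5
  have h6 := abs_exp_neg_abs_sub_le h1 h2
  have h0 : 0 ≤ D * Real.exp (-(q * |ξ - η|)) := (Real.exp_pos _).le.trans h1
  have e : s η * Real.exp (-|y ξ - y η|) * f η - s η * Real.exp (-|y' ξ - y' η|) * f' η =
      s η * ((Real.exp (-|y ξ - y η|) - Real.exp (-|y' ξ - y' η|)) * f η +
        Real.exp (-|y' ξ - y' η|) * (f η - f' η)) := by ring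
  rw [Real.norm_eq_abs, e, abs_mul]
  calc _ ≤ 1 * (|Real.exp (-|y ξ - y η|) - Real.exp (-|y' ξ - y' η|)| * |f η| +
        Real.exp (-|y' ξ - y' η|) * |f η - f' η|) := by
        refine mul_le_mul (hs η) ?_ (abs_nonneg _) zero_le_one
        refine (abs_add_le _ _).trans ?_
        rw [abs_mul, abs_mul, abs_of_pos (Real.exp_pos (-|y' ξ - y' η|))]
    _ ≤ D * Real.exp (-(q * |ξ - η|)) * d η * F + D * Real.exp (-(q * |ξ - η|)) * F' := by
        rw [one_mul]
        have h7 : |Real.exp (-|y ξ - y η|) - Real.exp (-|y' ξ - y' η|)| ≤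
            D * Real.exp (-(q * |ξ - η|)) * d η := h6.trans (mul_le_mul_of_nonneg_left h5 h0)
        exact add_le_add (mul_le_mul h7 h3 (abs_nonneg _) ((abs_nonneg _).trans h7))
          (mul_le_mul h2 h4 (abs_nonneg _) h0)
    _ = _ := by ring

end nonlocal

/-! ### Local Lipschitz bounds for the right-hand side -/

/-- The properties of the initial data on which the analysis rests. -/
structure Admissible (X₀ : State) : Prop where
  isPrim_Y : IsPrim (fun ξ => X₀.Z ξ + ξ) (fun ξ => 1 - X₀.V ξ)
  isPrim_K : IsPrim X₀.K X₀.W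
  measurable_V : Measurable X₀.V
  measurable_W : Measurable X₀.W
  constraint : ∀ ξ, X₀.W ξ ^ 2 + X₀.V ξ ^ 2 = X₀.V ξ
  integrable_V : Integrable X₀.V volume
  integrable_K_sq : Integrable (fun ξ => X₀.K ξ ^ 2) volume
  Q_eq : ∀ ξ, X₀.Q ξ = 1

/-- The values of the components of `X` at `ξ` (that of `Z` relative to `X₀`) are at most `R`. -/
structure BoundedAt (X₀ X : State) (R ξ : ℝ) : Prop where
  Z : |X.Z ξ - X₀.Z ξ| ≤ R
  K : |X.K ξ| ≤ R
  V : |X.V ξ| ≤ R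
  W : |X.W ξ| ≤ R
  Q : |X.Q ξ| ≤ R

/-- The values of the components of `X` and `Y` at `ξ` differ by at most `δ`. -/
structure CloseAt (X Y : State) (δ ξ : ℝ) : Prop where
  Z : |X.Z ξ - Y.Z ξ| ≤ δ
  K : |X.K ξ - Y.K ξ| ≤ δ
  V : |X.V ξ - Y.V ξ| ≤ δ
  W : |X.W ξ - Y.W ξ| ≤ δ
  Q : |X.Q ξ - Y.Q ξ| ≤ δ

/-- All components of a state are almost everywhere strongly measurable. -/
structure State.AESM (X : State) : Prop where
  Z : AEStronglyMeasurable X.Z volume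
  K : AEStronglyMeasurable X.K volume
  V : AEStronglyMeasurable X.V volume
  W : AEStronglyMeasurable X.W volume
  Q : AEStronglyMeasurable X.Q volume

theorem V_mem_of_constraint {v w : ℝ} (h : w ^ 2 + v ^ 2 = v) : 0 ≤ v ∧ v ≤ 1 ∧ |w| ≤ 1 / 2 := by
  refine ⟨by nlinarith [sq_nonneg w, sq_nonneg v], by nlinarith [sq_nonneg w], ?_⟩
  refine abs_le_of_sq_le_sq ?_ (by norm_num)
  nlinarith [sq_nonneg (v - 1 / 2)]

section

variable (p : Params)

/-- The constant in the decay `e^{-|y(ξ) - y(η)|} ≤ C e^{-|ξ - η|}` for states within distance `R`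
of `X₀`. -/
def kernelConst (X₀ : State) (R : ℝ) : ℝ := Real.exp ((∫ ξ, X₀.V ξ) + 2 * R)

theorem kernelConst_pos (X₀ : State) (R : ℝ) : 0 < kernelConst X₀ R := Real.exp_pos _

namespace Admissible

variable {p} {X₀ X Y : State} (h₀ : Admissible X₀)
include h₀

theorem V_nonneg (ξ : ℝ) : 0 ≤ X₀.V ξ := (V_mem_of_constraint (h₀.constraint ξ)).1

/-- The initial characteristic moves with speed almost `1` on large scales, because the part of
the line on which `V` is large has finite measure. -/
theorem abs_sub_le_Y (ξ η : ℝ) :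
    |ξ - η| - ∫ x, X₀.V x ≤ |(X₀.Z ξ + ξ) - (X₀.Z η + η)| := by
  have key : ∀ ξ η : ℝ, η ≤ ξ → |ξ - η| - ∫ x, X₀.V x ≤ |(X₀.Z ξ + ξ) - (X₀.Z η + η)| := by
    intro ξ η h
    rw [← h₀.isPrim_Y.integral_eq, intervalIntegral.integral_sub (by simp)
      h₀.integrable_V.intervalIntegrable, abs_of_nonneg (sub_nonneg.2 h)]
    refine le_trans ?_ (le_abs_self _)
    have : ∫ x in η..ξ, X₀.V x ≤ ∫ x, X₀.V x := by
      rw [intervalIntegral.integral_of_le h]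
      exact setIntegral_le_integral h₀.integrable_V (Eventually.of_forall h₀.V_nonneg)
    simp only [intervalIntegral.integral_const, smul_eq_mul, mul_one]
    linarith
  rcases le_total η ξ with h | h
  · exact key ξ η h
  · have := key η ξ h
    rwa [abs_sub_comm η ξ, abs_sub_comm (X₀.Z η + η)] at this

theorem exp_charY_le {R t ξ η : ℝ} (hξ : |X.Z ξ - X₀.Z ξ| ≤ R) (hη : |X.Z η - X₀.Z η| ≤ R) :
    Real.exp (-|charY p t X ξ - charY p t X η|) ≤
      kernelConst X₀ R * Real.exp (-(1 * |ξ - η|)) := by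
  rw [kernelConst, ← Real.exp_add, Real.exp_le_exp]
  have h1 := h₀.abs_sub_le_Y ξ η
  have h2 : (X₀.Z ξ + ξ) - (X₀.Z η + η) = (charY p t X ξ - charY p t X η) -
      (X.Z ξ - X₀.Z ξ) + (X.Z η - X₀.Z η) := by simp only [charY]; ring
  have h3 : |(X₀.Z ξ + ξ) - (X₀.Z η + η)| ≤ |charY p t X ξ - charY p t X η| + R + R := by
    rw [h2]
    refine (abs_add_le _ _).trans (add_le_add ((abs_sub _ _).trans ?_) hη)
    exact add_le_add le_rfl hξ
  linarith

end Admissible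

/-- `H` as a polynomial in `e = e^{-λt}` and `K`. -/
def hamilPoly (e K : ℝ) : ℝ :=
  (p.α + p.Γ) * K + p.β * e ^ 2 / 3 * K ^ 3 + p.γ * e ^ 3 / 4 * K ^ 4

theorem hamil_eq (t K : ℝ) : hamil p t K = hamilPoly p (Real.exp (-p.lam * t)) K := by
  have h2 : Real.exp (-2 * p.lam * t) = Real.exp (-p.lam * t) ^ 2 := by
    rw [← Real.exp_nat_mul]; congr 1; push_cast; ring
  have h3 : Real.exp (-3 * p.lam * t) = Real.exp (-p.lam * t) ^ 3 := by
    rw [← Real.exp_nat_mul]; congr 1; push_cast; ring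
  rw [hamil, hamilPoly, h2, h3]

/-- The quantities `e^{-λt}, K, V, W, Q, P` at one point, of which the local terms of the system
are polynomials. -/
def localVec (e : ℝ) (X : State) (P ξ : ℝ) : Fin 6 → ℝ := ![e, X.K ξ, X.V ξ, X.W ξ, X.Q ξ, P]

/-- The source term as a polynomial. -/
def polySource (u : Fin 6 → ℝ) : ℝ :=
  -hamilPoly p (u 0) (u 1) * u 4 * (1 - u 2) + u 0 * u 1 ^ 2 * u 4 * (1 - u 2)
    + u 0 / 2 * u 4 * u 2

/-- The common factor of the equations for `V` and `W` as a polynomial. -/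
def polyFactor (u : Fin 6 → ℝ) : ℝ :=
  u 0 * u 1 ^ 2 * (1 - u 2) - hamilPoly p (u 0) (u 1) * (1 - u 2) - u 0 / 2 * u 2
    - u 5 * (1 - u 2)

/-- The right-hand side of the equation for `V` as a polynomial. -/
def polyV (u : Fin 6 → ℝ) : ℝ := 2 * u 3 * polyFactor p u

/-- The right-hand side of the equation for `W` as a polynomial. -/
def polyW (u : Fin 6 → ℝ) : ℝ := (1 - 2 * u 2) * polyFactor p u

/-- The right-hand side of the equation for `Q` as a polynomial. -/
def polyQ (u : Fin 6 → ℝ) : ℝ :=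
  2 * u 3 * u 4 * (u 0 / 2 + u 0 * u 1 ^ 2 - hamilPoly p (u 0) (u 1) - u 5)

theorem source_eq (t : ℝ) (X : State) (P η : ℝ) :
    source p t X η = polySource p (localVec (Real.exp (-p.lam * t)) X P η) := by
  rw [source, hamil_eq]; rfl

theorem field_V_eq (t : ℝ) (X : State) (ξ : ℝ) : (field p t X).V ξ =
    polyV p (localVec (Real.exp (-p.lam * t)) X (lagP p t X ξ) ξ) := by
  simp only [field, factorVW, hamil_eq]; rfl

theorem field_W_eq (t : ℝ) (X : State) (ξ : ℝ) : (field p t X).W ξ =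
    polyW p (localVec (Real.exp (-p.lam * t)) X (lagP p t X ξ) ξ) := by
  simp only [field, factorVW, hamil_eq]; rfl

theorem field_Q_eq (t : ℝ) (X : State) (ξ : ℝ) : (field p t X).Q ξ =
    polyQ p (localVec (Real.exp (-p.lam * t)) X (lagP p t X ξ) ξ) := by
  simp only [field, hamil_eq]; rfl

theorem contDiff_polySource : ContDiff ℝ 1 (polySource p) := by
  unfold polySource hamilPoly; fun_prop

theorem contDiff_polyV : ContDiff ℝ 1 (polyV p) := by
  unfold polyV polyFactor hamilPoly; fun_prop

theorem contDiff_polyW : ContDiff ℝ 1 (polyW p) := by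
  unfold polyW polyFactor hamilPoly; fun_prop

theorem contDiff_polyQ : ContDiff ℝ 1 (polyQ p) := by
  unfold polyQ hamilPoly; fun_prop

theorem exists_poly_const (R : ℝ) : ∃ L : ℝ, 0 < L ∧
    ∀ φ ∈ ({polySource p, polyV p, polyW p, polyQ p} : Set ((Fin 6 → ℝ) → ℝ)),
      ∀ u v : Fin 6 → ℝ, (∀ i, |u i| ≤ R) → (∀ i, |v i| ≤ R) →
      |φ u| ≤ L ∧ ∀ δ, 0 ≤ δ → (∀ i, |u i - v i| ≤ δ) → |φ u - φ v| ≤ L * δ := by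
  obtain ⟨L1, p1, h1⟩ := exists_lipschitz_cube (contDiff_polySource p) R
  obtain ⟨L2, p2, h2⟩ := exists_lipschitz_cube (contDiff_polyV p) R
  obtain ⟨L3, p3, h3⟩ := exists_lipschitz_cube (contDiff_polyW p) R
  obtain ⟨L4, p4, h4⟩ := exists_lipschitz_cube (contDiff_polyQ p) R
  refine ⟨L1 + L2 + L3 + L4, by positivity, ?_⟩
  have aux : ∀ (φ : (Fin 6 → ℝ) → ℝ) (L' : ℝ), L' ≤ L1 + L2 + L3 + L4 →
      (∀ u v : Fin 6 → ℝ, (∀ i, |u i| ≤ R) → (∀ i, |v i| ≤ R) →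
      |φ u| ≤ L' ∧ ∀ δ, 0 ≤ δ → (∀ i, |u i - v i| ≤ δ) → |φ u - φ v| ≤ L' * δ) →
      ∀ u v : Fin 6 → ℝ, (∀ i, |u i| ≤ R) → (∀ i, |v i| ≤ R) →
      |φ u| ≤ L1 + L2 + L3 + L4 ∧ ∀ δ, 0 ≤ δ → (∀ i, |u i - v i| ≤ δ) →
        |φ u - φ v| ≤ (L1 + L2 + L3 + L4) * δ := by
    intro φ L' hL' h u v hu hv
    exact ⟨(h u v hu hv).1.trans hL', fun δ hδ hd =>
      ((h u v hu hv).2 δ hδ hd).trans (mul_le_mul_of_nonneg_right hL' hδ)⟩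
  rintro φ (rfl | rfl | rfl | rfl)
  · exact aux _ L1 (by linarith) h1
  · exact aux _ L2 (by linarith) h2
  · exact aux _ L3 (by linarith) h3
  · exact aux _ L4 (by linarith) h4

theorem abs_localVec_le {X₀ X : State} {R ξ e P : ℝ} (h : BoundedAt X₀ X R ξ) (he : |e| ≤ R)
    (hP : |P| ≤ R) (i : Fin 6) : |localVec e X P ξ i| ≤ R := by
  fin_cases i
  exacts [he, h.K, h.V, h.W, h.Q, hP]

theorem abs_localVec_sub_le {X Y : State} {δ ξ e e' P P' : ℝ} (h : CloseAt X Y δ ξ)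
    (he : |e - e'| ≤ δ) (hP : |P - P'| ≤ δ) (i : Fin 6) :
    |localVec e X P ξ i - localVec e' Y P' ξ i| ≤ δ := by
  fin_cases i
  exacts [he, h.K, h.V, h.W, h.Q, hP]

theorem BoundedAt.mono {X₀ X : State} {R R' ξ : ℝ} (h : BoundedAt X₀ X R ξ) (hR : R ≤ R') :
    BoundedAt X₀ X R' ξ :=
  ⟨h.Z.trans hR, h.K.trans hR, h.V.trans hR, h.W.trans hR, h.Q.trans hR⟩

theorem CloseAt.mono {X Y : State} {δ δ' ξ : ℝ} (h : CloseAt X Y δ ξ) (hδ : δ ≤ δ') :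
    CloseAt X Y δ' ξ :=
  ⟨h.Z.trans hδ, h.K.trans hδ, h.V.trans hδ, h.W.trans hδ, h.Q.trans hδ⟩

theorem State.AESM.charY {X : State} (h : X.AESM) (t : ℝ) :
    AEStronglyMeasurable (charY p t X) volume :=
  (h.Z.add aestronglyMeasurable_id).add aestronglyMeasurable_const

theorem State.AESM.source {X : State} (h : X.AESM) (t : ℝ) :
    AEStronglyMeasurable (source p t X) volume := by
  have hK := h.K.aemeasurable
  have hV := h.V.aemeasurable
  have hQ := h.Q.aemeasurable
  apply AEMeasurable.aestronglyMeasurable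
  unfold LagrangianCH.source hamil
  fun_prop

theorem exp_lam_le {p : Params} (hlam : 0 < p.lam) {t : ℝ} (ht : 0 ≤ t) :
    |Real.exp (-p.lam * t)| ≤ 1 := by
  rw [abs_of_pos (Real.exp_pos _), Real.exp_le_one_iff]
  nlinarith

/-- The right-hand side of the system is bounded and Lipschitz on bounded sets, uniformly in time
and with respect to the supremum norm, which also controls the nonlocal terms. -/
theorem Admissible.exists_field_const {p : Params} (hlam : 0 < p.lam) {X₀ : State}
    (h₀ : Admissible X₀) (R : ℝ) :
    ∃ L : ℝ, 0 < L ∧ ∀ t t' : ℝ, 0 ≤ t → 0 ≤ t' → ∀ X Y : State, X.AESM → Y.AESM →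
      (∀ᵐ η, BoundedAt X₀ X R η) → (∀ᵐ η, BoundedAt X₀ Y R η) → ∀ δ, 0 ≤ δ →
      |Real.exp (-p.lam * t) - Real.exp (-p.lam * t')| ≤ δ → (∀ᵐ η, CloseAt X Y δ η) →
      ∀ ξ, BoundedAt X₀ X R ξ → BoundedAt X₀ Y R ξ → CloseAt X Y δ ξ →
        |lagP p t X ξ| ≤ L ∧ |(field p t X).Z ξ| ≤ L ∧ |(field p t X).K ξ| ≤ L ∧
        |(field p t X).V ξ| ≤ L ∧ |(field p t X).W ξ| ≤ L ∧ |(field p t X).Q ξ| ≤ L ∧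
        CloseAt (field p t X) (field p t' Y) (L * δ) ξ := by
  set R₁ := max R 1 with hR₁
  have hRR₁ : R ≤ R₁ := le_max_left _ _
  have h1R₁ : 1 ≤ R₁ := le_max_right _ _
  obtain ⟨L₁, hL₁, H₁⟩ := exists_poly_const p R₁
  set D := kernelConst X₀ R with hD
  have hDpos : 0 < D := kernelConst_pos _ _
  -- the nonlocal terms are bounded by `B` and have Lipschitz constant `B'`
  set B := D * L₁ with hB
  set B' := D * 3 * L₁ with hB'
  have hBpos : 0 < B := by positivity
  have hB'pos : 0 < B' := by positivity
  set R₂ := max R₁ B with hR₂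
  obtain ⟨L₂, hL₂, H₂⟩ := exists_poly_const p R₂
  refine ⟨L₂ * (B' + 1) + L₂ + R₁ + 1 + B + B', by positivity, ?_⟩
  set L := L₂ * (B' + 1) + L₂ + R₁ + 1 + B + B' with hL
  intro t t' ht ht' X Y hXm hYm hXb hYb δ hδ he hXY ξ hXξ hYξ hXYξ
  have e1 := exp_lam_le hlam ht
  have e2 := exp_lam_le hlam ht'
  have hsrcX : ∀ᵐ η, |source p t X η| ≤ L₁ := by
    filter_upwards [hXb] with η hη
    rw [source_eq p t X 0]
    have hv := abs_localVec_le (hη.mono hRR₁) (e1.trans h1R₁) (P := 0) (by simp; linarith)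
    exact (H₁ _ (by simp) _ _ hv hv).1
  have hsrcY : ∀ᵐ η, |source p t' Y η| ≤ L₁ := by
    filter_upwards [hYb] with η hη
    rw [source_eq p t' Y 0]
    have hv := abs_localVec_le (hη.mono hRR₁) (e2.trans h1R₁) (P := 0) (by simp; linarith)
    exact (H₁ _ (by simp) _ _ hv hv).1
  have hsrc : ∀ᵐ η, |source p t X η - source p t' Y η| ≤ L₁ * δ := by
    filter_upwards [hXb, hYb, hXY] with η h1 h2 h3
    rw [source_eq p t X 0, source_eq p t' Y 0]
    exact (H₁ _ (by simp) _ _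
      (abs_localVec_le (h1.mono hRR₁) (e1.trans h1R₁) (P := 0) (by simp; linarith))
      (abs_localVec_le (h2.mono hRR₁) (e2.trans h1R₁) (P := 0) (by simp; linarith))).2 δ hδ
      (abs_localVec_sub_le h3 he (by simpa using hδ))
  have hkX : ∀ᵐ η, Real.exp (-|charY p t X ξ - charY p t X η|) ≤ D * Real.exp (-(1 * |ξ - η|)) := by
    filter_upwards [hXb] with η hη using h₀.exp_charY_le hXξ.Z hη.Z
  have hkY : ∀ᵐ η, Real.exp (-|charY p t' Y ξ - charY p t' Y η|) ≤
      D * Real.exp (-(1 * |ξ - η|)) := by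
    filter_upwards [hYb] with η hη using h₀.exp_charY_le hYξ.Z hη.Z
  have hint : ∀ c : ℝ, Integrable fun η => Real.exp (-(1 * |ξ - η|)) * c := fun c =>
    (integrable_kernel one_pos ξ).mul_const c
  have hval : ∀ c : ℝ, ∫ η, Real.exp (-(1 * |ξ - η|)) * c = 2 * c := fun c => by
    rw [integral_mul_const, integral_kernel one_pos]; norm_num
  have hbd : ∀ s : ℝ → ℝ, (∀ η, |s η| ≤ 1) →
      |nonlocal s (charY p t X) (source p t X) ξ| ≤ D * (2 * L₁) := fun s hs => by
    rw [← hval]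
    exact abs_nonlocal_le hs hkX hsrcX (hint _)
  have hbdY : ∀ s : ℝ → ℝ, (∀ η, |s η| ≤ 1) →
      |nonlocal s (charY p t' Y) (source p t' Y) ξ| ≤ D * (2 * L₁) := fun s hs => by
    rw [← hval]
    exact abs_nonlocal_le hs hkY hsrcY (hint _)
  have hlip : ∀ s : ℝ → ℝ, (∀ η, |s η| ≤ 1) → Measurable s →
      |nonlocal s (charY p t X) (source p t X) ξ - nonlocal s (charY p t' Y) (source p t' Y) ξ| ≤
        D * (2 * (2 * δ * L₁ + L₁ * δ)) := fun s hs hsm => by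
    rw [← hval]
    refine abs_nonlocal_sub_le one_pos hs hsm hkX hkY (hXm.charY p t) (hYm.charY p t') hsrcX hsrcY
      (hXm.source p t) (hYm.source p t') hsrc (d := fun _ => 2 * δ) ?_ (hint _)
    filter_upwards [hXY] with η hη
    have e : (charY p t X ξ - charY p t X η) - (charY p t' Y ξ - charY p t' Y η) =
        (X.Z ξ - Y.Z ξ) - (X.Z η - Y.Z η) := by simp only [charY]; ring
    rw [e]
    refine (abs_sub _ _).trans ?_
    linarith [hXYξ.Z, hη.Z]
  have hP : |lagP p t X ξ| ≤ B := by
    rw [lagP_eq_nonlocal, abs_mul]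
    have := hbd (fun _ => 1) (by simp)
    norm_num
    linarith
  have hPY : |lagP p t' Y ξ| ≤ B := by
    rw [lagP_eq_nonlocal, abs_mul]
    have := hbdY (fun _ => 1) (by simp)
    norm_num
    linarith
  have hPd : |lagP p t X ξ - lagP p t' Y ξ| ≤ B' * δ := by
    rw [lagP_eq_nonlocal, lagP_eq_nonlocal, ← mul_sub, abs_mul]
    have := hlip (fun _ => 1) (by simp) measurable_const
    norm_num
    linarith
  have hsm : Measurable fun η => Real.sign (ξ - η) :=
    measurable_sign.comp (measurable_const.sub measurable_id)
  have hG : |(field p t X).K ξ| ≤ B := by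
    change |-lagG p t X ξ| ≤ B
    rw [lagG_eq_nonlocal, abs_neg, abs_mul]
    have := hbd (fun η => Real.sign (ξ - η)) (fun _ => abs_sign_le _)
    norm_num
    linarith
  have hGd : |(field p t X).K ξ - (field p t' Y).K ξ| ≤ B' * δ := by
    change |-lagG p t X ξ - -lagG p t' Y ξ| ≤ B' * δ
    rw [lagG_eq_nonlocal, lagG_eq_nonlocal, ← neg_mul, ← neg_mul, ← mul_sub, abs_mul]
    have := hlip (fun η => Real.sign (ξ - η)) (fun _ => abs_sign_le _) hsm
    norm_num
    linarith
  have hR₁₂ : R₁ ≤ R₂ := le_max_left _ _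
  have hvX := abs_localVec_le (hXξ.mono (hRR₁.trans hR₁₂)) (e1.trans (h1R₁.trans hR₁₂))
    (hP.trans (le_max_right _ _))
  have hvY := abs_localVec_le (hYξ.mono (hRR₁.trans hR₁₂)) (e2.trans (h1R₁.trans hR₁₂))
    (hPY.trans (le_max_right _ _))
  have hδ' : 0 ≤ (B' + 1) * δ := by positivity
  have hδδ : δ ≤ (B' + 1) * δ := by nlinarith
  have hvd := abs_localVec_sub_le (hXYξ.mono hδδ) (he.trans hδδ)
    (hPd.trans (mul_le_mul_of_nonneg_right (by linarith) hδ) :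
      |lagP p t X ξ - lagP p t' Y ξ| ≤ (B' + 1) * δ)
  have hLL : ∀ c, c ≤ L₂ * (B' + 1) + R₁ + 1 + B' → c * δ ≤ L * δ := fun c hc =>
    mul_le_mul_of_nonneg_right (by rw [hL]; linarith) hδ
  have hL₂B : 0 < L₂ * B' := by positivity
  have hpoly : ∀ φ ∈ ({polySource p, polyV p, polyW p, polyQ p} : Set ((Fin 6 → ℝ) → ℝ)),
      |φ (localVec (Real.exp (-p.lam * t)) X (lagP p t X ξ) ξ)| ≤ L ∧
      |φ (localVec (Real.exp (-p.lam * t)) X (lagP p t X ξ) ξ) -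
        φ (localVec (Real.exp (-p.lam * t')) Y (lagP p t' Y ξ) ξ)| ≤ L * δ := fun φ hφ => by
    obtain ⟨ha, hb⟩ := H₂ φ hφ _ _ hvX hvY
    refine ⟨ha.trans ?_, (hb _ hδ' hvd).trans ?_⟩
    · rw [hL]; nlinarith
    · rw [← mul_assoc]
      exact hLL _ (by linarith)
  have hZ : |(field p t X).Z ξ| ≤ R₁ := by
    change |Real.exp (-p.lam * t) * X.K ξ| ≤ R₁
    rw [abs_mul]
    calc _ ≤ 1 * |X.K ξ| := by gcongr
      _ ≤ R₁ := by rw [one_mul]; exact hXξ.K.trans hRR₁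
  have hZd : |(field p t X).Z ξ - (field p t' Y).Z ξ| ≤ (R₁ + 1) * δ := by
    change |Real.exp (-p.lam * t) * X.K ξ - Real.exp (-p.lam * t') * Y.K ξ| ≤ (R₁ + 1) * δ
    have e : Real.exp (-p.lam * t) * X.K ξ - Real.exp (-p.lam * t') * Y.K ξ =
        (Real.exp (-p.lam * t) - Real.exp (-p.lam * t')) * X.K ξ +
          Real.exp (-p.lam * t') * (X.K ξ - Y.K ξ) := by ring
    rw [e]
    refine (abs_add_le _ _).trans ?_
    rw [abs_mul, abs_mul]
    have a1 : |Real.exp (-p.lam * t) - Real.exp (-p.lam * t')| * |X.K ξ| ≤ δ * R₁ :=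
      mul_le_mul he (hXξ.K.trans hRR₁) (abs_nonneg _) hδ
    have a2 : |Real.exp (-p.lam * t')| * |X.K ξ - Y.K ξ| ≤ 1 * δ :=
      mul_le_mul e2 hXYξ.K (abs_nonneg _) zero_le_one
    linarith
  have hLB : B ≤ L := by rw [hL]; nlinarith
  have hLR : R₁ ≤ L := by rw [hL]; nlinarith
  rw [field_V_eq, field_W_eq, field_Q_eq]
  refine ⟨hP.trans hLB, hZ.trans hLR, hG.trans hLB, (hpoly (polyV p) (by simp)).1,
    (hpoly (polyW p) (by simp)).1, (hpoly (polyQ p) (by simp)).1, ?_⟩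
  constructor
  · exact hZd.trans (hLL _ (by nlinarith))
  · exact hGd.trans (hLL _ (by nlinarith))
  · rw [field_V_eq, field_V_eq]
    exact (hpoly (polyV p) (by simp)).2
  · rw [field_W_eq, field_W_eq]
    exact (hpoly (polyW p) (by simp)).2
  · rw [field_Q_eq, field_Q_eq]
    exact (hpoly (polyQ p) (by simp)).2

end

/-! ### Classical solutions and uniqueness -/

/-- The five components of a state as a family. -/
def State.comp (X : State) : Fin 5 → ℝ → ℝ := ![X.Z, X.K, X.V, X.W, X.Q]

theorem closeAt_iff {X Y : State} {δ ξ : ℝ} :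
    CloseAt X Y δ ξ ↔ ∀ i, |X.comp i ξ - Y.comp i ξ| ≤ δ := by
  constructor
  · intro h i
    fin_cases i
    exacts [h.Z, h.K, h.V, h.W, h.Q]
  · intro h
    exact ⟨h 0, h 1, h 2, h 3, h 4⟩

theorem State.eq_of_closeAt {X Y : State} (h : ∀ ξ, CloseAt X Y 0 ξ) : X = Y := by
  have key : ∀ i, X.comp i = Y.comp i := fun i => funext fun ξ => by
    have := closeAt_iff.1 (h ξ) i
    exact sub_eq_zero.1 (abs_nonpos_iff.1 this)
  have h0 := key 0
  have h1 := key 1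
  have h2 := key 2
  have h3 := key 3
  have h4 := key 4
  cases X; cases Y
  simp only [State.comp, Matrix.cons_val] at h0 h1 h2 h3 h4
  subst h0 h1 h2 h3 h4
  rfl

/-- All components of a state are measurable. -/
structure State.Meas (X : State) : Prop where
  Z : Measurable X.Z
  K : Measurable X.K
  V : Measurable X.V
  W : Measurable X.W
  Q : Measurable X.Q

theorem State.Meas.aesm {X : State} (h : X.Meas) : X.AESM :=
  ⟨h.Z.aestronglyMeasurable, h.K.aestronglyMeasurable, h.V.aestronglyMeasurable,
    h.W.aestronglyMeasurable, h.Q.aestronglyMeasurable⟩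

section

variable (p : Params)

/-- The five equations hold at the point `ξ` throughout `[0, T]`. -/
def SolvesAt (T : ℝ) (X : ℝ → State) (ξ : ℝ) : Prop :=
  ∀ t ∈ Icc 0 T, ∀ i,
    HasDerivWithinAt (fun s => (X s).comp i ξ) ((field p t (X t)).comp i ξ) (Icc 0 T) t

/-- Bounded solutions for which the equations hold everywhere, not just almost everywhere, in the
Lagrangian variable. -/
structure ClassicalOn (X₀ : State) (T R : ℝ) (X : ℝ → State) : Prop where
  meas : ∀ t ∈ Icc 0 T, (X t).Meas
  bounded : ∀ t ∈ Icc 0 T, ∀ ξ, BoundedAt X₀ (X t) R ξ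
  initial : X 0 = X₀
  equation : ∀ ξ, SolvesAt p T X ξ

theorem SolvesAt.mono {p : Params} {T T' : ℝ} {X : ℝ → State} {ξ : ℝ} (h : SolvesAt p T X ξ)
    (hT : T' ≤ T) : SolvesAt p T' X ξ := fun t ht i =>
  (h t ⟨ht.1, ht.2.trans hT⟩ i).mono (Icc_subset_Icc_right hT)

theorem ClassicalOn.mono {p : Params} {X₀ : State} {T T' R R' : ℝ} {X : ℝ → State}
    (h : ClassicalOn p X₀ T R X) (hT : T' ≤ T) (hR : R ≤ R') : ClassicalOn p X₀ T' R' X :=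
  ⟨fun t ht => h.meas t ⟨ht.1, ht.2.trans hT⟩,
    fun t ht ξ => (h.bounded t ⟨ht.1, ht.2.trans hT⟩ ξ).mono hR, h.initial,
    fun ξ => (h.equation ξ).mono hT⟩

/-- Two bounded solutions with the same initial values agree. Everything takes place on a set `S`
of full measure. -/
theorem closeAt_zero_of_solvesAt {p : Params} (hlam : 0 < p.lam) {X₀ : State}
    (h₀ : Admissible X₀) {T R : ℝ} {X Y : ℝ → State} {S : Set ℝ} (hS : ∀ᵐ ξ, ξ ∈ S)
    (hXm : ∀ t ∈ Icc 0 T, (X t).AESM) (hYm : ∀ t ∈ Icc 0 T, (Y t).AESM)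
    (hXb : ∀ t ∈ Icc 0 T, ∀ ξ ∈ S, BoundedAt X₀ (X t) R ξ)
    (hYb : ∀ t ∈ Icc 0 T, ∀ ξ ∈ S, BoundedAt X₀ (Y t) R ξ)
    (hX : ∀ ξ ∈ S, SolvesAt p T X ξ) (hY : ∀ ξ ∈ S, SolvesAt p T Y ξ)
    (h0 : ∀ ξ ∈ S, CloseAt (X 0) (Y 0) 0 ξ) :
    ∀ t ∈ Icc 0 T, ∀ ξ ∈ S, CloseAt (X t) (Y t) 0 ξ := by
  obtain ⟨L, hL, H⟩ := h₀.exists_field_const hlam R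
  intro t ht ξ hξ
  rw [closeAt_iff]
  intro i
  have hclose : ∀ t ∈ Icc 0 T, ∀ ξ ∈ S, CloseAt (X t) (Y t) (2 * R) ξ := by
    intro t ht ξ hξ
    have h1 := hXb t ht ξ hξ
    have h2 := hYb t ht ξ hξ
    refine ⟨?_, (abs_sub _ _).trans (by linarith [h1.K, h2.K]),
      (abs_sub _ _).trans (by linarith [h1.V, h2.V]),
      (abs_sub _ _).trans (by linarith [h1.W, h2.W]),
      (abs_sub _ _).trans (by linarith [h1.Q, h2.Q])⟩
    have e : (X t).Z ξ - (Y t).Z ξ = ((X t).Z ξ - X₀.Z ξ) - ((Y t).Z ξ - X₀.Z ξ) := by ring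
    rw [e]
    exact (abs_sub _ _).trans (by linarith [h1.Z, h2.Z])
  have hR : 0 ≤ R := (abs_nonneg _).trans (hXb t ht ξ hξ).Z
  have key := gronwall_family (ι := Fin 5 × S) (T := T)
    (φ := fun i t => (X t).comp i.1 i.2 - (Y t).comp i.1 i.2)
    (φ' := fun i t => (field p t (X t)).comp i.1 i.2 - (field p t (Y t)).comp i.1 i.2)
    (w := fun _ => 1) (a := 0) (M := 2 * R) hL le_rfl (by positivity) (fun _ => zero_le_one)
    (fun i s hs => ((hX i.2 i.2.2 s hs i.1).sub (hY i.2 i.2.2 s hs i.1)).continuousWithinAt)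
    (fun i s hs => ((hX i.2 i.2.2 s (Ioo_subset_Icc_self hs) i.1).sub
      (hY i.2 i.2.2 s (Ioo_subset_Icc_self hs) i.1)).hasDerivAt (Icc_mem_nhds hs.1 hs.2))
    (fun i => by simpa using closeAt_iff.1 (h0 i.2 i.2.2) i.1)
    (fun i s hs => by simpa using closeAt_iff.1 (hclose s hs i.2 i.2.2) i.1)
    (by
      intro s hs ρ hρ hsρ j
      have hs' := Ioo_subset_Icc_self hs
      have hc : ∀ ξ ∈ S, CloseAt (X s) (Y s) ρ ξ := fun ξ hξ =>
        closeAt_iff.2 fun i => by simpa using hsρ (i, ⟨ξ, hξ⟩)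
      have := (H s s hs.1.le hs.1.le (X s) (Y s) (hXm s hs') (hYm s hs')
        (hS.mono fun ξ hξ => hXb s hs' ξ hξ) (hS.mono fun ξ hξ => hYb s hs' ξ hξ) ρ hρ
        (by simpa using hρ) (hS.mono hc) j.2 (hXb s hs' _ j.2.2) (hYb s hs' _ j.2.2)
        (hc _ j.2.2)).2.2.2.2.2.2
      simpa using closeAt_iff.1 this j.1)
    (i, ⟨ξ, hξ⟩) ht
  simpa using key

theorem ClassicalOn.unique {p : Params} (hlam : 0 < p.lam) {X₀ : State}
    (h₀ : Admissible X₀) {T R R' : ℝ} {X Y : ℝ → State} (hX : ClassicalOn p X₀ T R X)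
    (hY : ClassicalOn p X₀ T R' Y) {t : ℝ} (ht : t ∈ Icc 0 T) : X t = Y t := by
  have hX' := hX.mono le_rfl (le_max_left R R')
  have hY' := hY.mono le_rfl (le_max_right R R')
  refine State.eq_of_closeAt fun ξ => closeAt_zero_of_solvesAt hlam h₀ (S := univ) (by simp)
    (fun t ht => (hX.meas t ht).aesm) (fun t ht => (hY.meas t ht).aesm)
    (fun t ht ξ _ => hX'.bounded t ht ξ) (fun t ht ξ _ => hY'.bounded t ht ξ)
    (fun ξ _ => hX.equation ξ) (fun ξ _ => hY.equation ξ) (fun ξ _ => ?_) t ht ξ (mem_univ _)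
  rw [hX.initial, hY.initial, closeAt_iff]
  simp

theorem SolvesAt.congr {p : Params} {T : ℝ} {X Y : ℝ → State} {ξ : ℝ} (h : SolvesAt p T X ξ)
    (hXY : ∀ t ∈ Icc 0 T, Y t = X t) : SolvesAt p T Y ξ := fun t ht i => by
  rw [hXY t ht]
  exact (h t ht i).congr (fun s hs => by rw [hXY s hs]) (by rw [hXY t ht])

theorem ClassicalOn.congr {p : Params} {X₀ : State} {T R : ℝ} {X Y : ℝ → State}
    (h : ClassicalOn p X₀ T R X) (hT : 0 ≤ T) (hXY : ∀ t ∈ Icc 0 T, Y t = X t) :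
    ClassicalOn p X₀ T R Y :=
  ⟨fun t ht => by rw [hXY t ht]; exact h.meas t ht,
    fun t ht => by rw [hXY t ht]; exact h.bounded t ht,
    by rw [hXY 0 ⟨le_rfl, hT⟩]; exact h.initial, fun ξ => (h.equation ξ).congr hXY⟩

/-! ### Measurability of the right-hand side -/

theorem measurable_nonlocal {s : ℝ → ℝ → ℝ} {y f : ℝ → ℝ}
    (hs : Measurable fun z : ℝ × ℝ => s z.1 z.2) (hy : Measurable y) (hf : Measurable f) :
    Measurable fun ξ => nonlocal (s ξ) y f ξ := by
  have h : Measurable fun z : ℝ × ℝ => s z.1 z.2 * Real.exp (-|y z.1 - y z.2|) * f z.2 := by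
    refine (hs.mul ?_).mul (hf.comp measurable_snd)
    have : Measurable fun z : ℝ × ℝ => y z.1 - y z.2 :=
      (hy.comp measurable_fst).sub (hy.comp measurable_snd)
    exact (show Continuous fun x : ℝ => Real.exp (-|x|) by fun_prop).measurable.comp this
  exact (h.stronglyMeasurable.integral_prod_right (f := fun ξ η =>
    s ξ η * Real.exp (-|y ξ - y η|) * f η)).measurable

namespace State.Meas

variable {p} {X : State} (h : X.Meas)
include h

theorem charY (t : ℝ) : Measurable (charY p t X) :=
  (h.Z.add measurable_id).add measurable_const

theorem source (t : ℝ) : Measurable (source p t X) := by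
  have hK := h.K
  have hV := h.V
  have hQ := h.Q
  unfold LagrangianCH.source hamil
  fun_prop

theorem lagP (t : ℝ) : Measurable (lagP p t X) := by
  rw [show LagrangianCH.lagP p t X = _ from funext (lagP_eq_nonlocal p t X)]
  exact (measurable_nonlocal (s := fun _ _ => 1) measurable_const (h.charY t)
    (h.source t)).const_mul _

theorem lagG (t : ℝ) : Measurable (lagG p t X) := by
  rw [show LagrangianCH.lagG p t X = _ from funext (lagG_eq_nonlocal p t X)]
  exact (measurable_nonlocal (s := fun ξ η => Real.sign (ξ - η))
    (measurable_sign.comp (measurable_fst.sub measurable_snd)) (h.charY t)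
    (h.source t)).const_mul _

theorem field (t : ℝ) : (field p t X).Meas := by
  have hK := h.K
  have hV := h.V
  have hW := h.W
  have hQ := h.Q
  have hP := h.lagP (p := p) t
  refine ⟨?_, ?_, ?_, ?_, ?_⟩
  · exact hK.const_mul _
  · exact (h.lagG t).neg
  · unfold LagrangianCH.field factorVW hamil; fun_prop
  · unfold LagrangianCH.field factorVW hamil; fun_prop
  · unfold LagrangianCH.field hamil; fun_prop

theorem comp (i : Fin 5) : Measurable (X.comp i) := by
  fin_cases i
  exacts [h.Z, h.K, h.V, h.W, h.Q]

end State.Meas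

theorem Admissible.meas {X₀ : State} (h : Admissible X₀) : X₀.Meas := by
  refine ⟨?_, h.isPrim_K.continuous.measurable, h.measurable_V, h.measurable_W, ?_⟩
  · have := h.isPrim_Y.continuous.measurable.sub measurable_id
    rwa [show (fun ξ => X₀.Z ξ + ξ) - id = X₀.Z from funext fun ξ => by simp] at this
  · rw [show X₀.Q = fun _ => 1 from funext h.Q_eq]
    exact measurable_const

/-! ### Existence -/

/-- The Banach space of bounded measurable functions on five copies of the real line, with the
supremum norm. It holds the five components of a state. -/
def boundedMeasurable : Submodule ℝ (lp (fun _ : Fin 5 × ℝ => ℝ) ∞) where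
  carrier := {f | Measurable (fun z => f z)}
  add_mem' hf hg := Measurable.add (f := fun _ => _) hf hg
  zero_mem' := measurable_const (a := (0 : ℝ))
  smul_mem' c _ hf := Measurable.const_smul (M := ℝ) hf c

theorem isClosed_boundedMeasurable :
    IsClosed (boundedMeasurable : Set (lp (fun _ : Fin 5 × ℝ => ℝ) ∞)) := by
  refine isSeqClosed_iff_isClosed.1 fun f g hf hfg => ?_
  refine measurable_of_tendsto_metrizable (f := fun n z => f n z) (fun n => hf n) ?_
  rw [tendsto_pi_nhds]
  intro z
  exact ((lp.evalCLM ℝ (fun _ : Fin 5 × ℝ => ℝ) ∞ z).continuous.tendsto g).comp hfg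

instance : CompleteSpace boundedMeasurable := isClosed_boundedMeasurable.completeSpace_coe

/-- The value of an element of `boundedMeasurable` at a point, as a continuous linear map. -/
def evalAt (z : Fin 5 × ℝ) : boundedMeasurable →L[ℝ] ℝ :=
  (lp.evalCLM ℝ (fun _ : Fin 5 × ℝ => ℝ) ∞ z).comp boundedMeasurable.subtypeL

theorem abs_evalAt_le (z : Fin 5 × ℝ) (u : boundedMeasurable) : |evalAt z u| ≤ ‖u‖ :=
  lp.norm_apply_le_norm (by simp) u.1 z

theorem norm_le_of_evalAt {u : boundedMeasurable} {C : ℝ} (hC : 0 ≤ C)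
    (h : ∀ z, |evalAt z u| ≤ C) : ‖u‖ ≤ C :=
  lp.norm_le_of_forall_le hC h

theorem exists_evalAt_eq {g : Fin 5 × ℝ → ℝ} {C : ℝ} (hg : Measurable g) (hC : ∀ z, |g z| ≤ C) :
    ∃ u : boundedMeasurable, ∀ z, evalAt z u = g z := by
  refine ⟨⟨⟨g, memℓp_infty ⟨C, ?_⟩⟩, hg⟩, fun z => rfl⟩
  rintro _ ⟨z, rfl⟩
  exact hC z

open Classical in
/-- The element of `boundedMeasurable` with the given values; `0` if there is none. -/
def ofValues (g : Fin 5 × ℝ → ℝ) : boundedMeasurable :=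
  if h : ∃ u : boundedMeasurable, ∀ z, evalAt z u = g z then h.choose else 0

theorem evalAt_ofValues {g : Fin 5 × ℝ → ℝ} {C : ℝ} (hg : Measurable g) (hC : ∀ z, |g z| ≤ C)
    (z : Fin 5 × ℝ) : evalAt z (ofValues g) = g z := by
  have h := exists_evalAt_eq hg hC
  rw [ofValues, dif_pos h]
  exact h.choose_spec z

/-- Truncation of a real number to `[-R, R]`. -/
def clip (R x : ℝ) : ℝ := max (-R) (min R x)

theorem abs_clip_le {R : ℝ} (hR : 0 ≤ R) (x : ℝ) : |clip R x| ≤ R := by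
  rw [abs_le, clip]
  exact ⟨le_max_left _ _, max_le (by linarith) (min_le_left _ _)⟩

theorem clip_eq {R x : ℝ} (h : |x| ≤ R) : clip R x = x := by
  rw [abs_le] at h
  rw [clip, min_eq_right h.2, max_eq_right h.1]

theorem abs_clip_sub_le (R x y : ℝ) : |clip R x - clip R y| ≤ |x - y| := by
  refine (abs_max_sub_max_le_max _ _ _ _).trans ?_
  simp only [sub_self, abs_zero]
  refine max_le (abs_nonneg _) ((abs_min_sub_min_le_max _ _ _ _).trans ?_)
  simp

theorem measurable_clip (R : ℝ) : Measurable (clip R) :=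
  measurable_const.max (measurable_const.min measurable_id)

/-- The state with components given by `u`, truncated at height `R`, the first of them relative
to `X₀`. -/
def clipState (X₀ : State) (R : ℝ) (u : boundedMeasurable) : State where
  Z ξ := X₀.Z ξ + clip R (evalAt (0, ξ) u)
  K ξ := clip R (evalAt (1, ξ) u)
  V ξ := clip R (evalAt (2, ξ) u)
  W ξ := clip R (evalAt (3, ξ) u)
  Q ξ := clip R (evalAt (4, ξ) u)

theorem measurable_evalAt (u : boundedMeasurable) (i : Fin 5) :
    Measurable fun ξ => evalAt (i, ξ) u :=
  (show Measurable fun z => evalAt z u from u.2).comp measurable_prodMk_left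

theorem Admissible.meas_clipState {X₀ : State} (h₀ : Admissible X₀) (R : ℝ)
    (u : boundedMeasurable) : (clipState X₀ R u).Meas :=
  ⟨h₀.meas.Z.add ((measurable_clip R).comp (measurable_evalAt u 0)),
    (measurable_clip R).comp (measurable_evalAt u 1),
    (measurable_clip R).comp (measurable_evalAt u 2),
    (measurable_clip R).comp (measurable_evalAt u 3),
    (measurable_clip R).comp (measurable_evalAt u 4)⟩

theorem boundedAt_clipState (X₀ : State) {R : ℝ} (hR : 0 ≤ R) (u : boundedMeasurable) (ξ : ℝ) :
    BoundedAt X₀ (clipState X₀ R u) R ξ :=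
  ⟨by simpa [clipState] using abs_clip_le hR _, abs_clip_le hR _, abs_clip_le hR _,
    abs_clip_le hR _, abs_clip_le hR _⟩

theorem closeAt_clipState (X₀ : State) (R : ℝ) (u v : boundedMeasurable) (ξ : ℝ) :
    CloseAt (clipState X₀ R u) (clipState X₀ R v) ‖u - v‖ ξ := by
  have key : ∀ z, |clip R (evalAt z u) - clip R (evalAt z v)| ≤ ‖u - v‖ := fun z =>
    (abs_clip_sub_le R _ _).trans (by rw [← map_sub]; exact abs_evalAt_le z (u - v))
  exact ⟨by simpa [clipState] using key (0, ξ), key _, key _, key _, key _⟩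

/-- The right-hand side of the system after truncation of its arguments, as a time-dependent
vector field on the space of bounded measurable functions. -/
def clipField (X₀ : State) (R t : ℝ) (u : boundedMeasurable) : boundedMeasurable :=
  ofValues fun z => (field p t (clipState X₀ R u)).comp z.1 z.2

/-- The truncated system is globally Lipschitz and bounded, hence solvable on any time interval. -/
theorem exists_clip_solution {p : Params} (hlam : 0 < p.lam) {X₀ : State} (h₀ : Admissible X₀)
    {R T : ℝ} (hR : 0 ≤ R) (hT : 0 ≤ T) (u₀ : boundedMeasurable) :
    ∃ u : ℝ → boundedMeasurable, u 0 = u₀ ∧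
      (∀ t ∈ Icc 0 T, HasDerivWithinAt u (clipField p X₀ R t (u t)) (Icc 0 T) t) ∧
      ∀ t ∈ Icc 0 T, ∀ z, evalAt z (clipField p X₀ R t (u t)) =
        (field p t (clipState X₀ R (u t))).comp z.1 z.2 := by
  obtain ⟨L, hL, H⟩ := h₀.exists_field_const hlam R
  have hbd : ∀ t ∈ Icc 0 T, ∀ u, ∀ i ξ, |(field p t (clipState X₀ R u)).comp i ξ| ≤ L := by
    intro t ht u i ξ
    have hb := boundedAt_clipState X₀ hR u
    have hm := (h₀.meas_clipState R u).aesm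
    have hc : ∀ ξ, CloseAt (clipState X₀ R u) (clipState X₀ R u) 0 ξ := fun ξ =>
      closeAt_iff.2 (by simp)
    obtain ⟨-, h0, h1, h2, h3, h4, -⟩ := H t t ht.1 ht.1 _ _ hm hm (Eventually.of_forall hb)
      (Eventually.of_forall hb) 0 le_rfl (by simp) (Eventually.of_forall hc) ξ (hb ξ) (hb ξ) (hc ξ)
    fin_cases i
    exacts [h0, h1, h2, h3, h4]
  have hev : ∀ t ∈ Icc 0 T, ∀ u, ∀ z, evalAt z (clipField p X₀ R t u) =
      (field p t (clipState X₀ R u)).comp z.1 z.2 := by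
    intro t ht u z
    refine evalAt_ofValues (C := L) ?_ (fun z => hbd t ht u z.1 z.2) z
    refine measurable_from_prod_countable_right fun i => ?_
    exact ((h₀.meas_clipState R u).field t).comp i
  have hlip : ∀ t ∈ Icc 0 T, ∀ t' ∈ Icc 0 T, ∀ u v,
      ‖clipField p X₀ R t u - clipField p X₀ R t' v‖ ≤
        L * max ‖u - v‖ |Real.exp (-p.lam * t) - Real.exp (-p.lam * t')| := by
    intro t ht t' ht' u v
    set δ := max ‖u - v‖ |Real.exp (-p.lam * t) - Real.exp (-p.lam * t')|
    have hδ : 0 ≤ δ := (norm_nonneg _).trans (le_max_left _ _)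
    refine norm_le_of_evalAt (by positivity) fun z => ?_
    rw [map_sub, hev t ht, hev t' ht']
    have hc : ∀ ξ, CloseAt (clipState X₀ R u) (clipState X₀ R v) δ ξ := fun ξ =>
      (closeAt_clipState X₀ R u v ξ).mono (le_max_left _ _)
    have := (H t t' ht.1 ht'.1 _ _ (h₀.meas_clipState R u).aesm (h₀.meas_clipState R v).aesm
      (Eventually.of_forall (boundedAt_clipState X₀ hR u))
      (Eventually.of_forall (boundedAt_clipState X₀ hR v)) δ hδ (le_max_right _ _)
      (Eventually.of_forall hc) z.2 (boundedAt_clipState X₀ hR u _)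
      (boundedAt_clipState X₀ hR v _) (hc _)).2.2.2.2.2.2
    exact closeAt_iff.1 this z.1
  have hPL : IsPicardLindelof (clipField p X₀ R) (tmin := 0) (tmax := T) ⟨0, le_rfl, hT⟩ u₀
      ⟨L * T, by positivity⟩ 0 ⟨L, hL.le⟩ ⟨L, hL.le⟩ := by
    constructor
    · intro t ht
      refine LipschitzOnWith.of_dist_le_mul fun u _ v _ => ?_
      rw [dist_eq_norm, dist_eq_norm]
      refine (hlip t ht t ht u v).trans ?_
      simp only [sub_self, abs_zero, norm_nonneg, sup_of_le_left]
      exact le_rfl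
    · intro u _
      rw [Metric.continuousOn_iff]
      intro t ht ε hε
      have hexp : Continuous fun t => Real.exp (-p.lam * t) := by fun_prop
      obtain ⟨δ, hδ, h⟩ := Metric.continuous_iff.1 hexp t (ε / L) (by positivity)
      refine ⟨δ, hδ, fun t' ht' hd => ?_⟩
      rw [dist_eq_norm]
      refine (hlip t' ht' t ht u u).trans_lt ?_
      have := h t' hd
      rw [Real.dist_eq, lt_div_iff₀ hL] at this
      simp only [sub_self, norm_zero]
      rw [max_eq_right (abs_nonneg _)]
      linarith
    · intro t ht u _
      exact norm_le_of_evalAt hL.le fun z => by rw [hev t ht]; exact hbd t ht u _ _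
    · simp only [NNReal.coe_zero, sub_zero, max_eq_left hT]
      exact le_rfl
  obtain ⟨u, hu0, hu⟩ := hPL.exists_eq_forall_mem_Icc_hasDerivWithinAt₀
  exact ⟨u, hu0, hu, fun t ht z => hev t ht (u t) z⟩

/-- A bound on all classical solutions up to time `T` that does not depend on the bound assumed in
the definition of a classical solution yields a classical solution on `[0, T]`: the solution of the
truncated system cannot leave the region in which the truncation is not felt. -/
theorem exists_classicalOn_of_bound {p : Params} (hlam : 0 < p.lam) {X₀ : State}
    (h₀ : Admissible X₀) {T R₀ : ℝ} (hT : 0 ≤ T) (hR₀ : 0 ≤ R₀)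
    (hX₀ : ∀ ξ, BoundedAt X₀ X₀ R₀ ξ)
    (hap : ∀ T' R X, 0 ≤ T' → T' ≤ T → ClassicalOn p X₀ T' R X →
      ∀ t ∈ Icc 0 T', ∀ ξ, BoundedAt X₀ (X t) R₀ ξ) :
    ∃ X, ClassicalOn p X₀ T (R₀ + 1) X := by
  set R := R₀ + 1 with hR
  have hRpos : 0 ≤ R := by positivity
  -- the initial value, with first component relative to `X₀`
  obtain ⟨u₀, hu₀⟩ : ∃ u : boundedMeasurable, ∀ z, evalAt z u =
      (![fun _ => 0, X₀.K, X₀.V, X₀.W, X₀.Q] : Fin 5 → ℝ → ℝ) z.1 z.2 := by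
    refine exists_evalAt_eq (C := R₀) (measurable_from_prod_countable_right fun i => ?_) ?_
    · have := h₀.meas
      fin_cases i
      exacts [measurable_const, this.K, this.V, this.W, this.Q]
    · rintro ⟨i, ξ⟩
      have := hX₀ ξ
      fin_cases i
      exacts [by simpa using hR₀, this.K, this.V, this.W, this.Q]
  have hclip₀ : clipState X₀ R u₀ = X₀ := by
    refine State.eq_of_closeAt fun ξ => ?_
    have hb := (hX₀ ξ).mono (by linarith : R₀ ≤ R)
    have e0 : clip R (evalAt (0, ξ) u₀) = 0 := by
      rw [hu₀]; exact clip_eq (by simpa using hRpos)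
    constructor
    · simp [clipState, e0]
    · simp [clipState, hu₀, clip_eq hb.K]
    · simp [clipState, hu₀, clip_eq hb.V]
    · simp [clipState, hu₀, clip_eq hb.W]
    · simp [clipState, hu₀, clip_eq hb.Q]
  obtain ⟨u, hu0, hu, hev⟩ := exists_clip_solution hlam h₀ hRpos hT u₀
  have hucont : ContinuousOn u (Icc 0 T) := fun t ht => (hu t ht).continuousWithinAt
  have hclass : ∀ T', 0 ≤ T' → T' ≤ T → (∀ t ∈ Icc 0 T', ‖u t‖ ≤ R) →
      ClassicalOn p X₀ T' R (fun t => clipState X₀ R (u t)) := by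
    intro T' hT' hTT' hn
    refine ⟨fun t _ => h₀.meas_clipState R _, fun t _ ξ => boundedAt_clipState X₀ hRpos _ ξ,
      by rw [hu0, hclip₀], fun ξ t ht i => ?_⟩
    have ht' : t ∈ Icc 0 T := ⟨ht.1, ht.2.trans hTT'⟩
    have h1 : HasDerivWithinAt (fun s => evalAt (i, ξ) (u s))
        ((field p t (clipState X₀ R (u t))).comp i ξ) (Icc 0 T') t := by
      rw [← hev t ht' (i, ξ)]
      exact ((evalAt (i, ξ)).hasFDerivAt.comp_hasDerivWithinAt t (hu t ht')).mono
        (Icc_subset_Icc_right hTT')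
    have hcl : ∀ s ∈ Icc 0 T', ∀ z, clip R (evalAt z (u s)) = evalAt z (u s) := fun s hs z =>
      clip_eq ((abs_evalAt_le z _).trans (hn s hs))
    have e : ∀ s ∈ Icc 0 T', (clipState X₀ R (u s)).comp i ξ =
        (![X₀.Z, fun _ => 0, fun _ => 0, fun _ => 0, fun _ => 0] : Fin 5 → ℝ → ℝ) i ξ +
          evalAt (i, ξ) (u s) := by
      intro s hs
      have hz := hcl s hs
      fin_cases i <;> simp [clipState, State.comp, hz]
    exact (h1.const_add _).congr (fun s hs => e s hs) (e t ht)
  have hnorm : ∀ t ∈ Icc 0 T, (∀ s ∈ Icc 0 t, ‖u s‖ ≤ R) → ‖u t‖ ≤ R₀ := by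
    intro t ht hs
    have hc := hclass t ht.1 ht.2 hs
    have htt : t ∈ Icc 0 t := ⟨ht.1, le_rfl⟩
    have hb := hap t R _ ht.1 ht.2 hc t htt
    refine norm_le_of_evalAt hR₀ ?_
    rintro ⟨i, ξ⟩
    have hz : ∀ z, clip R (evalAt z (u t)) = evalAt z (u t) := fun z =>
      clip_eq ((abs_evalAt_le z _).trans (hs t htt))
    have hbξ := hb ξ
    obtain ⟨b0, b1, b2, b3, b4⟩ := hbξ
    simp only [clipState, hz, add_sub_cancel_left] at b0 b1 b2 b3 b4
    fin_cases i
    exacts [b0, b1, b2, b3, b4]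
  refine ⟨_, hclass T hT le_rfl ?_⟩
  by_contra hcon
  push Not at hcon
  obtain ⟨t₁, ht₁, hbig⟩ := hcon
  -- the first time at which the norm reaches `R`
  have hcomp : IsCompact (Icc 0 T ∩ (fun t => ‖u t‖) ⁻¹' Ici R) :=
    isCompact_Icc.of_isClosed_subset
      (hucont.norm.preimage_isClosed_of_isClosed isClosed_Icc isClosed_Ici) inter_subset_left
  obtain ⟨s, ⟨hsT, hsR⟩, hsmin⟩ := hcomp.exists_isLeast ⟨t₁, ht₁, hbig.le⟩
  have hlt : ∀ r ∈ Icc 0 s, r ≠ s → ‖u r‖ < R := fun r hr hrs => by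
    by_contra hge
    push Not at hge
    exact hrs (le_antisymm hr.2 (hsmin ⟨⟨hr.1, hr.2.trans hsT.2⟩, hge⟩))
  have hsle : ‖u s‖ ≤ R := by
    rcases eq_or_lt_of_le hsT.1 with h | h
    · rw [← h, hu0]
      refine norm_le_of_evalAt hRpos ?_
      rintro ⟨i, ξ⟩
      have := (hX₀ ξ).mono (by linarith : R₀ ≤ R)
      rw [hu₀]
      fin_cases i
      exacts [by simpa using hRpos, this.K, this.V, this.W, this.Q]
    · have hc : ContinuousWithinAt (fun t => ‖u t‖) (Ico 0 s) s :=
        (hucont.norm s hsT).mono fun r hr => ⟨hr.1, hr.2.le.trans hsT.2⟩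
      have hne : (𝓝[Ico 0 s] s).NeBot := by
        rw [← mem_closure_iff_nhdsWithin_neBot, closure_Ico h.ne]
        exact ⟨h.le, le_rfl⟩
      refine le_of_tendsto hc ?_
      filter_upwards [self_mem_nhdsWithin] with r hr
      exact (hlt r ⟨hr.1, hr.2.le⟩ hr.2.ne).le
  have h1 := hnorm s hsT fun r hr => by
    rcases eq_or_ne r s with h | h
    · rw [h]; exact hsle
    · exact (hlt r hr h).le
  have h2 : R ≤ ‖u s‖ := hsR
  linarith

/-- Classical solutions on all bounded time intervals fit together. -/
theorem exists_global_of_forall {p : Params} (hlam : 0 < p.lam) {X₀ : State}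
    (h₀ : Admissible X₀) (h : ∀ T, 0 ≤ T → ∃ R X, ClassicalOn p X₀ T R X) :
    ∃ X, ∀ T, 0 ≤ T → ∃ R, ClassicalOn p X₀ T R X := by
  choose R X hX using fun n : ℕ => h n n.cast_nonneg
  refine ⟨fun t => X ⌈t⌉₊ t, fun T hT => ⟨R ⌈T⌉₊, ?_⟩⟩
  refine ((hX ⌈T⌉₊).mono (Nat.le_ceil T) le_rfl).congr hT fun t ht => ?_
  refine (hX ⌈t⌉₊).unique hlam h₀ ((hX ⌈T⌉₊).mono ?_ le_rfl) ⟨ht.1, Nat.le_ceil t⟩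
  exact_mod_cast Nat.ceil_mono ht.2

end

/-! ### Pointwise invariants of classical solutions -/

section invariants

variable {p : Params} {X₀ : State} {T R : ℝ} {X : ℝ → State}

namespace ClassicalOn

theorem deriv_Z (hX : ClassicalOn p X₀ T R X) (ξ : ℝ) {t : ℝ} (ht : t ∈ Icc 0 T) :
    HasDerivWithinAt (fun s => (X s).Z ξ) ((field p t (X t)).Z ξ) (Icc 0 T) t :=
  hX.equation ξ t ht 0

theorem deriv_K (hX : ClassicalOn p X₀ T R X) (ξ : ℝ) {t : ℝ} (ht : t ∈ Icc 0 T) :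
    HasDerivWithinAt (fun s => (X s).K ξ) ((field p t (X t)).K ξ) (Icc 0 T) t :=
  hX.equation ξ t ht 1

theorem deriv_V (hX : ClassicalOn p X₀ T R X) (ξ : ℝ) {t : ℝ} (ht : t ∈ Icc 0 T) :
    HasDerivWithinAt (fun s => (X s).V ξ) ((field p t (X t)).V ξ) (Icc 0 T) t :=
  hX.equation ξ t ht 2

theorem deriv_W (hX : ClassicalOn p X₀ T R X) (ξ : ℝ) {t : ℝ} (ht : t ∈ Icc 0 T) :
    HasDerivWithinAt (fun s => (X s).W ξ) ((field p t (X t)).W ξ) (Icc 0 T) t :=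
  hX.equation ξ t ht 3

theorem deriv_Q (hX : ClassicalOn p X₀ T R X) (ξ : ℝ) {t : ℝ} (ht : t ∈ Icc 0 T) :
    HasDerivWithinAt (fun s => (X s).Q ξ) ((field p t (X t)).Q ξ) (Icc 0 T) t :=
  hX.equation ξ t ht 4

/-- A bound on one component of the right-hand side bounds the displacement of that component. -/
theorem abs_comp_sub_le (hX : ClassicalOn p X₀ T R X) (i : Fin 5) (ξ : ℝ) {c : ℝ}
    (hc : ∀ t ∈ Icc 0 T, |(field p t (X t)).comp i ξ| ≤ c) {t : ℝ} (ht : t ∈ Icc 0 T) :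
    |(X t).comp i ξ - X₀.comp i ξ| ≤ c * t := by
  have h := abs_le_add_of_deriv_le (T := T) (φ := fun s => (X s).comp i ξ - X₀.comp i ξ)
    (φ' := fun s => (field p s (X s)).comp i ξ) (B := fun s => c * s) (B' := fun _ => c)
    (fun s hs => ((hX.equation ξ s hs i).sub_const _).continuousWithinAt)
    (fun s hs => ((hX.equation ξ s (Ioo_subset_Icc_self hs) i).hasDerivAt
      (Icc_mem_nhds hs.1 hs.2)).sub_const _)
    (fun s => by simpa using (hasDerivAt_id s).const_mul c)
    (fun s hs => hc s (Ioo_subset_Icc_self hs)) ht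
  simpa [hX.initial] using h

/-- The right-hand sides for `V` and `W` are tangent to the circle `W² + V² = V`. -/
theorem constraint (h₀ : Admissible X₀) (hX : ClassicalOn p X₀ T R X) {t : ℝ}
    (ht : t ∈ Icc 0 T) (ξ : ℝ) : (X t).W ξ ^ 2 + (X t).V ξ ^ 2 = (X t).V ξ := by
  have hd : ∀ s ∈ Icc 0 T, HasDerivWithinAt
      (fun s => (X s).W ξ ^ 2 + (X s).V ξ ^ 2 - (X s).V ξ) 0 (Icc 0 T) s := by
    intro s hs
    refine ((((hX.deriv_W ξ hs).fun_pow 2).fun_add ((hX.deriv_V ξ hs).fun_pow 2)).fun_sub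
      (hX.deriv_V ξ hs)).congr_deriv ?_
    simp only [field]
    push_cast
    ring
  have h := abs_le_add_of_deriv_le (T := T) (φ' := fun _ => 0) (B := fun _ => 0)
    (B' := fun _ => 0) (fun s hs => (hd s hs).continuousWithinAt)
    (fun s hs => (hd s (Ioo_subset_Icc_self hs)).hasDerivAt (Icc_mem_nhds hs.1 hs.2))
    (fun s => hasDerivAt_const s 0) (fun s _ => by simp) ht
  simp only [hX.initial, h₀.constraint ξ, sub_self, abs_zero, add_zero] at h
  exact sub_eq_zero.1 (abs_nonpos_iff.1 h)

end ClassicalOn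

end invariants

/-- The logarithmic time derivative of `Q`. -/
def rateQ (p : Params) (t : ℝ) (X : State) (ξ : ℝ) : ℝ :=
  2 * X.W ξ * (Real.exp (-p.lam * t) / 2 + Real.exp (-p.lam * t) * X.K ξ ^ 2
      - hamil p t (X.K ξ) - lagP p t X ξ)

/-- The size of the coefficients of `H`. -/
def coeffBound (p : Params) : ℝ := |p.α + p.Γ| + |p.β| + |p.γ|

theorem coeffBound_nonneg (p : Params) : 0 ≤ coeffBound p := by
  unfold coeffBound; positivity

theorem abs_hamil_le {p : Params} (hlam : 0 < p.lam) {t : ℝ} (ht : 0 ≤ t) (K : ℝ) :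
    |hamil p t K| ≤ coeffBound p * (|K| + |K| ^ 3 + |K| ^ 4) := by
  have he := exp_lam_le hlam ht
  rw [hamil_eq, hamilPoly]
  set e := Real.exp (-p.lam * t)
  have he2 : |e| ^ 2 ≤ 1 := pow_le_one₀ (abs_nonneg _) he
  have he3 : |e| ^ 3 ≤ 1 := pow_le_one₀ (abs_nonneg _) he
  have h1 : |(p.α + p.Γ) * K| ≤ coeffBound p * |K| := by
    rw [abs_mul]
    gcongr
    unfold coeffBound
    linarith [abs_nonneg p.β, abs_nonneg p.γ]
  have h2 : |p.β * e ^ 2 / 3 * K ^ 3| ≤ coeffBound p * |K| ^ 3 := by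
    rw [abs_mul, abs_div, abs_mul, abs_pow, abs_pow]
    gcongr
    unfold coeffBound
    rw [abs_of_pos (by norm_num : (0 : ℝ) < 3), div_le_iff₀ (by norm_num)]
    have := abs_nonneg p.β
    nlinarith [abs_nonneg (p.α + p.Γ), abs_nonneg p.γ]
  have h3 : |p.γ * e ^ 3 / 4 * K ^ 4| ≤ coeffBound p * |K| ^ 4 := by
    rw [abs_mul, abs_div, abs_mul, abs_pow, abs_pow]
    gcongr
    unfold coeffBound
    rw [abs_of_pos (by norm_num : (0 : ℝ) < 4), div_le_iff₀ (by norm_num)]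
    have := abs_nonneg p.γ
    nlinarith [abs_nonneg (p.α + p.Γ), abs_nonneg p.β]
  calc _ ≤ |(p.α + p.Γ) * K| + |p.β * e ^ 2 / 3 * K ^ 3| + |p.γ * e ^ 3 / 4 * K ^ 4| :=
        abs_add_three _ _ _
    _ ≤ _ := by linarith

theorem abs_rateQ_le {p : Params} (hlam : 0 < p.lam) {t : ℝ} (ht : 0 ≤ t) {X : State} {ξ k P : ℝ}
    (hW : |X.W ξ| ≤ 1 / 2) (hK : |X.K ξ| ≤ k) (hP : |lagP p t X ξ| ≤ P) :
    |rateQ p t X ξ| ≤ 1 + k ^ 2 + coeffBound p * (k + k ^ 3 + k ^ 4) + P := by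
  have he := exp_lam_le hlam ht
  have hH := abs_hamil_le hlam ht (X.K ξ)
  have hk : 0 ≤ k := (abs_nonneg _).trans hK
  have hH' : |hamil p t (X.K ξ)| ≤ coeffBound p * (k + k ^ 3 + k ^ 4) := hH.trans <| by
    have := coeffBound_nonneg p
    gcongr
  rw [rateQ, abs_mul]
  set e := Real.exp (-p.lam * t)
  have h2W : |2 * X.W ξ| ≤ 1 := by
    rw [abs_mul, abs_two]; linarith
  have h1 : |e * X.K ξ ^ 2| ≤ k ^ 2 := by
    rw [abs_mul, abs_pow]
    calc _ ≤ 1 * |X.K ξ| ^ 2 := by gcongr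
      _ ≤ k ^ 2 := by rw [one_mul]; gcongr
  have h3 : |e / 2| ≤ 1 := by rw [abs_div, abs_two]; linarith
  have h4 : |e / 2 + e * X.K ξ ^ 2 - hamil p t (X.K ξ) - lagP p t X ξ| ≤
      1 + k ^ 2 + coeffBound p * (k + k ^ 3 + k ^ 4) + P := by
    refine (abs_sub _ _).trans (add_le_add ((abs_sub _ _).trans (add_le_add
      ((abs_add_le _ _).trans (add_le_add h3 h1)) hH')) hP)
  calc _ ≤ 1 * |e / 2 + e * X.K ξ ^ 2 - hamil p t (X.K ξ) - lagP p t X ξ| := by gcongr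
    _ ≤ _ := by rw [one_mul]; exact h4

theorem ClassicalOn.exp_bounds_Q {p : Params} {X₀ : State} {T R : ℝ} {X : ℝ → State}
    (h₀ : Admissible X₀) (hX : ClassicalOn p X₀ T R X) {ξ c : ℝ}
    (hc : ∀ t ∈ Icc 0 T, |rateQ p t (X t) ξ| ≤ c) {t : ℝ} (ht : t ∈ Icc 0 T) :
    Real.exp (-(c * t)) ≤ (X t).Q ξ ∧ (X t).Q ξ ≤ Real.exp (c * t) := by
  refine exp_bounds_of_deriv_eq_mul (q := fun s => (X s).Q ξ)
    (a := fun s => rateQ p s (X s) ξ)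
    (fun s hs => (hX.deriv_Q ξ hs).continuousWithinAt) (fun s hs => ?_)
    (fun s hs => hc s (Ioo_subset_Icc_self hs)) (by rw [hX.initial, h₀.Q_eq]) ht
  refine ((hX.deriv_Q ξ (Ioo_subset_Icc_self hs)).hasDerivAt
    (Icc_mem_nhds hs.1 hs.2)).congr_deriv ?_
  simp only [field, rateQ]
  ring

/-- A preliminary lower bound on `Q`, which depends on the bound assumed for the solution. -/
theorem ClassicalOn.exists_lower_Q {p : Params} (hlam : 0 < p.lam) {X₀ : State} {T R : ℝ}
    {X : ℝ → State} (h₀ : Admissible X₀) (hX : ClassicalOn p X₀ T R X) :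
    ∃ q₀ : ℝ, 0 < q₀ ∧ q₀ ≤ 1 ∧ ∀ t ∈ Icc 0 T, ∀ ξ, q₀ ≤ (X t).Q ξ := by
  obtain ⟨L, hL, H⟩ := h₀.exists_field_const hlam R
  set c := 1 + |R| ^ 2 + coeffBound p * (|R| + |R| ^ 3 + |R| ^ 4) + L with hc
  have hc0 : 0 ≤ c := by have := coeffBound_nonneg p; positivity
  have hrate : ∀ ξ, ∀ t ∈ Icc 0 T, |rateQ p t (X t) ξ| ≤ c := by
    intro ξ t ht
    have hb := hX.bounded t ht
    have hcl : ∀ ξ, CloseAt (X t) (X t) 0 ξ := fun ξ => closeAt_iff.2 (by simp)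
    refine abs_rateQ_le hlam ht.1 (V_mem_of_constraint (hX.constraint h₀ ht ξ)).2.2
      ((hb ξ).K.trans (le_abs_self R)) ?_
    exact (H t t ht.1 ht.1 _ _ (hX.meas t ht).aesm (hX.meas t ht).aesm (Eventually.of_forall hb)
      (Eventually.of_forall hb) 0 le_rfl (by simp) (Eventually.of_forall hcl) ξ (hb ξ) (hb ξ)
      (hcl ξ)).1
  refine ⟨Real.exp (-(c * |T|)), Real.exp_pos _, Real.exp_le_one_iff.2 ?_, fun t ht ξ => ?_⟩
  · have := mul_nonneg hc0 (abs_nonneg T); linarith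
  · refine le_trans (Real.exp_le_exp.2 ?_) (hX.exp_bounds_Q h₀ (hrate ξ) ht).1
    have : c * t ≤ c * |T| := mul_le_mul_of_nonneg_left (ht.2.trans (le_abs_self T)) hc0
    linarith

/-! ### Domination by a square integrable function -/

/-- A function with the size of the square of the initial data. -/
def domBase (X₀ : State) (ξ : ℝ) : ℝ := X₀.K ξ ^ 2 + X₀.V ξ

/-- The average of `domBase` against a slowly decaying exponential. -/
def domConv (X₀ : State) (ξ : ℝ) : ℝ := ∫ η, Real.exp (-(1 / 2 * |ξ - η|)) * domBase X₀ η

/-- The square integrable function which, up to a constant, dominates the solution at all times. -/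
def domFun (X₀ : State) (ξ : ℝ) : ℝ := Real.sqrt (domBase X₀ ξ) + Real.sqrt (domConv X₀ ξ)

/-- A variant of `domFun` that is bounded below by a positive constant, so that every bounded
function is at most a multiple of it. -/
def domAux (X₀ : State) (δ ξ : ℝ) : ℝ :=
  Real.sqrt (domBase X₀ ξ) + Real.sqrt (domConv X₀ ξ + δ)

theorem domFun_nonneg (X₀ : State) (ξ : ℝ) : 0 ≤ domFun X₀ ξ := by unfold domFun; positivity

theorem le_domFun_of_forall {X₀ : State} {x c ξ : ℝ}
    (h : ∀ δ, 0 < δ → x ≤ c * domAux X₀ δ ξ) : x ≤ c * domFun X₀ ξ := by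
  have hcont : Continuous fun δ => c * domAux X₀ δ ξ := by unfold domAux; fun_prop
  have hlim : Tendsto (fun δ => c * domAux X₀ δ ξ) (𝓝[>] 0) (𝓝 (c * domFun X₀ ξ)) := by
    have := (hcont.tendsto 0).mono_left (nhdsWithin_le_nhds (s := Ioi 0))
    simpa [domAux, domFun] using this
  exact ge_of_tendsto hlim (by filter_upwards [self_mem_nhdsWithin] with δ hδ using h δ hδ)

namespace Admissible

variable {X₀ : State} (h₀ : Admissible X₀)
include h₀

theorem domBase_nonneg (ξ : ℝ) : 0 ≤ domBase X₀ ξ :=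
  add_nonneg (sq_nonneg _) (h₀.V_nonneg ξ)

theorem domConv_nonneg (ξ : ℝ) : 0 ≤ domConv X₀ ξ :=
  integral_nonneg fun η => mul_nonneg (Real.exp_pos _).le (h₀.domBase_nonneg η)

theorem integrable_domBase : Integrable (domBase X₀) volume :=
  h₀.integrable_K_sq.add h₀.integrable_V

theorem exists_bound_K : ∃ B : ℝ, ∀ ξ, |X₀.K ξ| ≤ B := by
  refine h₀.isPrim_K.exists_bound h₀.integrable_K_sq (h₀.integrable_V.mono'
    (h₀.measurable_W.pow_const 2).aestronglyMeasurable (Eventually.of_forall fun x => ?_))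
  rw [Real.norm_of_nonneg (sq_nonneg _)]
  nlinarith [h₀.constraint x, sq_nonneg (X₀.V x)]

theorem exists_bound_domBase : ∃ B : ℝ, ∀ ξ, domBase X₀ ξ ≤ B := by
  obtain ⟨B, hB⟩ := h₀.exists_bound_K
  refine ⟨B ^ 2 + 1, fun ξ => add_le_add ?_ (V_mem_of_constraint (h₀.constraint ξ)).2.1⟩
  rw [← sq_abs]
  exact pow_le_pow_left₀ (abs_nonneg _) (hB ξ) 2

theorem measurable_domBase : Measurable (domBase X₀) :=
  (h₀.meas.K.pow_const 2).add h₀.meas.V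

theorem integrable_kernel_mul_domBase {q : ℝ} (hq : 0 < q) (ξ : ℝ) :
    Integrable fun η => Real.exp (-(q * |ξ - η|)) * domBase X₀ η := by
  refine h₀.integrable_domBase.bdd_mul (c := 1) ?_ ?_
  · exact (by fun_prop : Continuous fun η => Real.exp (-(q * |ξ - η|))).aestronglyMeasurable
  · refine Eventually.of_forall fun η => ?_
    rw [Real.norm_of_nonneg (Real.exp_pos _).le, Real.exp_le_one_iff]
    have : 0 ≤ q * |ξ - η| := by positivity
    linarith

theorem integrable_domConv : Integrable (domConv X₀) volume := by
  have h := (h₀.integrable_domBase.convolution_integrand (ContinuousLinearMap.mul ℝ ℝ)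
    (integrable_exp_neg_mul_abs (q := 1 / 2) (by norm_num))).integral_prod_left
  refine h.congr (Eventually.of_forall fun ξ => ?_)
  simp only [domConv, ContinuousLinearMap.mul_apply', mul_comm]

theorem measurable_domConv : Measurable (domConv X₀) := by
  have h : Measurable fun z : ℝ × ℝ => Real.exp (-(1 / 2 * |z.1 - z.2|)) * domBase X₀ z.2 :=
    (by fun_prop : Continuous fun z : ℝ × ℝ => Real.exp (-(1 / 2 * |z.1 - z.2|))).measurable.mul
      (h₀.measurable_domBase.comp measurable_snd)
  exact (h.stronglyMeasurable.integral_prod_right (f := fun ξ η =>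
    Real.exp (-(1 / 2 * |ξ - η|)) * domBase X₀ η)).measurable

theorem measurable_domFun : Measurable (domFun X₀) :=
  h₀.measurable_domBase.sqrt.add h₀.measurable_domConv.sqrt

theorem integrable_domFun_sq : Integrable (fun ξ => domFun X₀ ξ ^ 2) volume := by
  refine ((h₀.integrable_domBase.add h₀.integrable_domConv).const_mul 2).mono'
    (h₀.measurable_domFun.pow_const 2).aestronglyMeasurable (Eventually.of_forall fun ξ => ?_)
  rw [Real.norm_of_nonneg (sq_nonneg _), domFun]
  simp only [Pi.add_apply]
  nlinarith [Real.sq_sqrt (h₀.domBase_nonneg ξ), Real.sq_sqrt (h₀.domConv_nonneg ξ),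
    sq_nonneg (Real.sqrt (domBase X₀ ξ) - Real.sqrt (domConv X₀ ξ))]

theorem exists_bound_domFun : ∃ B : ℝ, 0 ≤ B ∧ ∀ ξ, domFun X₀ ξ ≤ B := by
  obtain ⟨B, hB⟩ := h₀.exists_bound_domBase
  have hB0 : 0 ≤ B := (h₀.domBase_nonneg 0).trans (hB 0)
  refine ⟨Real.sqrt B + Real.sqrt (4 * B), by positivity, fun ξ => add_le_add
    (Real.sqrt_le_sqrt (hB ξ)) (Real.sqrt_le_sqrt ?_)⟩
  calc domConv X₀ ξ ≤ ∫ η, Real.exp (-(1 / 2 * |ξ - η|)) * B :=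
        integral_mono (h₀.integrable_kernel_mul_domBase (by norm_num) ξ)
          ((integrable_kernel (by norm_num) ξ).mul_const B) fun η =>
          mul_le_mul_of_nonneg_left (hB η) (Real.exp_pos _).le
    _ = 4 * B := by rw [integral_mul_const, integral_kernel (by norm_num)]; norm_num

/-- The averaged function varies slowly. -/
theorem domConv_add_le {δ : ℝ} (hδ : 0 ≤ δ) (ξ η : ℝ) :
    domConv X₀ η + δ ≤ Real.exp (1 / 2 * |ξ - η|) * (domConv X₀ ξ + δ) := by
  have h1 : domConv X₀ η ≤ Real.exp (1 / 2 * |ξ - η|) * domConv X₀ ξ := by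
    rw [domConv, domConv, ← integral_const_mul]
    refine integral_mono (h₀.integrable_kernel_mul_domBase (by norm_num) η)
      ((h₀.integrable_kernel_mul_domBase (by norm_num) ξ).const_mul _) fun x => ?_
    simp only
    rw [← mul_assoc, ← Real.exp_add]
    refine mul_le_mul_of_nonneg_right (Real.exp_le_exp.2 ?_) (h₀.domBase_nonneg x)
    have := abs_sub_le ξ η x
    linarith
  have h2 : 1 ≤ Real.exp (1 / 2 * |ξ - η|) := Real.one_le_exp (by positivity)
  nlinarith

/-- Convolution with the exponential kernel reproduces `domAux` up to a constant. -/
theorem integrable_kernel_mul_domAux {δ : ℝ} (hδ : 0 < δ) (ξ : ℝ) :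
    Integrable (fun η => Real.exp (-(1 * |ξ - η|)) * domAux X₀ δ η) ∧
      ∫ η, Real.exp (-(1 * |ξ - η|)) * domAux X₀ δ η ≤ 6 * domAux X₀ δ ξ := by
  set s := Real.sqrt (domConv X₀ ξ + δ) with hs
  have hspos : 0 < s := Real.sqrt_pos.2 (by linarith [h₀.domConv_nonneg ξ])
  have hss : s ^ 2 = domConv X₀ ξ + δ := Real.sq_sqrt (by linarith [h₀.domConv_nonneg ξ])
  -- the rough part is handled by the inequality between the means
  have h1 : ∀ η, Real.exp (-(1 * |ξ - η|)) * domAux X₀ δ η ≤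
      1 / (2 * s) * (Real.exp (-(1 / 2 * |ξ - η|)) * domBase X₀ η) +
        s / 2 * Real.exp (-(1 * |ξ - η|)) + s * Real.exp (-(1 / 2 * |ξ - η|)) := by
    intro η
    have a1 : Real.sqrt (domBase X₀ η) ≤ 1 / (2 * s) * domBase X₀ η + s / 2 := by
      have : Real.sqrt (domBase X₀ η) ^ 2 = domBase X₀ η := Real.sq_sqrt (h₀.domBase_nonneg η)
      have e : 1 / (2 * s) * Real.sqrt (domBase X₀ η) ^ 2 + s / 2 - Real.sqrt (domBase X₀ η) =
          (Real.sqrt (domBase X₀ η) - s) ^ 2 / (2 * s) := by field_simp; ring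
      have h2 : 0 ≤ (Real.sqrt (domBase X₀ η) - s) ^ 2 / (2 * s) := by positivity
      rw [this] at e
      linarith
    have a2 : Real.sqrt (domConv X₀ η + δ) ≤ Real.exp (1 / 2 * |ξ - η|) * s := by
      refine Real.sqrt_le_iff.2 ⟨by positivity, ?_⟩
      have h2 : 1 ≤ Real.exp (1 / 2 * |ξ - η|) := Real.one_le_exp (by positivity)
      have h3 := h₀.domConv_add_le hδ.le ξ η
      rw [mul_pow, hss]
      have h4 : 0 < domConv X₀ ξ + δ := by linarith [h₀.domConv_nonneg ξ]
      nlinarith [mul_le_mul_of_nonneg_right h2 (mul_pos (Real.exp_pos (1 / 2 * |ξ - η|)) h4).le]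
    have a3 : Real.exp (-(1 * |ξ - η|)) * (Real.exp (1 / 2 * |ξ - η|) * s) =
        s * Real.exp (-(1 / 2 * |ξ - η|)) := by
      rw [← mul_assoc, ← Real.exp_add, mul_comm]
      ring_nf
    have a4 : Real.exp (-(1 * |ξ - η|)) ≤ Real.exp (-(1 / 2 * |ξ - η|)) :=
      Real.exp_le_exp.2 (by have := abs_nonneg (ξ - η); linarith)
    have a5 : Real.exp (-(1 * |ξ - η|)) * (1 / (2 * s) * domBase X₀ η) ≤
        1 / (2 * s) * (Real.exp (-(1 / 2 * |ξ - η|)) * domBase X₀ η) := by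
      have : 0 ≤ 1 / (2 * s) * domBase X₀ η := mul_nonneg (by positivity) (h₀.domBase_nonneg η)
      nlinarith
    have := Real.exp_pos (-(1 * |ξ - η|))
    calc Real.exp (-(1 * |ξ - η|)) * domAux X₀ δ η
        ≤ Real.exp (-(1 * |ξ - η|)) *
          ((1 / (2 * s) * domBase X₀ η + s / 2) + Real.exp (1 / 2 * |ξ - η|) * s) :=
          mul_le_mul_of_nonneg_left (add_le_add a1 a2) this.le
      _ ≤ _ := by rw [mul_add, mul_add, a3]; linarith
  have i1 := (h₀.integrable_kernel_mul_domBase (q := 1 / 2) (by norm_num) ξ).const_mul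
    (1 / (2 * s))
  have i2 := (integrable_kernel one_pos ξ).const_mul (s / 2)
  have i3 := (integrable_kernel (q := 1 / 2) (by norm_num) ξ).const_mul s
  have hint : Integrable (fun η => Real.exp (-(1 * |ξ - η|)) * domAux X₀ δ η) := by
    refine ((i1.add i2).add i3).mono' ?_ (Eventually.of_forall fun η => ?_)
    · refine Measurable.aestronglyMeasurable ?_
      exact (by fun_prop : Continuous fun η => Real.exp (-(1 * |ξ - η|))).measurable.mul
        (h₀.measurable_domBase.sqrt.add (h₀.measurable_domConv.add_const δ).sqrt)
    · rw [Real.norm_of_nonneg (by unfold domAux; positivity)]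
      exact h1 η
  refine ⟨hint, (integral_mono hint ((i1.add i2).add i3) h1).trans ?_⟩
  have e : ∫ η, (((fun η => 1 / (2 * s) * (Real.exp (-(1 / 2 * |ξ - η|)) * domBase X₀ η)) +
      fun η => s / 2 * Real.exp (-(1 * |ξ - η|))) +
      fun η => s * Real.exp (-(1 / 2 * |ξ - η|))) η =
      1 / (2 * s) * domConv X₀ ξ + s / 2 * (2 / 1) + s * (2 / (1 / 2)) := by
    rw [integral_add' (i1.add i2) i3, integral_add' i1 i2, integral_const_mul, integral_const_mul,
      integral_const_mul, integral_kernel one_pos, integral_kernel (by norm_num)]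
    rfl
  rw [e]
  have h5 : 1 / (2 * s) * domConv X₀ ξ ≤ s / 2 := by
    rw [div_mul_eq_mul_div, one_mul, div_le_iff₀ (by positivity)]
    nlinarith
  have h6 : s ≤ domAux X₀ δ ξ := by
    unfold domAux
    linarith [Real.sqrt_nonneg (domBase X₀ ξ)]
  linarith

/-- If `K`, `V` and `W` are dominated by a function that is stable under convolution with the
exponential kernel, then so are the nonlocal terms and the right-hand side. -/
theorem exists_dom_const {p : Params} (hlam : 0 < p.lam) (R : ℝ) :
    ∃ C : ℝ, 0 < C ∧ ∀ t, 0 ≤ t → ∀ X : State, X.AESM → (∀ ξ, BoundedAt X₀ X R ξ) →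
      ∀ ρ, 0 ≤ ρ → ∀ μ : ℝ → ℝ, (∀ ξ, 0 ≤ μ ξ) →
      (∀ ξ, Integrable fun η => Real.exp (-(1 * |ξ - η|)) * μ η) →
      (∀ ξ, ∫ η, Real.exp (-(1 * |ξ - η|)) * μ η ≤ 6 * μ ξ) →
      (∀ ξ, |X.K ξ| ≤ ρ * μ ξ ∧ |X.V ξ| ≤ ρ * μ ξ ∧ |X.W ξ| ≤ ρ * μ ξ) →
      ∀ ξ, |source p t X ξ| ≤ C * ρ * μ ξ ∧ |lagP p t X ξ| ≤ C * ρ * μ ξ ∧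
        ∀ i, |(field p t X).comp i ξ| ≤ C * ρ * μ ξ := by
  obtain ⟨L, hL, H⟩ := h₀.exists_field_const hlam R
  set R₂ := max (max R 1) L with hR₂
  have hRR : R ≤ R₂ := (le_max_left _ _).trans (le_max_left _ _)
  have h1R : 1 ≤ R₂ := (le_max_right _ _).trans (le_max_left _ _)
  have hLR : L ≤ R₂ := le_max_right _ _
  obtain ⟨L₂, hL₂, H₂⟩ := exists_poly_const p R₂
  set D := kernelConst X₀ R
  have hD : 0 < D := kernelConst_pos _ _
  refine ⟨L₂ * (1 + 3 * D * L₂) + 3 * D * L₂ + 1, by positivity, ?_⟩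
  set C := L₂ * (1 + 3 * D * L₂) + 3 * D * L₂ + 1 with hC
  intro t ht X hXm hXb ρ hρ μ hμ hμi hμc hXμ
  have he := exp_lam_le hlam ht
  have hPb : ∀ ξ, |lagP p t X ξ| ≤ L := fun ξ =>
    (H t t ht ht X X hXm hXm (Eventually.of_forall hXb) (Eventually.of_forall hXb) 0 le_rfl
      (by simp) (Eventually.of_forall fun η => closeAt_iff.2 (by simp)) ξ (hXb ξ) (hXb ξ)
      (closeAt_iff.2 (by simp))).1
  -- all polynomials vanish where `K = V = W = P = 0`
  have hpoly : ∀ φ ∈ ({polySource p, polyV p, polyW p, polyQ p} : Set ((Fin 6 → ℝ) → ℝ)),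
      ∀ ξ P δ, |P| ≤ R₂ → |P| ≤ δ → ρ * μ ξ ≤ δ →
        |φ (localVec (Real.exp (-p.lam * t)) X P ξ)| ≤ L₂ * δ := by
    intro φ hφ ξ P δ hP hPδ hδ
    have hδ0 : 0 ≤ δ := (abs_nonneg _).trans hPδ
    have hv := abs_localVec_le ((hXb ξ).mono hRR) (he.trans h1R) hP
    have hv0 : ∀ i, |(![Real.exp (-p.lam * t), 0, 0, 0, X.Q ξ, 0] : Fin 6 → ℝ) i| ≤ R₂ := by
      have hR0 : |(0 : ℝ)| ≤ R₂ := by simpa using zero_le_one.trans h1R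
      intro i
      fin_cases i
      exacts [he.trans h1R, hR0, hR0, hR0, (hXb ξ).Q.trans hRR, hR0]
    have hd : ∀ i, |localVec (Real.exp (-p.lam * t)) X P ξ i -
        (![Real.exp (-p.lam * t), 0, 0, 0, X.Q ξ, 0] : Fin 6 → ℝ) i| ≤ δ := by
      obtain ⟨hK, hV, hW⟩ := hXμ ξ
      intro i
      fin_cases i
      · simpa [localVec] using hδ0
      · simpa [localVec] using hK.trans hδ
      · simpa [localVec] using hV.trans hδ
      · simpa [localVec] using hW.trans hδ
      · simpa [localVec] using hδ0
      · simpa [localVec] using hPδ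
    have h0 : φ ![Real.exp (-p.lam * t), 0, 0, 0, X.Q ξ, 0] = 0 := by
      rcases hφ with rfl | rfl | rfl | rfl <;>
        simp [polySource, polyV, polyW, polyQ, polyFactor, hamilPoly]
    have := (H₂ φ hφ _ _ hv hv0).2 δ hδ0 hd
    rwa [h0, sub_zero] at this
  have hsrc : ∀ ξ, |source p t X ξ| ≤ L₂ * (ρ * μ ξ) := fun ξ => by
    rw [source_eq p t X 0]
    exact hpoly _ (by simp) ξ 0 _ (by simpa using zero_le_one.trans h1R)
      (by simpa using mul_nonneg hρ (hμ ξ)) le_rfl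
  have hnl : ∀ ξ, ∀ s : ℝ → ℝ, (∀ η, |s η| ≤ 1) →
      |nonlocal s (charY p t X) (source p t X) ξ| ≤ D * (L₂ * ρ * (6 * μ ξ)) := by
    intro ξ s hs
    have hi : ∀ η, Real.exp (-(1 * |ξ - η|)) * (L₂ * (ρ * μ η)) =
        L₂ * ρ * (Real.exp (-(1 * |ξ - η|)) * μ η) := fun η => by ring
    refine (abs_nonlocal_le (q := 1) (D := D) (w := fun η => L₂ * (ρ * μ η)) hs
      (Eventually.of_forall fun η => h₀.exp_charY_le (hXb ξ).Z (hXb η).Z)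
      (Eventually.of_forall hsrc) ?_).trans ?_
    · simp_rw [hi]
      exact (hμi ξ).const_mul _
    · simp_rw [hi]
      rw [integral_const_mul]
      have := hμc ξ
      gcongr
  have hmono : ∀ ξ c, c ≤ C → c * (ρ * μ ξ) ≤ C * ρ * μ ξ := fun ξ c hc => by
    rw [mul_assoc C]
    exact mul_le_mul_of_nonneg_right hc (mul_nonneg hρ (hμ ξ))
  have hP : ∀ ξ, |lagP p t X ξ| ≤ 3 * D * L₂ * (ρ * μ ξ) := fun ξ => by
    rw [lagP_eq_nonlocal, abs_mul]
    have := hnl ξ (fun _ => 1) (by simp)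
    norm_num
    linarith
  have hG : ∀ ξ, |lagG p t X ξ| ≤ 3 * D * L₂ * (ρ * μ ξ) := fun ξ => by
    rw [lagG_eq_nonlocal, abs_mul]
    have := hnl ξ (fun η => Real.sign (ξ - η)) (fun _ => abs_sign_le _)
    norm_num
    linarith
  have hloc : ∀ φ ∈ ({polySource p, polyV p, polyW p, polyQ p} : Set ((Fin 6 → ℝ) → ℝ)),
      ∀ ξ, |φ (localVec (Real.exp (-p.lam * t)) X (lagP p t X ξ) ξ)| ≤ C * ρ * μ ξ := by
    intro φ hφ ξ
    have h1 : 0 ≤ ρ * μ ξ := mul_nonneg hρ (hμ ξ)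
    have h2 : 0 ≤ 3 * D * L₂ := by positivity
    refine (hpoly φ hφ ξ _ ((1 + 3 * D * L₂) * (ρ * μ ξ)) ((hPb ξ).trans hLR)
      ((hP ξ).trans ?_) ?_).trans ?_
    · nlinarith
    · nlinarith
    · rw [← mul_assoc]
      exact hmono ξ _ (by linarith)
  have hLp : 0 < L₂ * (3 * D * L₂) := by positivity
  have hDp : 0 < 3 * D * L₂ := by positivity
  intro ξ
  refine ⟨(hsrc ξ).trans (hmono ξ _ (by linarith)), (hP ξ).trans (hmono ξ _ (by nlinarith)),
    fun i => ?_⟩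
  fin_cases i
  · change |Real.exp (-p.lam * t) * X.K ξ| ≤ _
    rw [abs_mul]
    calc _ ≤ 1 * |X.K ξ| := by gcongr
      _ ≤ 1 * (ρ * μ ξ) := by have := (hXμ ξ).1; gcongr
      _ ≤ _ := hmono ξ _ (by nlinarith)
  · change |-lagG p t X ξ| ≤ _
    rw [abs_neg]
    exact (hG ξ).trans (hmono ξ _ (by nlinarith))
  · change |(field p t X).V ξ| ≤ _
    rw [field_V_eq]; exact hloc _ (by simp) ξ
  · change |(field p t X).W ξ| ≤ _
    rw [field_W_eq]; exact hloc _ (by simp) ξ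
  · change |(field p t X).Q ξ| ≤ _
    rw [field_Q_eq]; exact hloc _ (by simp) ξ

end Admissible

/-- The pointwise bounds by multiples of `domFun`, collected at one time and one point. -/
structure DomAt (p : Params) (X₀ : State) (C t : ℝ) (X : State) (ξ : ℝ) : Prop where
  Z : |X.Z ξ - X₀.Z ξ| ≤ C * domFun X₀ ξ
  K : |X.K ξ| ≤ C * domFun X₀ ξ
  V : |X.V ξ| ≤ C * domFun X₀ ξ
  W : |X.W ξ| ≤ C * domFun X₀ ξ
  Q : |X.Q ξ - 1| ≤ C * domFun X₀ ξ
  source : |source p t X ξ| ≤ C * domFun X₀ ξ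
  P : |lagP p t X ξ| ≤ C * domFun X₀ ξ
  field : ∀ i, |(field p t X).comp i ξ| ≤ C * domFun X₀ ξ

theorem DomAt.G {p : Params} {X₀ : State} {C t : ℝ} {X : State} {ξ : ℝ}
    (h : DomAt p X₀ C t X ξ) : |lagG p t X ξ| ≤ C * domFun X₀ ξ := by
  have : |-lagG p t X ξ| ≤ C * domFun X₀ ξ := h.field 1
  rwa [abs_neg] at this

/-- A classical solution is dominated by `domFun` on bounded time intervals. Grönwall's lemma applies
with the weight `domAux`, which has a positive lower bound, with constants that do not depend on
`δ`; the bound by `domFun` arises in the limit `δ → 0`. -/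
theorem ClassicalOn.exists_domAt {p : Params} (hlam : 0 < p.lam) {X₀ : State} {T R : ℝ}
    {X : ℝ → State} (h₀ : Admissible X₀) (hX : ClassicalOn p X₀ T R X) :
    ∃ C : ℝ, 0 < C ∧ ∀ t ∈ Icc 0 T, ∀ ξ, DomAt p X₀ C t (X t) ξ := by
  obtain ⟨C, hC, H⟩ := h₀.exists_dom_const hlam R
  set ρ := 2 * Real.exp (2 * C * |T|) with hρ
  have hρ0 : 0 < ρ := by positivity
  have main : ∀ δ, 0 < δ → ∀ t ∈ Icc 0 T, ∀ ξ, |(X t).K ξ| ≤ ρ * domAux X₀ δ ξ ∧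
      |(X t).V ξ| ≤ ρ * domAux X₀ δ ξ ∧ |(X t).W ξ| ≤ ρ * domAux X₀ δ ξ := by
    intro δ hδ
    have hsδ : 0 < Real.sqrt δ := Real.sqrt_pos.2 hδ
    have hlow : ∀ ξ, Real.sqrt δ ≤ domAux X₀ δ ξ := fun ξ => by
      have h1 : Real.sqrt δ ≤ Real.sqrt (domConv X₀ ξ + δ) :=
        Real.sqrt_le_sqrt (by linarith [h₀.domConv_nonneg ξ])
      unfold domAux
      linarith [Real.sqrt_nonneg (domBase X₀ ξ)]
    have hpos : ∀ ξ, 0 ≤ domAux X₀ δ ξ := fun ξ => hsδ.le.trans (hlow ξ)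
    have hbase : ∀ ξ x, x ^ 2 ≤ domBase X₀ ξ → |x| ≤ domAux X₀ δ ξ := fun ξ x hx => by
      have := Real.abs_le_sqrt hx
      unfold domAux
      linarith [Real.sqrt_nonneg (domConv X₀ ξ + δ)]
    -- the components `K`, `V` and `W`
    let c : Fin 3 → Fin 5 := ![1, 2, 3]
    have key : ∀ t ∈ Icc 0 T, ∀ i : Fin 3, ∀ ξ,
        |(X t).comp (c i) ξ| ≤ ρ * domAux X₀ δ ξ := by
      intro t ht i ξ
      have hgw := gronwall_family (ι := Fin 3 × ℝ) (T := T)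
        (φ := fun j t => (X t).comp (c j.1) j.2)
        (φ' := fun j t => (field p t (X t)).comp (c j.1) j.2)
        (w := fun j => domAux X₀ δ j.2) (a := 1) (M := |R| / Real.sqrt δ) hC zero_le_one
        (by positivity) (fun j => hpos j.2)
        (fun j s hs => (hX.equation j.2 s hs (c j.1)).continuousWithinAt)
        (fun j s hs => (hX.equation j.2 s (Ioo_subset_Icc_self hs) (c j.1)).hasDerivAt
          (Icc_mem_nhds hs.1 hs.2))
        (fun j => by
          have hc := h₀.constraint j.2
          have hV := V_mem_of_constraint hc
          obtain ⟨i, ξ⟩ := j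
          rw [one_mul, hX.initial]
          refine hbase ξ _ ?_
          unfold domBase
          simp only at hc hV
          fin_cases i
          · change X₀.K ξ ^ 2 ≤ _
            linarith
          · change X₀.V ξ ^ 2 ≤ _
            nlinarith [sq_nonneg (X₀.W ξ), sq_nonneg (X₀.K ξ)]
          · change X₀.W ξ ^ 2 ≤ _
            nlinarith [sq_nonneg (X₀.V ξ), sq_nonneg (X₀.K ξ)])
        (fun j s hs => by
          have h1 : |(X s).comp (c j.1) j.2| ≤ |R| := by
            have hb := (hX.bounded s hs j.2)
            obtain ⟨i, ξ⟩ := j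
            fin_cases i
            exacts [hb.K.trans (le_abs_self R), hb.V.trans (le_abs_self R),
              hb.W.trans (le_abs_self R)]
          refine h1.trans ?_
          rw [div_mul_eq_mul_div, le_div_iff₀ hsδ]
          exact mul_le_mul_of_nonneg_left (hlow _) (abs_nonneg R))
        (fun s hs r hr hsr j => by
          have hs' := Ioo_subset_Icc_self hs
          exact (H s hs.1.le (X s) (hX.meas s hs').aesm (hX.bounded s hs') r hr (domAux X₀ δ) hpos
            (fun ξ => (h₀.integrable_kernel_mul_domAux hδ ξ).1)
            (fun ξ => (h₀.integrable_kernel_mul_domAux hδ ξ).2)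
            (fun ξ => ⟨hsr (0, ξ), hsr (1, ξ), hsr (2, ξ)⟩) j.2).2.2 (c j.1))
        (i, ξ) ht
      refine hgw.trans (mul_le_mul_of_nonneg_right ?_ (hpos ξ))
      rw [hρ, mul_one]
      have : 2 * C * t ≤ 2 * C * |T| :=
        mul_le_mul_of_nonneg_left (ht.2.trans (le_abs_self T)) (by positivity)
      gcongr
    exact fun t ht ξ => ⟨key t ht 0 ξ, key t ht 1 ξ, key t ht 2 ξ⟩
  have hall : ∀ δ, 0 < δ → ∀ t ∈ Icc 0 T, ∀ ξ, |source p t (X t) ξ| ≤ C * ρ * domAux X₀ δ ξ ∧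
      |lagP p t (X t) ξ| ≤ C * ρ * domAux X₀ δ ξ ∧
        ∀ i, |(field p t (X t)).comp i ξ| ≤ C * ρ * domAux X₀ δ ξ := fun δ hδ t ht =>
    H t ht.1 (X t) (hX.meas t ht).aesm (hX.bounded t ht) ρ hρ0.le (domAux X₀ δ)
      (fun ξ => by unfold domAux; positivity)
      (fun ξ => (h₀.integrable_kernel_mul_domAux hδ ξ).1)
      (fun ξ => (h₀.integrable_kernel_mul_domAux hδ ξ).2) (main δ hδ t ht)
  have hCρ : 0 ≤ C * ρ := by positivity
  have hfield : ∀ t ∈ Icc 0 T, ∀ ξ, ∀ i, |(field p t (X t)).comp i ξ| ≤ C * ρ * domFun X₀ ξ :=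
    fun t ht ξ i => le_domFun_of_forall fun δ hδ => (hall δ hδ t ht ξ).2.2 i
  have hdisp : ∀ t ∈ Icc 0 T, ∀ ξ, ∀ i,
      |(X t).comp i ξ - X₀.comp i ξ| ≤ C * ρ * |T| * domFun X₀ ξ := by
    intro t ht ξ i
    refine (hX.abs_comp_sub_le i ξ (fun s hs => hfield s hs ξ i) ht).trans ?_
    have h1 := mul_nonneg hCρ (domFun_nonneg X₀ ξ)
    have h2 := mul_le_mul_of_nonneg_left (ht.2.trans (le_abs_self T)) h1
    linarith
  refine ⟨ρ + C * ρ + C * ρ * |T|, by positivity, fun t ht ξ => ?_⟩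
  have hm : ∀ x c, c ≤ ρ + C * ρ + C * ρ * |T| → x ≤ c * domFun X₀ ξ →
      x ≤ (ρ + C * ρ + C * ρ * |T|) * domFun X₀ ξ := fun x c hc hx =>
    hx.trans (mul_le_mul_of_nonneg_right hc (domFun_nonneg X₀ ξ))
  have hTp : 0 ≤ C * ρ * |T| := by positivity
  constructor
  · exact hm _ _ (by linarith) (hdisp t ht ξ 0)
  · exact hm _ ρ (by linarith)
      (le_domFun_of_forall fun δ hδ => (main δ hδ t ht ξ).1)
  · exact hm _ ρ (by linarith)
      (le_domFun_of_forall fun δ hδ => (main δ hδ t ht ξ).2.1)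
  · exact hm _ ρ (by linarith)
      (le_domFun_of_forall fun δ hδ => (main δ hδ t ht ξ).2.2)
  · have := hdisp t ht ξ 4
    change |(X t).Q ξ - X₀.Q ξ| ≤ _ at this
    rw [h₀.Q_eq] at this
    exact hm _ _ (by linarith) this
  · exact hm _ (C * ρ) (by linarith)
      (le_domFun_of_forall fun δ hδ => (hall δ hδ t ht ξ).1)
  · exact hm _ (C * ρ) (by linarith)
      (le_domFun_of_forall fun δ hδ => (hall δ hδ t ht ξ).2.1)
  · exact fun i => hm _ (C * ρ) (by linarith) (hfield t ht ξ i)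

/-! ### Derivatives of the nonlocal terms -/

theorem IsPrim.monotone {y w : ℝ → ℝ} (hy : IsPrim y w) (hw : ∀ x, 0 ≤ w x) : Monotone y := by
  intro a b hab
  have := intervalIntegral.integral_nonneg (μ := volume) hab fun x _ => hw x
  rw [hy.integral_eq] at this
  linarith

/-- The operator with the kernel `e^{-|y(ξ) - y(η)|}` and the one with the additional factor
`sgn(ξ - η)` are, up to a local term, primitives of each other when `y` is nondecreasing: both are
combinations of `e^{-y} ∫_{-∞}^ξ e^y f` and `e^y ∫_ξ^∞ e^{-y} f`. -/
theorem isPrim_nonlocal {y w f : ℝ → ℝ} {D q F : ℝ} (hq : 0 < q)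
    (hy : IsPrim y w) (hw : ∀ x, 0 ≤ w x)
    (hD : ∀ ξ η, Real.exp (-|y ξ - y η|) ≤ D * Real.exp (-(q * |ξ - η|)))
    (hf : ∀ η, |f η| ≤ F) (hfm : AEStronglyMeasurable f volume) :
    IsPrim (fun ξ => nonlocal (fun _ => 1) y f ξ)
      (fun ξ => -w ξ * nonlocal (fun η => Real.sign (ξ - η)) y f ξ) ∧
    IsPrim (fun ξ => nonlocal (fun η => Real.sign (ξ - η)) y f ξ)
      (fun ξ => 2 * f ξ - w ξ * nonlocal (fun _ => 1) y f ξ) := by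
  have hmono := hy.monotone hw
  have hyc := hy.continuous
  have hfl : LocallyIntegrable f volume :=
    (locallyIntegrable_const F).mono hfm (Eventually.of_forall fun x => by
      rw [Real.norm_eq_abs]; exact (hf x).trans (le_abs_self F))
  -- the contributions from the left and from the right of `ξ`
  set I₁ : ℝ → ℝ := fun ξ => ∫ η in Iic ξ, Real.exp (y η) * f η with hI₁
  set I₂ : ℝ → ℝ := fun ξ => ∫ η in Ioi ξ, Real.exp (-y η) * f η with hI₂
  have hint₁ : ∀ ξ, IntegrableOn (fun η => Real.exp (y η) * f η) (Iic ξ) := by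
    intro ξ
    refine Integrable.mono' (((integrable_kernel hq ξ).const_mul
      (Real.exp (y ξ) * D * F)).integrableOn) ?_ ?_
    · exact ((Real.continuous_exp.comp hyc).aestronglyMeasurable.mul hfm).restrict
    · refine (ae_restrict_iff' measurableSet_Iic).2 (Eventually.of_forall fun η hη => ?_)
      have h1 := hD ξ η
      rw [abs_of_nonneg (sub_nonneg.2 (hmono hη))] at h1
      have h2 : Real.exp (y η) = Real.exp (y ξ) * Real.exp (-(y ξ - y η)) := by
        rw [← Real.exp_add]; ring_nf
      rw [Real.norm_eq_abs, abs_mul, abs_of_pos (Real.exp_pos _), h2]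
      calc _ ≤ Real.exp (y ξ) * (D * Real.exp (-(q * |ξ - η|))) * F := by
            have := hf η
            have := (Real.exp_pos (-(y ξ - y η))).le.trans h1
            gcongr
        _ = _ := by ring
  have hint₂ : ∀ ξ, IntegrableOn (fun η => Real.exp (-y η) * f η) (Ioi ξ) := by
    intro ξ
    refine Integrable.mono' (((integrable_kernel hq ξ).const_mul
      (Real.exp (-y ξ) * D * F)).integrableOn) ?_ ?_
    · exact ((Real.continuous_exp.comp hyc.neg).aestronglyMeasurable.mul hfm).restrict
    · refine (ae_restrict_iff' measurableSet_Ioi).2 (Eventually.of_forall fun η hη => ?_)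
      have h1 := hD ξ η
      rw [abs_of_nonpos (sub_nonpos.2 (hmono (le_of_lt hη)))] at h1
      have h2 : Real.exp (-y η) = Real.exp (-y ξ) * Real.exp (-(-(y ξ - y η))) := by
        rw [← Real.exp_add]; ring_nf
      rw [Real.norm_eq_abs, abs_mul, abs_of_pos (Real.exp_pos _), h2]
      calc _ ≤ Real.exp (-y ξ) * (D * Real.exp (-(q * |ξ - η|))) * F := by
            have := hf η
            have := (Real.exp_pos (-(-(y ξ - y η)))).le.trans h1
            gcongr
        _ = _ := by ring
  have hP₁ : IsPrim I₁ (fun η => Real.exp (y η) * f η) :=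
    ⟨hfl.continuous_mul (Real.continuous_exp.comp hyc), fun a b =>
      (intervalIntegral.integral_Iic_sub_Iic (hint₁ a) (hint₁ b)).symm⟩
  have hP₂ : IsPrim I₂ (fun η => -(Real.exp (-y η) * f η)) := by
    refine ⟨(hfl.continuous_mul (Real.continuous_exp.comp hyc.neg)).neg, fun a b => ?_⟩
    rw [intervalIntegral.integral_neg,
      ← intervalIntegral.integral_Ioi_sub_Ioi' (hint₂ a) (hint₂ b)]
    simp only [hI₂]
    ring
  have hA := (hy.neg.exp).mul hP₁
  have hB := (hy.exp).mul hP₂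
  have hexp : ∀ x, Real.exp (-y x) * Real.exp (y x) = 1 := fun x => by
    rw [← Real.exp_add, neg_add_cancel, Real.exp_zero]
  have hsplit : ∀ (s : ℝ → ℝ → ℝ) (σ : ℝ), (∀ ξ η, η < ξ → s ξ η = 1) →
      (∀ ξ η, ξ < η → s ξ η = σ) → (∀ ξ, Measurable (s ξ)) → (∀ ξ η, |s ξ η| ≤ 1) → ∀ ξ,
      nonlocal (s ξ) y f ξ = Real.exp (-y ξ) * I₁ ξ + σ * (Real.exp (y ξ) * I₂ ξ) := by
    intro s σ hs1 hs2 hsm hs ξ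
    have hi := integrable_nonlocal (ξ := ξ) hq (hs ξ) (hsm ξ) (Eventually.of_forall (hD ξ))
      hyc.aestronglyMeasurable (Eventually.of_forall hf) hfm
    rw [nonlocal, ← intervalIntegral.integral_Iic_add_Ioi (b := ξ) hi.integrableOn
      hi.integrableOn]
    congr 1
    · rw [hI₁, ← integral_const_mul]
      refine setIntegral_congr_ae measurableSet_Iic ?_
      filter_upwards [Measure.ae_ne volume ξ] with η hne hη
      have hlt : η < ξ := lt_of_le_of_ne hη hne
      rw [hs1 ξ η hlt, abs_of_nonneg (sub_nonneg.2 (hmono hη)), one_mul, ← mul_assoc,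
        ← Real.exp_add]
      ring_nf
    · rw [hI₂, ← integral_const_mul, ← integral_const_mul]
      refine setIntegral_congr_fun measurableSet_Ioi fun η hη => ?_
      rw [hs2 ξ η hη, abs_of_nonpos (sub_nonpos.2 (hmono (le_of_lt hη)))]
      have : Real.exp (-(-(y ξ - y η))) = Real.exp (y ξ) * Real.exp (-y η) := by
        rw [← Real.exp_add]; ring_nf
      rw [this]
      ring
  have h1 := hsplit (fun _ _ => 1) 1 (by simp) (by simp) (fun _ => measurable_const) (by simp)
  have h2 := hsplit (fun ξ η => Real.sign (ξ - η)) (-1)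
    (fun ξ η h => Real.sign_of_pos (sub_pos.2 h)) (fun ξ η h => Real.sign_of_neg (sub_neg.2 h))
    (fun ξ => measurable_sign.comp (measurable_const.sub measurable_id))
    (fun ξ η => abs_sign_le _)
  constructor
  · rw [show (fun ξ => nonlocal (fun _ => 1) y f ξ) = _ from funext h1]
    simp_rw [one_mul]
    refine (hA.add hB).congr_deriv (Eventually.of_forall fun ξ => ?_)
    simp only [h2]
    ring
  · rw [show (fun ξ => nonlocal (fun η => Real.sign (ξ - η)) y f ξ) = _ from funext h2]
    simp_rw [neg_one_mul, ← sub_eq_add_neg]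
    refine (hA.sub hB).congr_deriv (Eventually.of_forall fun ξ => ?_)
    simp only [h1]
    have e := hexp ξ
    linear_combination (2 * f ξ) * e

/-! ### The relations `y_ξ = Q (1 - V)` and `K_ξ = W Q` -/

/-- Differentiation under an interval integral, for a bounded time derivative. -/
theorem intervalIntegral_param {T : ℝ} {g g' : ℝ → ℝ → ℝ} {c : ℝ}
    (hm : ∀ t ∈ Icc 0 T, AEStronglyMeasurable (g t) volume)
    (h0 : LocallyIntegrable (g 0) volume)
    (hd : ∀ ξ, ∀ t ∈ Icc 0 T, HasDerivWithinAt (fun s => g s ξ) (g' t ξ) (Icc 0 T) t)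
    (hb : ∀ t ∈ Icc 0 T, ∀ ξ, |g' t ξ| ≤ c)
    (hm' : ∀ t ∈ Icc 0 T, AEStronglyMeasurable (g' t) volume) (a b : ℝ) :
    ContinuousOn (fun t => ∫ ξ in a..b, g t ξ) (Icc 0 T) ∧
      ∀ t ∈ Ioo 0 T, HasDerivAt (fun t => ∫ ξ in a..b, g t ξ) (∫ ξ in a..b, g' t ξ) t := by
  obtain ⟨-, h1, h2⟩ := integral_param (μ := volume.restrict (uIoc a b)) (b := fun _ => c)
    (fun t ht => (hm t ht).restrict)
    ((h0.integrableOn_isCompact isCompact_uIcc).mono_set uIoc_subset_uIcc) hd hb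
    ((continuous_const.integrableOn_uIcc).mono_set uIoc_subset_uIcc)
    (fun t ht => (hm' t ht).restrict)
  simp_rw [intervalIntegral.intervalIntegral_eq_integral_uIoc, smul_eq_mul]
  exact ⟨h1.const_mul _, fun t ht => (h2 t ht).const_mul _⟩

section

variable {p : Params} {X₀ : State} {T R : ℝ} {X : ℝ → State}

/-- The time derivative of `Q (1 - V)` is `e^{-λt} W Q`. -/
theorem ClassicalOn.deriv_QV (hX : ClassicalOn p X₀ T R X) (ξ : ℝ) {t : ℝ} (ht : t ∈ Icc 0 T) :
    HasDerivWithinAt (fun s => (X s).Q ξ * (1 - (X s).V ξ))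
      (Real.exp (-p.lam * t) * ((X t).W ξ * (X t).Q ξ)) (Icc 0 T) t := by
  refine ((hX.deriv_Q ξ ht).fun_mul ((hX.deriv_V ξ ht).const_sub 1)).congr_deriv ?_
  simp only [field, factorVW]
  ring

/-- The time derivative of `W Q` is the source minus `P Q (1 - V)`. -/
theorem ClassicalOn.deriv_WQ (h₀ : Admissible X₀) (hX : ClassicalOn p X₀ T R X) (ξ : ℝ) {t : ℝ}
    (ht : t ∈ Icc 0 T) :
    HasDerivWithinAt (fun s => (X s).W ξ * (X s).Q ξ)
      (source p t (X t) ξ - (X t).Q ξ * (1 - (X t).V ξ) * lagP p t (X t) ξ) (Icc 0 T) t := by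
  refine ((hX.deriv_W ξ ht).fun_mul (hX.deriv_Q ξ ht)).congr_deriv ?_
  have hc := hX.constraint h₀ ht ξ
  simp only [field, factorVW, source]
  linear_combination (2 * (X t).Q ξ * (Real.exp (-p.lam * t) / 2 + Real.exp (-p.lam * t) *
    (X t).K ξ ^ 2 - hamil p t ((X t).K ξ) - lagP p t (X t) ξ)) * hc

/-- Along a classical solution, `y` is a primitive of `Q (1 - V)` and `K` is a primitive of `W Q`.

The defects `y(b) - y(a) - ∫ Q (1 - V)` and `K(b) - K(a) - ∫ W Q` over all intervals vanish
initially and satisfy a closed linear system up to the difference between the nonlocal terms formed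
with `y` and with the primitive of `Q (1 - V)`. That difference is controlled by the defects
themselves, in a norm that allows them to grow linearly with the length of the interval. -/
theorem ClassicalOn.isPrim (hlam : 0 < p.lam) (h₀ : Admissible X₀) (hX : ClassicalOn p X₀ T R X)
    {t : ℝ} (ht : t ∈ Icc 0 T) :
    IsPrim (charY p t (X t)) (fun ξ => (X t).Q ξ * (1 - (X t).V ξ)) ∧
      IsPrim (X t).K (fun ξ => (X t).W ξ * (X t).Q ξ) := by
  have hT : 0 ≤ T := ht.1.trans ht.2
  have hR : 0 ≤ R := (abs_nonneg _).trans (hX.bounded t ht 0).K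
  obtain ⟨C, hC, hdom⟩ := hX.exists_domAt hlam h₀
  obtain ⟨B, hB0, hB⟩ := h₀.exists_bound_domFun
  obtain ⟨q, hq, hq1, hqQ⟩ := hX.exists_lower_Q hlam h₀
  set F := C * B with hF
  have hF0 : 0 ≤ F := by positivity
  have hCB : ∀ ξ, C * domFun X₀ ξ ≤ F := fun ξ => mul_le_mul_of_nonneg_left (hB ξ) hC.le
  have hVW : ∀ s ∈ Icc 0 T, ∀ ξ, 0 ≤ (X s).V ξ ∧ (X s).V ξ ≤ 1 ∧ |(X s).W ξ| ≤ 1 / 2 :=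
    fun s hs ξ => V_mem_of_constraint (hX.constraint h₀ hs ξ)
  have hQR : ∀ s ∈ Icc 0 T, ∀ ξ, 0 ≤ (X s).Q ξ ∧ (X s).Q ξ ≤ R := fun s hs ξ =>
    ⟨hq.le.trans (hqQ s hs ξ), (le_abs_self _).trans (hX.bounded s hs ξ).Q⟩
  -- the two derivatives in question and their bounds
  set w : ℝ → ℝ → ℝ := fun s ξ => (X s).Q ξ * (1 - (X s).V ξ) with hw
  set v : ℝ → ℝ → ℝ := fun s ξ => (X s).W ξ * (X s).Q ξ with hv
  have hw0 : ∀ s ∈ Icc 0 T, ∀ ξ, 0 ≤ w s ξ := fun s hs ξ =>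
    mul_nonneg (hQR s hs ξ).1 (by linarith [(hVW s hs ξ).2.1])
  have hwR : ∀ s ∈ Icc 0 T, ∀ ξ, |w s ξ| ≤ R := fun s hs ξ => by
    rw [abs_of_nonneg (hw0 s hs ξ)]
    calc w s ξ ≤ (X s).Q ξ * 1 :=
          mul_le_mul_of_nonneg_left (by linarith [(hVW s hs ξ).1]) (hQR s hs ξ).1
      _ ≤ R := by rw [mul_one]; exact (hQR s hs ξ).2
  have hvR : ∀ s ∈ Icc 0 T, ∀ ξ, |v s ξ| ≤ R := fun s hs ξ => by
    rw [hv, abs_mul, abs_of_nonneg (hQR s hs ξ).1]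
    calc _ ≤ 1 * (X s).Q ξ :=
          mul_le_mul_of_nonneg_right ((hVW s hs ξ).2.2.trans (by norm_num)) (hQR s hs ξ).1
      _ ≤ R := by rw [one_mul]; exact (hQR s hs ξ).2
  have hwm : ∀ s ∈ Icc 0 T, Measurable (w s) := fun s hs =>
    (hX.meas s hs).Q.mul (measurable_const.sub (hX.meas s hs).V)
  have hvm : ∀ s ∈ Icc 0 T, Measurable (v s) := fun s hs => (hX.meas s hs).W.mul (hX.meas s hs).Q
  have hloc : ∀ g : ℝ → ℝ, Measurable g → (∀ ξ, |g ξ| ≤ R) → LocallyIntegrable g volume :=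
    fun g hg hgR => (locallyIntegrable_const R).mono hg.aestronglyMeasurable
      (Eventually.of_forall fun x => by
        rw [Real.norm_eq_abs]; exact (hgR x).trans (le_abs_self R))
  have hwl : ∀ s ∈ Icc 0 T, LocallyIntegrable (w s) volume := fun s hs =>
    hloc _ (hwm s hs) (hwR s hs)
  have hvl : ∀ s ∈ Icc 0 T, LocallyIntegrable (v s) volume := fun s hs =>
    hloc _ (hvm s hs) (hvR s hs)
  have hsrc : ∀ s ∈ Icc 0 T, ∀ ξ, |source p s (X s) ξ| ≤ F := fun s hs ξ =>
    (hdom s hs ξ).source.trans (hCB ξ)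
  have hPF : ∀ s ∈ Icc 0 T, ∀ ξ, |lagP p s (X s) ξ| ≤ F := fun s hs ξ =>
    (hdom s hs ξ).P.trans (hCB ξ)
  -- the primitive of `Q (1 - V)` also moves at a positive speed on large scales
  set Y : ℝ → ℝ → ℝ := fun s ξ => ∫ x in (0 : ℝ)..ξ, w s x with hY
  have hYprim : ∀ s ∈ Icc 0 T, IsPrim (Y s) (w s) := fun s hs =>
    IsPrim.of_locallyIntegrable (hwl s hs) 0
  set J := ∫ ξ, 2 * C ^ 2 * domFun X₀ ξ ^ 2 with hJ
  have hVJ : ∀ s ∈ Icc 0 T, ∀ ξ, (X s).V ξ ≤ 2 * C ^ 2 * domFun X₀ ξ ^ 2 := by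
    intro s hs ξ
    have h1 := hX.constraint h₀ hs ξ
    have h2 : (X s).V ξ ^ 2 ≤ (C * domFun X₀ ξ) ^ 2 :=
      sq_le_sq' (by linarith [(abs_le.1 (hdom s hs ξ).V).1]) (abs_le.1 (hdom s hs ξ).V).2
    have h3 : (X s).W ξ ^ 2 ≤ (C * domFun X₀ ξ) ^ 2 :=
      sq_le_sq' (by linarith [(abs_le.1 (hdom s hs ξ).W).1]) (abs_le.1 (hdom s hs ξ).W).2
    nlinarith
  have hYlow : ∀ s ∈ Icc 0 T, ∀ ξ η, q * |ξ - η| - J ≤ |Y s ξ - Y s η| := by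
    intro s hs
    have hVi : Integrable (X s).V volume := by
      refine (h₀.integrable_domFun_sq.const_mul (2 * C ^ 2)).mono'
        (hX.meas s hs).V.aestronglyMeasurable (Eventually.of_forall fun ξ => ?_)
      rw [Real.norm_of_nonneg (hVW s hs ξ).1]
      exact hVJ s hs ξ
    have hVJ' : ∫ ξ, (X s).V ξ ≤ J :=
      integral_mono hVi (h₀.integrable_domFun_sq.const_mul (2 * C ^ 2)) (hVJ s hs)
    have hV0 : 0 ≤ ∫ ξ, (X s).V ξ := integral_nonneg fun ξ => (hVW s hs ξ).1
    have key : ∀ ξ η, η ≤ ξ → q * |ξ - η| - J ≤ |Y s ξ - Y s η| := by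
      intro ξ η h
      rw [← (hYprim s hs).integral_eq, abs_of_nonneg (sub_nonneg.2 h)]
      refine le_trans ?_ (le_abs_self _)
      have h1 : ∫ x in η..ξ, q * (1 - (X s).V x) ≤ ∫ x in η..ξ, w s x :=
        intervalIntegral.integral_mono h
          ((intervalIntegrable_const.sub hVi.intervalIntegrable).const_mul q)
          ((hYprim s hs).intervalIntegrable _ _)
          fun x => mul_le_mul_of_nonneg_right (hqQ s hs x) (by linarith [(hVW s hs x).2.1])
      rw [intervalIntegral.integral_const_mul, intervalIntegral.integral_sub
        intervalIntegrable_const hVi.intervalIntegrable] at h1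
      have h2 : ∫ x in η..ξ, (X s).V x ≤ ∫ x, (X s).V x := by
        rw [intervalIntegral.integral_of_le h]
        exact setIntegral_le_integral hVi (Eventually.of_forall fun x => (hVW s hs x).1)
      simp only [intervalIntegral.integral_const, smul_eq_mul, mul_one] at h1
      have h3 : q * ∫ x in η..ξ, (X s).V x ≤ J := by
        have : q * ∫ x in η..ξ, (X s).V x ≤ q * ∫ x, (X s).V x := by gcongr
        nlinarith
      linarith
    intro ξ η
    rcases le_total η ξ with h | h
    · exact key ξ η h
    · have := key η ξ h
      rwa [abs_sub_comm η ξ, abs_sub_comm (Y s η)] at this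
  -- common decay of the two exponential kernels
  set D := max (kernelConst X₀ R) (Real.exp J) with hD
  have hD0 : 0 < D := (Real.exp_pos J).trans_le (le_max_right _ _)
  have hkY : ∀ s ∈ Icc 0 T, ∀ ξ η,
      Real.exp (-|Y s ξ - Y s η|) ≤ D * Real.exp (-(q * |ξ - η|)) := by
    intro s hs ξ η
    calc _ ≤ Real.exp (J + -(q * |ξ - η|)) :=
          Real.exp_le_exp.2 (by linarith [hYlow s hs ξ η])
      _ = Real.exp J * Real.exp (-(q * |ξ - η|)) := Real.exp_add _ _
      _ ≤ _ := mul_le_mul_of_nonneg_right (le_max_right _ _) (Real.exp_pos _).le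
  have hky : ∀ s ∈ Icc 0 T, ∀ ξ η, Real.exp (-|charY p s (X s) ξ - charY p s (X s) η|) ≤
      D * Real.exp (-(q * |ξ - η|)) := by
    intro s hs ξ η
    refine (h₀.exp_charY_le (hX.bounded s hs ξ).Z (hX.bounded s hs η).Z).trans ?_
    refine mul_le_mul (le_max_left _ _) (Real.exp_le_exp.2 ?_) (Real.exp_pos _).le hD0.le
    have := mul_le_mul_of_nonneg_right hq1 (abs_nonneg (ξ - η))
    linarith
  -- the defects
  set d : Fin 2 × ℝ × ℝ → ℝ → ℝ := fun i s =>
    (![charY p s (X s) i.2.2 - charY p s (X s) i.2.1 - ∫ x in i.2.1..i.2.2, w s x,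
      (X s).K i.2.2 - (X s).K i.2.1 - ∫ x in i.2.1..i.2.2, v s x] : Fin 2 → ℝ) i.1 with hd
  set g : ℝ → ℝ → ℝ := fun s x => source p s (X s) x - w s x * lagP p s (X s) x with hg
  set d' : Fin 2 × ℝ × ℝ → ℝ → ℝ := fun i s =>
    (![Real.exp (-p.lam * s) * d (1, i.2) s,
      -lagG p s (X s) i.2.2 - -lagG p s (X s) i.2.1 - ∫ x in i.2.1..i.2.2, g s x] :
        Fin 2 → ℝ) i.1 with hd'
  set E := 1 / 2 * (D * (F * (1 + 2 / q) * (2 / (q / 2)))) with hE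
  have hE0 : 0 ≤ E := by positivity
  have hgm : ∀ s ∈ Icc 0 T, Measurable (g s) := fun s hs =>
    ((hX.meas s hs).source s).sub ((hwm s hs).mul ((hX.meas s hs).lagP s))
  have hgF : ∀ s ∈ Icc 0 T, ∀ ξ, |g s ξ| ≤ F + R * F := fun s hs ξ => by
    refine (abs_sub _ _).trans (add_le_add (hsrc s hs ξ) ?_)
    rw [abs_mul]
    exact mul_le_mul (hwR s hs ξ) (hPF s hs ξ) (abs_nonneg _) hR
  have hparw := fun a b => intervalIntegral_param (fun s hs => (hwm s hs).aestronglyMeasurable)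
    (hwl 0 ⟨le_rfl, hT⟩) (fun ξ s hs => hX.deriv_QV ξ hs) (c := R)
    (fun s hs ξ => by
      rw [abs_mul]
      calc _ ≤ 1 * |v s ξ| := mul_le_mul_of_nonneg_right (exp_lam_le hlam hs.1) (abs_nonneg _)
        _ ≤ R := by rw [one_mul]; exact hvR s hs ξ)
    (fun s hs => ((hvm s hs).const_mul _).aestronglyMeasurable) a b
  have hparv := fun a b => intervalIntegral_param (fun s hs => (hvm s hs).aestronglyMeasurable)
    (hvl 0 ⟨le_rfl, hT⟩) (fun ξ s hs => hX.deriv_WQ h₀ ξ hs) (c := F + R * F)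
    (fun s hs ξ => hgF s hs ξ) (fun s hs => (hgm s hs).aestronglyMeasurable) a b
  have hchar : ∀ ξ, ∀ s ∈ Icc 0 T, HasDerivWithinAt (fun r => charY p r (X r) ξ)
      (Real.exp (-p.lam * s) * (X s).K ξ + p.Γ) (Icc 0 T) s := fun ξ s hs => by
    refine (((hX.deriv_Z ξ hs).add_const ξ).add
      ((hasDerivWithinAt_id s _).const_mul p.Γ)).congr_deriv ?_
    simp only [field, mul_one]
  have hzero : ∀ i, ∀ s ∈ Icc 0 T, d i s = 0 := by
    intro i s hs
    have := gronwall_family (T := T) (φ := d) (φ' := d') (w := fun i => 1 + |i.2.2 - i.2.1|)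
      (a := 0) (M := 2 * R + 2 + R) (L := (2 + R) * E + 1) (by positivity) le_rfl (by positivity)
      (fun i => by positivity) ?_ ?_ ?_ ?_ ?_ i hs
    · simpa using this
    · rintro ⟨j, a, b⟩
      fin_cases j
      · have h : ContinuousOn (fun r => charY p r (X r) b - charY p r (X r) a) (Icc 0 T) :=
          fun s hs => ((hchar b s hs).sub (hchar a s hs)).continuousWithinAt
        exact h.sub (hparw a b).1
      · have h : ContinuousOn (fun r => (X r).K b - (X r).K a) (Icc 0 T) :=
          fun s hs => ((hX.deriv_K b hs).sub (hX.deriv_K a hs)).continuousWithinAt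
        exact h.sub (hparv a b).1
    · rintro ⟨j, a, b⟩ s hs
      have hs' := Ioo_subset_Icc_self hs
      have hn := Icc_mem_nhds hs.1 hs.2
      fin_cases j
      · have h1 := (((hchar b s hs').sub (hchar a s hs')).hasDerivAt hn).fun_sub
          ((hparw a b).2 s hs)
        refine h1.congr_deriv ?_
        change _ = Real.exp (-p.lam * s) * ((X s).K b - (X s).K a - ∫ x in a..b, v s x)
        rw [intervalIntegral.integral_const_mul]
        ring
      · exact (((hX.deriv_K b hs').sub (hX.deriv_K a hs')).hasDerivAt hn).fun_sub
          ((hparv a b).2 s hs)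
    · rintro ⟨j, a, b⟩
      rw [zero_mul]
      refine (abs_nonpos_iff.2 ?_)
      fin_cases j
      · simp only [hd, hw, hX.initial, h₀.Q_eq, one_mul]
        have := h₀.isPrim_Y.integral_eq a b
        simp only [charY]
        simp only [Fin.zero_eta, Matrix.cons_val]
        linarith
      · simp only [hd, hv, hX.initial, h₀.Q_eq, mul_one]
        have := h₀.isPrim_K.integral_eq a b
        simp only [Fin.mk_one, Matrix.cons_val]
        linarith
    · rintro ⟨j, a, b⟩ s hs
      have hab := abs_nonneg (b - a)
      fin_cases j
      · have h1 : |∫ x in a..b, w s x| ≤ R * |b - a| :=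
          intervalIntegral.norm_integral_le_of_norm_le_const (f := w s) fun x _ => hwR s hs x
        have h2 : |(X₀.Z b + b) - (X₀.Z a + a)| ≤ 1 * |b - a| :=
          h₀.isPrim_Y.abs_sub_le (fun x => by
            have := V_mem_of_constraint (h₀.constraint x)
            rw [abs_le]; constructor <;> linarith) a b
        have h3 := (hX.bounded s hs b).Z
        have h4 := (hX.bounded s hs a).Z
        have e : d (0, a, b) s = ((X s).Z b - X₀.Z b) - ((X s).Z a - X₀.Z a) +
            ((X₀.Z b + b) - (X₀.Z a + a)) - ∫ x in a..b, w s x := by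
          simp only [hd, charY, Matrix.cons_val]; ring
        change |d (0, a, b) s| ≤ (2 * R + 2 + R) * (1 + |b - a|)
        rw [e]
        refine (abs_sub _ _).trans ((add_le_add ((abs_add_le _ _).trans (add_le_add
          ((abs_sub _ _).trans (add_le_add h3 h4)) h2)) h1).trans ?_)
        nlinarith
      · have h1 : |∫ x in a..b, v s x| ≤ R * |b - a| :=
          intervalIntegral.norm_integral_le_of_norm_le_const (f := v s) fun x _ => hvR s hs x
        have h3 := (hX.bounded s hs b).K
        have h4 := (hX.bounded s hs a).K
        change |(X s).K b - (X s).K a - ∫ x in a..b, v s x| ≤ (2 * R + 2 + R) * (1 + |b - a|)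
        refine (abs_sub _ _).trans ((add_le_add ((abs_sub _ _).trans (add_le_add h3 h4)) h1).trans
          ?_)
        nlinarith
    · intro s hs ρ hρ hsρ
      have hs' := Ioo_subset_Icc_self hs
      -- the nonlocal terms formed with `y` and with the primitive of `Q (1 - V)`
      have hcmp : ∀ ξ, ∀ σ : ℝ → ℝ, (∀ η, |σ η| ≤ 1) → Measurable σ →
          1 / 2 * |nonlocal σ (charY p s (X s)) (source p s (X s)) ξ -
            nonlocal σ (Y s) (source p s (X s)) ξ| ≤ E * ρ := by
        intro ξ σ hσ hσm
        have hbd : ∀ η, Real.exp (-(q * |ξ - η|)) * (ρ * (1 + |ξ - η|) * F + 0) ≤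
            ρ * F * (1 + 2 / q) * Real.exp (-(q / 2 * |ξ - η|)) := fun η => by
          have := one_add_mul_exp_neg_le hq (abs_nonneg (ξ - η))
          have h1 : 0 ≤ ρ * F := by positivity
          nlinarith
        have hi := (integrable_kernel (half_pos hq) ξ).const_mul (ρ * F * (1 + 2 / q))
        have hi' : Integrable fun η =>
            Real.exp (-(q * |ξ - η|)) * (ρ * (1 + |ξ - η|) * F + 0) := by
          refine hi.mono' (by fun_prop : Continuous fun η =>
            Real.exp (-(q * |ξ - η|)) * (ρ * (1 + |ξ - η|) * F + 0)).aestronglyMeasurable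
            (Eventually.of_forall fun η => ?_)
          rw [Real.norm_of_nonneg (by positivity)]
          exact hbd η
        have h1 := abs_nonlocal_sub_le (ξ := ξ) (s := σ) (D := D) (F := F) (F' := 0)
          (y := charY p s (X s)) (y' := Y s) (f := source p s (X s)) (f' := source p s (X s))
          (d := fun η => ρ * (1 + |ξ - η|)) hq hσ hσm
          (Eventually.of_forall (hky s hs' ξ)) (Eventually.of_forall (hkY s hs' ξ))
          ((hX.meas s hs').charY s).aestronglyMeasurable
          (hYprim s hs').continuous.aestronglyMeasurable
          (Eventually.of_forall (hsrc s hs')) (Eventually.of_forall (hsrc s hs'))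
          ((hX.meas s hs').source s).aestronglyMeasurable
          ((hX.meas s hs').source s).aestronglyMeasurable (Eventually.of_forall (by simp))
          (Eventually.of_forall fun η => ?_) hi'
        · have h2 := integral_mono hi' hi hbd
          rw [integral_const_mul, integral_kernel (half_pos hq)] at h2
          have h3 := mul_le_mul_of_nonneg_left h2 hD0.le
          rw [hE]
          linarith
        · have := hsρ (0, η, ξ)
          change |charY p s (X s) ξ - charY p s (X s) η - ∫ x in η..ξ, w s x| ≤
            ρ * (1 + |ξ - η|) at this
          rwa [(hYprim s hs').integral_eq] at this
      obtain ⟨hp1, hp2⟩ := isPrim_nonlocal hq (hYprim s hs') (hw0 s hs') (hkY s hs') (hsrc s hs')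
        ((hX.meas s hs').source s).aestronglyMeasurable
      set N₁ : ℝ → ℝ := fun ξ => nonlocal (fun _ => 1) (Y s) (source p s (X s)) ξ with hN₁
      set N₂ : ℝ → ℝ := fun ξ => nonlocal (fun η => Real.sign (ξ - η)) (Y s) (source p s (X s)) ξ
        with hN₂
      have hP : ∀ ξ, |1 / 2 * N₁ ξ - lagP p s (X s) ξ| ≤ E * ρ := fun ξ => by
        rw [lagP_eq_nonlocal, ← mul_sub, abs_mul, abs_of_pos (by norm_num : (0 : ℝ) < 1 / 2),
          abs_sub_comm]
        exact hcmp ξ _ (by simp) measurable_const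
      have hG : ∀ ξ, |-(1 / 2) * N₂ ξ - lagG p s (X s) ξ| ≤ E * ρ := fun ξ => by
        rw [lagG_eq_nonlocal, ← mul_sub, abs_mul, abs_neg,
          abs_of_pos (by norm_num : (0 : ℝ) < 1 / 2), abs_sub_comm]
        exact hcmp ξ _ (fun _ => abs_sign_le _)
          (measurable_sign.comp (measurable_const.sub measurable_id))
      rintro ⟨j, a, b⟩
      have hab := abs_nonneg (b - a)
      have hEρ : 0 ≤ E * ρ := by positivity
      fin_cases j
      · change |Real.exp (-p.lam * s) * d (1, a, b) s| ≤ ((2 + R) * E + 1) * ρ * (1 + |b - a|)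
        have h1 : |d (1, a, b) s| ≤ ρ * (1 + |b - a|) := hsρ (1, a, b)
        rw [abs_mul]
        have h2 : |Real.exp (-p.lam * s)| * |d (1, a, b) s| ≤ 1 * (ρ * (1 + |b - a|)) :=
          mul_le_mul (exp_lam_le hlam hs.1.le) h1 (abs_nonneg _) zero_le_one
        have h3 : 0 ≤ (2 + R) * E * (ρ * (1 + |b - a|)) := by positivity
        linarith
      · change |-lagG p s (X s) b - -lagG p s (X s) a - ∫ x in a..b, g s x| ≤
          ((2 + R) * E + 1) * ρ * (1 + |b - a|)
        have h1 := hp2.integral_eq a b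
        have hdiff : ∀ x, |w s x * (1 / 2 * N₁ x - lagP p s (X s) x)| ≤ R * (E * ρ) := fun x => by
          rw [abs_mul]
          exact mul_le_mul (hwR s hs' x) (hP x) (abs_nonneg _) hR
        have h2 : |∫ x in a..b, w s x * (1 / 2 * N₁ x - lagP p s (X s) x)| ≤
            R * (E * ρ) * |b - a| :=
          intervalIntegral.norm_integral_le_of_norm_le_const
            (f := fun x => w s x * (1 / 2 * N₁ x - lagP p s (X s) x)) fun x _ => hdiff x
        have hgi : IntervalIntegrable (g s) volume a b := by
          have : LocallyIntegrable (g s) volume :=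
            (locallyIntegrable_const (F + R * F)).mono (hgm s hs').aestronglyMeasurable
              (Eventually.of_forall fun x => by
                rw [Real.norm_eq_abs]; exact (hgF s hs' x).trans (le_abs_self _))
          exact (this.integrableOn_isCompact isCompact_uIcc).intervalIntegrable
        have h3 : ∫ x in a..b, w s x * (1 / 2 * N₁ x - lagP p s (X s) x) =
            (∫ x in a..b, g s x) - 1 / 2 * (N₂ b - N₂ a) := by
          rw [← h1, ← intervalIntegral.integral_const_mul,
            ← intervalIntegral.integral_sub hgi ((hp2.intervalIntegrable a b).const_mul _)]
          refine intervalIntegral.integral_congr fun x _ => ?_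
          simp only [hg]
          ring
        have e : -lagG p s (X s) b - -lagG p s (X s) a - ∫ x in a..b, g s x =
            (-(1 / 2) * N₂ b - lagG p s (X s) b) - (-(1 / 2) * N₂ a - lagG p s (X s) a) -
              ∫ x in a..b, w s x * (1 / 2 * N₁ x - lagP p s (X s) x) := by
          rw [h3]; ring
        rw [e]
        refine (abs_sub _ _).trans ((add_le_add ((abs_sub _ _).trans (add_le_add (hG b) (hG a)))
          h2).trans ?_)
        have h4 : 0 ≤ ρ * (1 + |b - a|) := by positivity
        have h5 : 0 ≤ E * ρ * |b - a| := by positivity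
        nlinarith
  refine ⟨⟨hwl t ht, fun a b => ?_⟩, ⟨hvl t ht, fun a b => ?_⟩⟩
  · exact (sub_eq_zero.1 (hzero (0, a, b) t ht)).symm
  · exact (sub_eq_zero.1 (hzero (1, a, b) t ht)).symm

end

/-! ### Conservation of the energy -/

section

variable {p : Params} {X₀ : State} {T R : ℝ} {X : ℝ → State}

/-- Bounds on `Q` and on `y_ξ = Q (1 - V)`. -/
theorem ClassicalOn.weight_mem (hlam : 0 < p.lam) (h₀ : Admissible X₀)
    (hX : ClassicalOn p X₀ T R X) {t : ℝ} (ht : t ∈ Icc 0 T) (ξ : ℝ) :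
    0 ≤ (X t).Q ξ ∧ (X t).Q ξ ≤ R ∧ 0 ≤ (X t).Q ξ * (1 - (X t).V ξ) ∧
      (X t).Q ξ * (1 - (X t).V ξ) ≤ R := by
  obtain ⟨q, hq, -, hqQ⟩ := hX.exists_lower_Q hlam h₀
  have hV := V_mem_of_constraint (hX.constraint h₀ ht ξ)
  have hQ : 0 ≤ (X t).Q ξ := hq.le.trans (hqQ t ht ξ)
  have hR : (X t).Q ξ ≤ R := (le_abs_self _).trans (hX.bounded t ht ξ).Q
  refine ⟨hQ, hR, mul_nonneg hQ (by linarith [hV.2.1]), ?_⟩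
  nlinarith [hV.1]

theorem ClassicalOn.exp_charY_le (h₀ : Admissible X₀) (hX : ClassicalOn p X₀ T R X) {t : ℝ}
    (ht : t ∈ Icc 0 T) (ξ η : ℝ) : Real.exp (-|charY p t (X t) ξ - charY p t (X t) η|) ≤
      kernelConst X₀ R * Real.exp (-(1 * |ξ - η|)) :=
  h₀.exp_charY_le (hX.bounded t ht ξ).Z (hX.bounded t ht η).Z

/-- `P_ξ = y_ξ G` and `G_ξ = y_ξ P - f`. -/
theorem ClassicalOn.isPrim_lagP_lagG (hlam : 0 < p.lam) (h₀ : Admissible X₀)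
    (hX : ClassicalOn p X₀ T R X) {t : ℝ} (ht : t ∈ Icc 0 T) :
    IsPrim (lagP p t (X t)) (fun ξ => (X t).Q ξ * (1 - (X t).V ξ) * lagG p t (X t) ξ) ∧
      IsPrim (lagG p t (X t))
        (fun ξ => (X t).Q ξ * (1 - (X t).V ξ) * lagP p t (X t) ξ - source p t (X t) ξ) := by
  obtain ⟨C, hC, hdom⟩ := hX.exists_domAt hlam h₀
  obtain ⟨B, hB0, hB⟩ := h₀.exists_bound_domFun
  obtain ⟨h1, h2⟩ := isPrim_nonlocal one_pos (hX.isPrim hlam h₀ ht).1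
    (fun ξ => (hX.weight_mem hlam h₀ ht ξ).2.2.1) (hX.exp_charY_le h₀ ht)
    (fun ξ => (hdom t ht ξ).source.trans (mul_le_mul_of_nonneg_left (hB ξ) hC.le))
    ((hX.meas t ht).source t).aestronglyMeasurable
  constructor
  · rw [show lagP p t (X t) = _ from funext fun ξ => lagP_eq_nonlocal p t (X t) ξ]
    refine (h1.const_mul (1 / 2)).congr_deriv (Eventually.of_forall fun ξ => ?_)
    simp only [lagG_eq_nonlocal]
    ring
  · rw [show lagG p t (X t) = _ from funext fun ξ => lagG_eq_nonlocal p t (X t) ξ]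
    refine (h2.const_mul (-(1 / 2))).congr_deriv (Eventually.of_forall fun ξ => ?_)
    simp only [lagP_eq_nonlocal]
    ring

/-- The time derivative of the energy density. -/
def energyRate (p : Params) (t : ℝ) (X : State) (ξ : ℝ) : ℝ :=
  -2 * X.K ξ * lagG p t X ξ * (X.Q ξ * (1 - X.V ξ))
    + (3 * Real.exp (-p.lam * t) * X.K ξ ^ 2 - 2 * hamil p t (X.K ξ) - 2 * lagP p t X ξ)
      * (X.W ξ * X.Q ξ)

/-- The flux of the energy, a primitive of `energyRate` in the Lagrangian variable. -/
def energyFlux (p : Params) (t : ℝ) (X : State) (ξ : ℝ) : ℝ :=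
  -2 * (lagP p t X ξ * X.K ξ) + X.K ξ ^ 2 * (Real.exp (-p.lam * t) * X.K ξ - (p.α + p.Γ)
    - p.β * Real.exp (-2 * p.lam * t) / 6 * X.K ξ ^ 2
    - p.γ * Real.exp (-3 * p.lam * t) / 10 * X.K ξ ^ 3)

theorem ClassicalOn.deriv_energyDensity (hX : ClassicalOn p X₀ T R X) (ξ : ℝ) {t : ℝ}
    (ht : t ∈ Icc 0 T) :
    HasDerivWithinAt (fun s => energyDensity (X s) ξ) (energyRate p t (X t) ξ) (Icc 0 T) t := by
  have h1 := ((hX.deriv_K ξ ht).fun_pow 2).fun_mul (hX.deriv_QV ξ ht)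
  have h2 := (hX.deriv_Q ξ ht).fun_mul (hX.deriv_V ξ ht)
  refine ((h1.fun_add h2).congr_of_mem (fun s _ => ?_) ht).congr_deriv ?_
  · simp only [energyDensity]; ring
  · simp only [field, factorVW, energyRate, Nat.cast_ofNat, Nat.add_one_sub_one, pow_one]
    ring

theorem ClassicalOn.isPrim_energyFlux (hlam : 0 < p.lam) (h₀ : Admissible X₀)
    (hX : ClassicalOn p X₀ T R X) {t : ℝ} (ht : t ∈ Icc 0 T) :
    IsPrim (energyFlux p t (X t)) (energyRate p t (X t)) := by
  obtain ⟨-, hK⟩ := hX.isPrim hlam h₀ ht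
  obtain ⟨hP, -⟩ := hX.isPrim_lagP_lagG hlam h₀ ht
  set e := Real.exp (-p.lam * t) with he
  set e2 := Real.exp (-2 * p.lam * t) with he2
  set e3 := Real.exp (-3 * p.lam * t) with he3
  have h1 := hK.comp (φ := fun x => x ^ 2 * (e * x - (p.α + p.Γ) - p.β * e2 / 6 * x ^ 2
      - p.γ * e3 / 10 * x ^ 3))
    (φ' := fun x => 3 * e * x ^ 2 - 2 * ((p.α + p.Γ) * x + p.β * e2 / 3 * x ^ 3
      + p.γ * e3 / 4 * x ^ 4)) (fun x => by
      have h : ∀ n : ℕ, HasDerivAt (fun x : ℝ => x ^ n) (n * x ^ (n - 1)) x := fun n =>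
        hasDerivAt_pow n x
      refine (((((h 3).const_mul e).sub ((h 2).const_mul (p.α + p.Γ))).sub
        ((h 4).const_mul (p.β * e2 / 6))).sub ((h 5).const_mul (p.γ * e3 / 10))).congr_deriv ?_
        |>.congr_of_eventuallyEq (Eventually.of_forall fun x => ?_)
      · push_cast; ring
      · simp only [Pi.sub_apply]; ring) (by fun_prop)
  refine (((hP.mul hK).const_mul (-2)).add h1).congr_deriv (Eventually.of_forall fun ξ => ?_)
  simp only [energyRate, hamil]
  ring

/-- The energy is conserved: its density changes by the divergence of an integrable flux. -/
theorem ClassicalOn.integral_energyDensity (hlam : 0 < p.lam) (h₀ : Admissible X₀)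
    (hX : ClassicalOn p X₀ T R X) {t : ℝ} (ht : t ∈ Icc 0 T) :
    Integrable (energyDensity (X t)) volume ∧
      ∫ ξ, energyDensity (X t) ξ = ∫ ξ, energyDensity X₀ ξ := by
  have hT : 0 ≤ T := ht.1.trans ht.2
  have hR : 0 ≤ R := (abs_nonneg _).trans (hX.bounded t ht 0).K
  obtain ⟨C, hC, hdom⟩ := hX.exists_domAt hlam h₀
  have hb0 := coeffBound_nonneg p
  set b := coeffBound p * (1 + R ^ 2 + R ^ 3) with hb
  have hb' : 0 ≤ b := by positivity
  set c := (4 * R + 3 * R ^ 2 + 2 * b * R) * C ^ 2 with hc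
  have hdensm : ∀ s ∈ Icc 0 T, Measurable (energyDensity (X s)) := fun s hs => by
    have h := hX.meas s hs
    exact (((h.K.pow_const 2).mul h.Q).mul (measurable_const.sub h.V)).add (h.Q.mul h.V)
  have hdens0 : Integrable (energyDensity X₀) volume := by
    have hm : Measurable (energyDensity X₀) := by
      have := hdensm 0 ⟨le_rfl, hT⟩
      rwa [hX.initial] at this
    refine h₀.integrable_domBase.mono' hm.aestronglyMeasurable (Eventually.of_forall fun ξ => ?_)
    have hV := V_mem_of_constraint (h₀.constraint ξ)
    have hV1 : 0 ≤ 1 - X₀.V ξ := by linarith [hV.2.1]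
    rw [energyDensity, domBase, h₀.Q_eq, Real.norm_of_nonneg (by nlinarith [sq_nonneg (X₀.K ξ)])]
    nlinarith [mul_nonneg (sq_nonneg (X₀.K ξ)) hV.1]
  have hratem : ∀ s ∈ Icc 0 T, AEStronglyMeasurable (energyRate p s (X s)) volume := fun s hs =>
    (hX.isPrim_energyFlux hlam h₀ hs).locallyIntegrable.aestronglyMeasurable
  have hrate : ∀ s ∈ Icc 0 T, ∀ ξ, |energyRate p s (X s) ξ| ≤ c * domFun X₀ ξ ^ 2 := by
    intro s hs ξ
    have hd := hdom s hs ξ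
    have hw := hX.weight_mem hlam h₀ hs ξ
    have hKR := (hX.bounded s hs ξ).K
    have hH := abs_hamil_le hlam hs.1 ((X s).K ξ)
    have he := exp_lam_le hlam hs.1
    have hm := domFun_nonneg X₀ ξ
    set u := C * domFun X₀ ξ with hu
    have hu0 : 0 ≤ u := by positivity
    have hH' : |hamil p s ((X s).K ξ)| ≤ b * u := by
      refine hH.trans ?_
      have h1 : |(X s).K ξ| + |(X s).K ξ| ^ 3 + |(X s).K ξ| ^ 4 =
          (1 + |(X s).K ξ| ^ 2 + |(X s).K ξ| ^ 3) * |(X s).K ξ| := by ring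
      rw [h1, hb, mul_assoc]
      have := hd.K
      gcongr
    have hG := hd.G
    have hWQ : |(X s).W ξ * (X s).Q ξ| ≤ u * R := by
      rw [abs_mul, abs_of_nonneg hw.1]
      exact mul_le_mul hd.W hw.2.1 hw.1 hu0
    have h1 : |-2 * (X s).K ξ * lagG p s (X s) ξ * ((X s).Q ξ * (1 - (X s).V ξ))| ≤
        2 * u * u * R := by
      rw [abs_mul, abs_mul, abs_mul, abs_neg, abs_two, abs_of_nonneg hw.2.2.1]
      have h2 := hd.K
      exact mul_le_mul (mul_le_mul (by linarith) hG (abs_nonneg _) (by positivity)) hw.2.2.2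
        hw.2.2.1 (by positivity)
    have h2 : |3 * Real.exp (-p.lam * s) * (X s).K ξ ^ 2 - 2 * hamil p s ((X s).K ξ)
        - 2 * lagP p s (X s) ξ| ≤ 3 * (R * u) + 2 * (b * u) + 2 * u := by
      refine (abs_sub _ _).trans (add_le_add ((abs_sub _ _).trans (add_le_add ?_ ?_)) ?_)
      · rw [mul_assoc, abs_mul, abs_mul, abs_pow, sq, abs_of_pos (by norm_num : (0 : ℝ) < 3)]
        have h3 : |(X s).K ξ| * |(X s).K ξ| ≤ R * u :=
          mul_le_mul hKR hd.K (abs_nonneg _) hR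
        have h4 := mul_le_mul he h3 (by positivity) zero_le_one
        linarith
      · rw [abs_mul, abs_two]; linarith
      · rw [abs_mul, abs_two]; linarith [hd.P]
    refine (abs_add_le _ _).trans ((add_le_add h1 ((abs_mul _ _).trans_le (mul_le_mul h2 hWQ
      (abs_nonneg _) (by positivity)))).trans (le_of_eq ?_))
    rw [hc, hu]
    ring
  obtain ⟨h1, h2, h3⟩ := integral_param (μ := volume) (b := fun ξ => c * domFun X₀ ξ ^ 2)
    (fun s hs => (hdensm s hs).aestronglyMeasurable) (by rw [hX.initial]; exact hdens0)
    (fun ξ s hs => hX.deriv_energyDensity ξ hs) hrate (h₀.integrable_domFun_sq.const_mul c) hratem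
  have hKm : ∀ s ∈ Icc 0 T, Measurable (X s).K := fun s hs => (hX.meas s hs).K
  have hzero : ∀ s ∈ Icc 0 T, ∫ ξ, energyRate p s (X s) ξ = 0 := by
    intro s hs
    refine (hX.isPrim_energyFlux hlam h₀ hs).integral_eq_zero
      ((h₀.integrable_domFun_sq.const_mul c).mono' (hratem s hs)
        (Eventually.of_forall (hrate s hs))) ?_
    have hPK : Integrable (fun ξ => lagP p s (X s) ξ * (X s).K ξ) := by
      refine (h₀.integrable_domFun_sq.const_mul (C ^ 2)).mono'
        (((hX.meas s hs).lagP s).mul (hKm s hs)).aestronglyMeasurable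
        (Eventually.of_forall fun ξ => ?_)
      have hd := hdom s hs ξ
      rw [Real.norm_eq_abs, abs_mul]
      refine (mul_le_mul hd.P hd.K (abs_nonneg _) ((abs_nonneg _).trans hd.P)).trans_eq (by ring)
    have hKK : Integrable (fun ξ => (X s).K ξ ^ 2) := by
      refine (h₀.integrable_domFun_sq.const_mul (C ^ 2)).mono'
        ((hKm s hs).pow_const 2).aestronglyMeasurable (Eventually.of_forall fun ξ => ?_)
      rw [Real.norm_eq_abs, abs_pow, ← mul_pow]
      exact pow_le_pow_left₀ (abs_nonneg _) (hdom s hs ξ).K 2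
    have hcont : Continuous fun x : ℝ => Real.exp (-p.lam * s) * x - (p.α + p.Γ)
        - p.β * Real.exp (-2 * p.lam * s) / 6 * x ^ 2
        - p.γ * Real.exp (-3 * p.lam * s) / 10 * x ^ 3 := by fun_prop
    obtain ⟨M, hM⟩ := (isCompact_Icc (a := -R) (b := R)).exists_bound_of_continuousOn
      hcont.continuousOn
    refine (hPK.const_mul (-2)).add (hKK.mul_bdd (c := M)
      (hcont.measurable.comp (hKm s hs)).aestronglyMeasurable (Eventually.of_forall fun ξ => ?_))
    exact hM _ (abs_le.1 (hX.bounded s hs ξ).K)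
  refine ⟨h1 t ht, ?_⟩
  have h4 := abs_le_add_of_deriv_le (T := T)
    (φ := fun s => (∫ ξ, energyDensity (X s) ξ) - ∫ ξ, energyDensity X₀ ξ)
    (φ' := fun _ => 0) (B := fun _ => 0) (B' := fun _ => 0) (h2.sub continuousOn_const)
    (fun s hs => ((h3 s hs).sub_const _).congr_deriv (hzero s (Ioo_subset_Icc_self hs)))
    (fun s => hasDerivAt_const s 0) (fun s _ => by simp) ht
  simp only [hX.initial, sub_self, abs_zero, add_zero] at h4
  exact sub_eq_zero.1 (abs_nonpos_iff.1 h4)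

/-! ### A priori bounds in terms of the energy -/

theorem energyDensity_nonneg_of {X : State} {ξ : ℝ} (hc : X.W ξ ^ 2 + X.V ξ ^ 2 = X.V ξ)
    (hQ : 0 ≤ X.Q ξ) : 0 ≤ energyDensity X ξ := by
  have hV := V_mem_of_constraint hc
  have hV1 : 0 ≤ 1 - X.V ξ := by linarith [hV.2.1]
  have := hV.1
  unfold energyDensity
  positivity

theorem ClassicalOn.energyDensity_nonneg (hlam : 0 < p.lam) (h₀ : Admissible X₀)
    (hX : ClassicalOn p X₀ T R X) {t : ℝ} (ht : t ∈ Icc 0 T) (ξ : ℝ) :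
    0 ≤ energyDensity (X t) ξ :=
  energyDensity_nonneg_of (hX.constraint h₀ ht ξ) (hX.weight_mem hlam h₀ ht ξ).1

theorem Admissible.integral_energyDensity_nonneg (h₀ : Admissible X₀) :
    0 ≤ ∫ ξ, energyDensity X₀ ξ :=
  integral_nonneg fun ξ => energyDensity_nonneg_of (h₀.constraint ξ) (by simp [h₀.Q_eq])

/-- The pointwise bound `K² ≤ E`. It rests on `|(K²)_ξ| = 2 |K W| Q ≤ (K² (1 - V) + V) Q`, a
consequence of `W² = V (1 - V)`. -/
theorem ClassicalOn.abs_K_le (hlam : 0 < p.lam) (h₀ : Admissible X₀)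
    (hX : ClassicalOn p X₀ T R X) {t : ℝ} (ht : t ∈ Icc 0 T) (ξ : ℝ) :
    |(X t).K ξ| ≤ Real.sqrt (∫ ξ, energyDensity X₀ ξ) := by
  obtain ⟨hint, hE⟩ := hX.integral_energyDensity hlam h₀ ht
  obtain ⟨C, hC, hdom⟩ := hX.exists_domAt hlam h₀
  have hprim := (hX.isPrim hlam h₀ ht).2.pow 2
  simp only [Nat.cast_ofNat, Nat.add_one_sub_one, pow_one] at hprim
  have hle : ∀ x, |2 * (X t).K x * ((X t).W x * (X t).Q x)| ≤ energyDensity (X t) x := by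
    intro x
    have hc := hX.constraint h₀ ht x
    have hV := V_mem_of_constraint hc
    have hV1 : 0 ≤ 1 - (X t).V x := by linarith [hV.2.1]
    have hQ := (hX.weight_mem hlam h₀ ht x).1
    have hV0 := hV.1
    have h1 : |2 * (X t).K x * (X t).W x| ≤ (X t).K x ^ 2 * (1 - (X t).V x) + (X t).V x := by
      refine abs_le_of_sq_le_sq ?_ (by positivity)
      have e : (2 * (X t).K x * (X t).W x) ^ 2 =
          4 * (X t).K x ^ 2 * ((X t).V x * (1 - (X t).V x)) := by
        linear_combination 4 * (X t).K x ^ 2 * hc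
      rw [e]
      nlinarith [sq_nonneg ((X t).K x ^ 2 * (1 - (X t).V x) - (X t).V x)]
    calc _ = |2 * (X t).K x * (X t).W x| * (X t).Q x := by
          rw [← mul_assoc, abs_mul _ ((X t).Q x), abs_of_nonneg hQ]
      _ ≤ ((X t).K x ^ 2 * (1 - (X t).V x) + (X t).V x) * (X t).Q x :=
          mul_le_mul_of_nonneg_right h1 hQ
      _ = _ := by unfold energyDensity; ring
  have hdi : Integrable (fun x => 2 * (X t).K x * ((X t).W x * (X t).Q x)) :=
    hint.mono' hprim.locallyIntegrable.aestronglyMeasurable (Eventually.of_forall hle)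
  have hKi : Integrable (fun x => (X t).K x ^ 2) := by
    refine (h₀.integrable_domFun_sq.const_mul (C ^ 2)).mono'
      ((hX.meas t ht).K.pow_const 2).aestronglyMeasurable (Eventually.of_forall fun x => ?_)
    rw [Real.norm_eq_abs, abs_pow, ← mul_pow]
    exact pow_le_pow_left₀ (abs_nonneg _) (hdom t ht x).K 2
  have hlim := (hprim.tendsto_atBot hdi hKi).const_add (∫ ξ, energyDensity X₀ ξ)
  rw [add_zero] at hlim
  refine Real.abs_le_sqrt (ge_of_tendsto hlim ?_)
  filter_upwards [eventually_le_atBot ξ] with a ha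
  have h1 := hprim.integral_eq a ξ
  have h2 : ∫ x in a..ξ, 2 * (X t).K x * ((X t).W x * (X t).Q x) ≤
      ∫ x, energyDensity (X t) x := by
    rw [intervalIntegral.integral_of_le ha]
    exact (setIntegral_mono hdi.integrableOn hint.integrableOn
      fun x => (le_abs_self _).trans (hle x)).trans
      (setIntegral_le_integral hint
        (Eventually.of_forall (hX.energyDensity_nonneg hlam h₀ ht)))
  linarith

/-- The exponential kernel has mass at most `2` with respect to the change of variables `y`. -/
theorem IsPrim.integral_exp_neg_abs_sub_le {y w : ℝ → ℝ} (hy : IsPrim y w) (hw : ∀ x, 0 ≤ w x)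
    {ξ : ℝ} (hi : Integrable fun η => Real.exp (-|y ξ - y η|) * w η) :
    ∫ η, Real.exp (-|y ξ - y η|) * w η ≤ 2 := by
  have hcont : Continuous fun s : ℝ => Real.exp (-|y ξ - s|) := by fun_prop
  have hk : Integrable fun s : ℝ => Real.exp (-|y ξ - s|) := by
    simpa using integrable_kernel one_pos (y ξ)
  have hk2 : ∫ s : ℝ, Real.exp (-|y ξ - s|) = 2 := by simpa using integral_kernel one_pos (y ξ)
  have hprim := hy.comp (fun s => (hcont.integral_hasStrictDerivAt 0 s).hasDerivAt) hcont
  refine le_of_tendsto (intervalIntegral_tendsto_integral hi tendsto_neg_atTop_atBot tendsto_id) ?_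
  filter_upwards [eventually_ge_atTop 0] with b hb
  have hmono := hy.monotone hw (show -b ≤ b by linarith)
  rw [_root_.id, hprim.integral_eq, intervalIntegral.integral_interval_sub_left
    (hcont.intervalIntegrable _ _) (hcont.intervalIntegrable _ _),
    intervalIntegral.integral_of_le hmono, ← hk2]
  exact setIntegral_le_integral hk (Eventually.of_forall fun s => (Real.exp_pos _).le)

/-- A polynomial bound on the nonlocal terms by the energy. The part of the source that is not
controlled by the energy density is linear in `K` and is integrated against `y_ξ`. -/
theorem ClassicalOn.abs_nonlocal_le_sqrt (hlam : 0 < p.lam) (h₀ : Admissible X₀)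
    (hX : ClassicalOn p X₀ T R X) {t : ℝ} (ht : t ∈ Icc 0 T) (ξ : ℝ) {s : ℝ → ℝ}
    (hs : ∀ η, |s η| ≤ 1) {k : ℝ} (hk : k = Real.sqrt (∫ ξ, energyDensity X₀ ξ)) :
    |nonlocal s (charY p t (X t)) (source p t (X t)) ξ| ≤
      (2 * coeffBound p + 1) * (k + k ^ 2 + k ^ 3 + k ^ 4) := by
  obtain ⟨hint, hE⟩ := hX.integral_energyDensity hlam h₀ ht
  have hb := coeffBound_nonneg p
  have hk0 : 0 ≤ k := hk ▸ Real.sqrt_nonneg _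
  have hk2 : k ^ 2 = ∫ ξ, energyDensity X₀ ξ := by
    rw [hk, Real.sq_sqrt h₀.integral_energyDensity_nonneg]
  set b := coeffBound p
  set y := charY p t (X t) with hy
  set w : ℝ → ℝ := fun η => (X t).Q η * (1 - (X t).V η) with hw
  have hyw : IsPrim y w := (hX.isPrim hlam h₀ ht).1
  have hw0 : ∀ η, 0 ≤ w η := fun η => (hX.weight_mem hlam h₀ ht η).2.2.1
  have hwR : ∀ η, |w η| ≤ R := fun η => by
    rw [abs_of_nonneg (hw0 η)]; exact (hX.weight_mem hlam h₀ ht η).2.2.2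
  have hsrc : ∀ η, |source p t (X t) η| ≤
      b * k * w η + (b * (k + k ^ 2) + 1) * energyDensity (X t) η := by
    intro η
    have hK : |(X t).K η| ≤ k := hk ▸ hX.abs_K_le hlam h₀ ht η
    have hH := abs_hamil_le hlam ht.1 ((X t).K η)
    have he := exp_lam_le hlam ht.1
    rw [abs_of_pos (Real.exp_pos _)] at he
    have he0 := (Real.exp_pos (-p.lam * t)).le
    have hQV : 0 ≤ (X t).Q η * (X t).V η := mul_nonneg (hX.weight_mem hlam h₀ ht η).1
      (V_mem_of_constraint (hX.constraint h₀ ht η)).1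
    have hKw : 0 ≤ (X t).K η ^ 2 * w η := mul_nonneg (sq_nonneg _) (hw0 η)
    have e1 : source p t (X t) η = -hamil p t ((X t).K η) * w η
        + (Real.exp (-p.lam * t) * ((X t).K η ^ 2 * w η)
          + Real.exp (-p.lam * t) / 2 * ((X t).Q η * (X t).V η)) := by
      simp only [source, hw]; ring
    have e2 : energyDensity (X t) η = (X t).K η ^ 2 * w η + (X t).Q η * (X t).V η := by
      simp only [energyDensity, hw]; ring
    have h1 : |-hamil p t ((X t).K η) * w η| ≤
        b * k * w η + b * (k + k ^ 2) * ((X t).K η ^ 2 * w η) := by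
      rw [abs_mul, abs_neg, abs_of_nonneg (hw0 η)]
      have h2 : |(X t).K η| + |(X t).K η| ^ 3 + |(X t).K η| ^ 4 ≤
          k + (k + k ^ 2) * (X t).K η ^ 2 := by
        have e3 : |(X t).K η| + |(X t).K η| ^ 3 + |(X t).K η| ^ 4 =
            |(X t).K η| + (|(X t).K η| + |(X t).K η| ^ 2) * |(X t).K η| ^ 2 := by ring
        rw [e3, sq_abs ((X t).K η)]
        have h4 : (X t).K η ^ 2 ≤ k ^ 2 := by
          rw [← sq_abs]; exact pow_le_pow_left₀ (abs_nonneg _) hK 2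
        gcongr
      calc _ ≤ b * (k + (k + k ^ 2) * (X t).K η ^ 2) * w η := by
            refine mul_le_mul_of_nonneg_right (hH.trans ?_) (hw0 η)
            gcongr
        _ = _ := by ring
    rw [e1]
    refine (abs_add_le _ _).trans ((add_le_add h1 (le_of_eq (abs_of_nonneg
      (by positivity)))).trans ?_)
    rw [e2]
    have h5 : 0 ≤ b * (k + k ^ 2) * ((X t).Q η * (X t).V η) := by positivity
    nlinarith
  have hi1 : Integrable fun η => Real.exp (-|y ξ - y η|) * w η := by
    simpa using integrable_nonlocal (s := fun _ => 1) (ξ := ξ) one_pos (by simp) measurable_const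
      (Eventually.of_forall (hX.exp_charY_le h₀ ht ξ)) hyw.continuous.aestronglyMeasurable
      (Eventually.of_forall hwR) hyw.locallyIntegrable.aestronglyMeasurable
  have hi2 : Integrable fun η => Real.exp (-|y ξ - y η|) * energyDensity (X t) η := by
    have hyc := hyw.continuous
    refine hint.bdd_mul (c := 1)
      (by fun_prop : Continuous fun η => Real.exp (-|y ξ - y η|)).aestronglyMeasurable
      (Eventually.of_forall fun η => ?_)
    rw [Real.norm_of_nonneg (Real.exp_pos _).le, Real.exp_le_one_iff]
    linarith [abs_nonneg (y ξ - y η)]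
  have h1 : |nonlocal s y (source p t (X t)) ξ| ≤
      ∫ η, (b * k * (Real.exp (-|y ξ - y η|) * w η) +
        (b * (k + k ^ 2) + 1) * (Real.exp (-|y ξ - y η|) * energyDensity (X t) η)) := by
    rw [nonlocal, ← Real.norm_eq_abs]
    refine norm_integral_le_of_norm_le ((hi1.const_mul _).add (hi2.const_mul _))
      (Eventually.of_forall fun η => ?_)
    rw [Real.norm_eq_abs, abs_mul, abs_mul, abs_of_pos (Real.exp_pos _)]
    calc _ ≤ 1 * Real.exp (-|y ξ - y η|) * |source p t (X t) η| := by gcongr; exact hs η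
      _ ≤ 1 * Real.exp (-|y ξ - y η|) *
          (b * k * w η + (b * (k + k ^ 2) + 1) * energyDensity (X t) η) := by
          gcongr; exact hsrc η
      _ = _ := by ring
  rw [integral_add (hi1.const_mul _) (hi2.const_mul _), integral_const_mul,
    integral_const_mul] at h1
  have h2 := hyw.integral_exp_neg_abs_sub_le hw0 hi1
  have h3 : ∫ η, Real.exp (-|y ξ - y η|) * energyDensity (X t) η ≤ k ^ 2 := by
    rw [hk2, ← hE]
    refine integral_mono hi2 hint fun η => ?_
    refine mul_le_of_le_one_left (hX.energyDensity_nonneg hlam h₀ ht η) ?_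
    rw [Real.exp_le_one_iff]
    linarith [abs_nonneg (y ξ - y η)]
  calc _ ≤ b * k * 2 + (b * (k + k ^ 2) + 1) * k ^ 2 := h1.trans (by gcongr)
    _ ≤ _ := by
      have : 0 ≤ b * k ^ 2 := by positivity
      have : 0 ≤ b * k ^ 3 := by positivity
      have : 0 ≤ b * k ^ 4 := by positivity
      have : 0 ≤ k ^ 3 := by positivity
      have : 0 ≤ k ^ 4 := by positivity
      nlinarith

theorem energyPoly_eq {E : ℝ} (hE : 0 ≤ E) : energyPoly E =
    Real.sqrt E + Real.sqrt E ^ 2 + Real.sqrt E ^ 3 + Real.sqrt E ^ 4 := by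
  have h1 : Real.sqrt E ^ 2 = E := Real.sq_sqrt hE
  have h3 : E ^ (3 / 2 : ℝ) = Real.sqrt E ^ 3 := by
    rw [Real.sqrt_eq_rpow, ← Real.rpow_natCast, ← Real.rpow_mul hE]
    norm_num
  have h4 : Real.sqrt E ^ 4 = E ^ 2 := by
    rw [show 4 = 2 * 2 by norm_num, pow_mul, h1]
  rw [energyPoly, h3, h4, h1, Real.sqrt_eq_rpow]

theorem energyPoly_nonneg {E : ℝ} (hE : 0 ≤ E) : 0 ≤ energyPoly E := by
  unfold energyPoly; positivity

/-- The constant in the a priori bounds. -/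
def aprioriConst (p : Params) : ℝ := 3 * coeffBound p + 2

theorem aprioriConst_pos (p : Params) : 0 < aprioriConst p := by
  have := coeffBound_nonneg p
  unfold aprioriConst
  positivity

theorem ClassicalOn.abs_lagP_lagG_le (hlam : 0 < p.lam) (h₀ : Admissible X₀)
    (hX : ClassicalOn p X₀ T R X) {t : ℝ} (ht : t ∈ Icc 0 T) (ξ : ℝ) :
    |lagP p t (X t) ξ| ≤ (2 * coeffBound p + 1) * energyPoly (∫ ξ, energyDensity X₀ ξ) ∧
    |lagG p t (X t) ξ| ≤ (2 * coeffBound p + 1) * energyPoly (∫ ξ, energyDensity X₀ ξ) := by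
  rw [energyPoly_eq h₀.integral_energyDensity_nonneg]
  constructor
  · rw [lagP_eq_nonlocal, abs_mul, abs_of_pos (by norm_num : (0 : ℝ) < 1 / 2)]
    have := hX.abs_nonlocal_le_sqrt hlam h₀ ht ξ (s := fun _ => 1) (by simp) rfl
    linarith [abs_nonneg (nonlocal (fun _ => 1) (charY p t (X t)) (source p t (X t)) ξ)]
  · rw [lagG_eq_nonlocal, abs_mul, abs_neg, abs_of_pos (by norm_num : (0 : ℝ) < 1 / 2)]
    have := hX.abs_nonlocal_le_sqrt hlam h₀ ht ξ (s := fun η => Real.sign (ξ - η))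
      (fun _ => abs_sign_le _) rfl
    linarith [abs_nonneg (nonlocal (fun η => Real.sign (ξ - η)) (charY p t (X t))
      (source p t (X t)) ξ)]

theorem ClassicalOn.abs_rateQ_le (hlam : 0 < p.lam) (h₀ : Admissible X₀)
    (hX : ClassicalOn p X₀ T R X) (ξ : ℝ) {t : ℝ} (ht : t ∈ Icc 0 T) :
    |rateQ p t (X t) ξ| ≤ aprioriConst p * (1 + energyPoly (∫ ξ, energyDensity X₀ ξ)) := by
  have h1 := LagrangianCH.abs_rateQ_le hlam ht.1
    (V_mem_of_constraint (hX.constraint h₀ ht ξ)).2.2 (hX.abs_K_le hlam h₀ ht ξ)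
    (hX.abs_lagP_lagG_le hlam h₀ ht ξ).1
  refine h1.trans ?_
  rw [energyPoly_eq h₀.integral_energyDensity_nonneg, aprioriConst]
  have hb := coeffBound_nonneg p
  set b := coeffBound p
  set k := Real.sqrt (∫ ξ, energyDensity X₀ ξ)
  have hk : 0 ≤ k := Real.sqrt_nonneg _
  have : 0 ≤ b * k ^ 2 := by positivity
  have : 0 ≤ k ^ 3 := by positivity
  have : 0 ≤ k ^ 4 := by positivity
  nlinarith

/-! ### Global existence for admissible initial data -/

theorem Admissible.exists_global (hlam : 0 < p.lam) (h₀ : Admissible X₀) :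
    ∃ X, ∀ T, 0 ≤ T → ∃ R, ClassicalOn p X₀ T R X := by
  refine exists_global_of_forall hlam h₀ fun T hT => ?_
  obtain ⟨B, hB⟩ := h₀.exists_bound_K
  have hB0 : 0 ≤ B := (abs_nonneg _).trans (hB 0)
  set k := Real.sqrt (∫ ξ, energyDensity X₀ ξ) with hk
  have hk0 : 0 ≤ k := Real.sqrt_nonneg _
  set c := aprioriConst p * (1 + energyPoly (∫ ξ, energyDensity X₀ ξ)) with hc
  have hc0 : 0 ≤ c := mul_nonneg (aprioriConst_pos p).le
    (by linarith [energyPoly_nonneg h₀.integral_energyDensity_nonneg])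
  set R₀ := k * T + k + B + 1 + Real.exp (c * T) with hR₀
  have hkT : 0 ≤ k * T := by positivity
  have hexp : 0 < Real.exp (c * T) := Real.exp_pos _
  have hR₀0 : 0 ≤ R₀ := by positivity
  have hVW : ∀ {X : State} {ξ : ℝ}, X.W ξ ^ 2 + X.V ξ ^ 2 = X.V ξ →
      |X.V ξ| ≤ R₀ ∧ |X.W ξ| ≤ R₀ := fun {X ξ} h => by
    have h1 := V_mem_of_constraint h
    rw [abs_of_nonneg h1.1]
    constructor <;> linarith [h1.2.1, h1.2.2]
  have hX₀ : ∀ ξ, BoundedAt X₀ X₀ R₀ ξ := fun ξ => by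
    obtain ⟨h1, h2⟩ := hVW (h₀.constraint ξ)
    refine ⟨by simpa using hR₀0, (hB ξ).trans (by linarith), h1, h2, ?_⟩
    rw [h₀.Q_eq, abs_one]
    linarith
  have hap : ∀ T' R X, 0 ≤ T' → T' ≤ T → ClassicalOn p X₀ T' R X →
      ∀ t ∈ Icc 0 T', ∀ ξ, BoundedAt X₀ (X t) R₀ ξ := fun T' R X hT' hTT' hX t ht ξ => by
    obtain ⟨h1, h2⟩ := hVW (hX.constraint h₀ ht ξ)
    have hK := fun s (hs : s ∈ Icc 0 T') => hX.abs_K_le hlam h₀ hs ξ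
    refine ⟨?_, (hK t ht).trans (by linarith), h1, h2, ?_⟩
    · have h3 := hX.abs_comp_sub_le 0 ξ (c := k) (fun s hs => ?_) ht
      · have h4 : k * t ≤ k * T := mul_le_mul_of_nonneg_left (ht.2.trans hTT') hk0
        exact h3.trans (by linarith)
      · change |Real.exp (-p.lam * s) * (X s).K ξ| ≤ k
        rw [abs_mul]
        exact (mul_le_mul (exp_lam_le hlam hs.1) (hK s hs) (abs_nonneg _) zero_le_one).trans_eq
          (one_mul k)
    · have h3 := hX.exp_bounds_Q h₀ (fun s hs => hX.abs_rateQ_le hlam h₀ ξ hs) ht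
      rw [abs_of_nonneg ((Real.exp_pos _).le.trans h3.1)]
      have h4 : Real.exp (c * t) ≤ Real.exp (c * T) :=
        Real.exp_le_exp.2 (mul_le_mul_of_nonneg_left (ht.2.trans hTT') hc0)
      linarith [h3.2]
  exact ⟨_, exists_classicalOn_of_bound hlam h₀ hT hR₀0 hX₀ hap⟩

end

/-! ### The initial data -/

theorem initialY_congr {g g' : ℝ → ℝ} (h : g =ᵐ[volume] g') : initialY g = initialY g' := by
  have : (fun y : ℝ => (∫ x in (0 : ℝ)..y, g x ^ 2) + y) =
      fun y => (∫ x in (0 : ℝ)..y, g' x ^ 2) + y := by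
    funext y
    congr 1
    refine intervalIntegral.integral_congr_ae ?_
    filter_upwards [h] with x hx _
    rw [hx]
  rw [initialY, initialY, this]

section

variable {g : ℝ → ℝ} (hg : MemLp g 2 volume)
include hg

/-- The inverse of `ȳ` as a primitive. -/
theorem isPrim_initialY_inverse :
    IsPrim (fun y => (∫ x in (0 : ℝ)..y, g x ^ 2) + y) (fun y => g y ^ 2 + 1) :=
  (IsPrim.of_locallyIntegrable hg.integrable_sq.locallyIntegrable 0).add IsPrim.id

theorem initialY_strictMono : StrictMono (initialY g) := by
  intro a b hab
  by_contra hle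
  push Not at hle
  have h1 := initialY_spec hg a
  have h2 := initialY_spec hg b
  have h3 := (isPrim_initialY_inverse hg).monotone (fun x => by positivity) hle
  simp only at h3
  linarith

/-- `ȳ` is the inverse of `y ↦ ∫₀^y k_x² dx + y`. -/
theorem lt_initialY_iff {a ξ : ℝ} :
    a < initialY g ξ ↔ (∫ x in (0 : ℝ)..a, g x ^ 2) + a < ξ := by
  -- the inverse function increases at least as fast as the identity, hence is injective
  have hinj : initialY g ((∫ x in (0 : ℝ)..a, g x ^ 2) + a) = a := by
    set b := initialY g ((∫ x in (0 : ℝ)..a, g x ^ 2) + a) with hb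
    have h1 : (∫ x in (0 : ℝ)..b, g x ^ 2) + b = (∫ x in (0 : ℝ)..a, g x ^ 2) + a :=
      initialY_spec hg _
    have h2 : ∀ c d : ℝ, c ≤ d → d - c ≤ ((∫ x in (0 : ℝ)..d, g x ^ 2) + d) -
        ((∫ x in (0 : ℝ)..c, g x ^ 2) + c) := fun c d hcd => by
      have h3 := (IsPrim.of_locallyIntegrable hg.integrable_sq.locallyIntegrable 0).monotone
        (fun x => sq_nonneg (g x)) hcd
      simp only at h3
      linarith
    rcases le_total a b with h | h
    · linarith [h2 a b h]
    · linarith [h2 b a h]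
  constructor
  · intro h
    rw [← hinj] at h
    exact (initialY_strictMono hg).lt_iff_lt.1 h
  · intro h
    have := initialY_strictMono hg h
    rwa [hinj] at this

/-- The change of variables `ȳ` carries Lebesgue measure to `(1 + k_x²) dx`. -/
theorem map_initialY : Measure.map (initialY g) volume =
    volume.withDensity fun y => ((g y ^ 2 + 1).toNNReal : ℝ≥0∞) := by
  have hYm : Measurable (initialY g) := (initialY_strictMono hg).monotone.measurable
  have hprim := isPrim_initialY_inverse hg
  have key : ∀ a b : ℝ, a < b → Measure.map (initialY g) volume (Ioc a b) =
      ENNReal.ofReal (((∫ x in (0 : ℝ)..b, g x ^ 2) + b) - ((∫ x in (0 : ℝ)..a, g x ^ 2) + a)) := by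
    intro a b _
    rw [Measure.map_apply hYm measurableSet_Ioc, ← Real.volume_Ioc]
    congr 1
    ext ξ
    simp only [mem_preimage, mem_Ioc, lt_initialY_iff hg]
    rw [← not_lt, lt_initialY_iff hg, not_lt]
  refine Measure.ext_of_Ioc' _ _ (fun a b hab => ?_) (fun a b hab => ?_)
  · rw [key a b hab]; exact ENNReal.ofReal_ne_top
  · rw [key a b hab, withDensity_apply _ measurableSet_Ioc, ← hprim.integral_eq,
      intervalIntegral.integral_of_le hab.le, ofReal_integral_eq_lintegral_ofReal
        ((hprim.intervalIntegrable a b).1) (Eventually.of_forall fun x => by positivity)]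
    rfl

theorem ae_comp_initialY {P : ℝ → Prop} (h : ∀ᵐ y, P y) : ∀ᵐ ξ, P (initialY g ξ) := by
  have hYm : Measurable (initialY g) := (initialY_strictMono hg).monotone.measurable
  refine ae_of_ae_map hYm.aemeasurable ?_
  rw [map_initialY hg]
  exact (withDensity_absolutelyContinuous _ _).ae_le h

variable (hgm : Measurable g)
include hgm

theorem integrable_comp_initialY {u : ℝ → ℝ} (hu : Measurable u) :
    Integrable (fun ξ => u (initialY g ξ)) ↔ Integrable fun y => (g y ^ 2 + 1) * u y := by
  have hYm : Measurable (initialY g) := (initialY_strictMono hg).monotone.measurable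
  have h1 := integrable_map_measure (μ := volume) (f := initialY g) (g := u)
    hu.aestronglyMeasurable hYm.aemeasurable
  rw [map_initialY hg, integrable_withDensity_iff_integrable_smul (by fun_prop)] at h1
  rw [show (fun ξ => u (initialY g ξ)) = u ∘ initialY g from rfl, ← h1]
  refine integrable_congr (Eventually.of_forall fun y => ?_)
  simp only [NNReal.smul_def, smul_eq_mul]
  rw [Real.coe_toNNReal _ (by positivity)]

theorem integral_comp_initialY {u : ℝ → ℝ} (hu : Measurable u) :
    ∫ ξ, u (initialY g ξ) = ∫ y, (g y ^ 2 + 1) * u y := by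
  have hYm : Measurable (initialY g) := (initialY_strictMono hg).monotone.measurable
  rw [← integral_map hYm.aemeasurable hu.aestronglyMeasurable, map_initialY hg,
    integral_withDensity_eq_integral_smul (by fun_prop)]
  refine integral_congr_ae (Eventually.of_forall fun y => ?_)
  simp only [NNReal.smul_def, smul_eq_mul]
  rw [Real.coe_toNNReal _ (by positivity)]

/-- The chain rule for the composition with `ȳ`: composition turns a primitive of `(1 + k_x²) u`
into a primitive of `u ∘ ȳ`. -/
theorem IsPrim.comp_initialY {F u : ℝ → ℝ} (hF : IsPrim F fun y => (g y ^ 2 + 1) * u y)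
    (hu : Measurable u) {c : ℝ} (huc : ∀ y, |u y| ≤ c) :
    IsPrim (fun ξ => F (initialY g ξ)) (fun ξ => u (initialY g ξ)) := by
  have hYm : Measurable (initialY g) := (initialY_strictMono hg).monotone.measurable
  refine ⟨(locallyIntegrable_const c).mono (hu.comp hYm).aestronglyMeasurable
    (Eventually.of_forall fun x => by
      rw [Real.norm_eq_abs]; exact (huc _).trans (le_abs_self c)), ?_⟩
  have key : ∀ a b : ℝ, a ≤ b →
      ∫ x in a..b, u (initialY g x) = F (initialY g b) - F (initialY g a) := by
    intro a b hab
    have hpre : Ioc a b = initialY g ⁻¹' Ioc (initialY g a) (initialY g b) := by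
      ext ξ
      simp only [mem_preimage, mem_Ioc, (initialY_strictMono hg).lt_iff_lt,
        (initialY_strictMono hg).le_iff_le]
    rw [intervalIntegral.integral_of_le hab, hpre, ← setIntegral_map measurableSet_Ioc
      hu.aestronglyMeasurable hYm.aemeasurable, map_initialY hg,
      setIntegral_withDensity_eq_setIntegral_smul (by fun_prop) _ measurableSet_Ioc,
      ← hF.integral_eq, intervalIntegral.integral_of_le ((initialY_strictMono hg).monotone hab)]
    refine integral_congr_ae (Eventually.of_forall fun y => ?_)
    simp only [NNReal.smul_def, smul_eq_mul]
    rw [Real.coe_toNNReal _ (by positivity)]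
  intro a b
  rcases le_total a b with h | h
  · exact key a b h
  · rw [intervalIntegral.integral_symm, key b a h, neg_sub]

variable {k : ℝ → ℝ} (hk : IsPrim k g)
include hk

/-- The initial data belonging to a function in `H¹` are admissible, provided that the continuous
representative of the function and an everywhere measurable derivative are used. -/
theorem admissible_initialState (hk2 : MemLp k 2 volume) : Admissible (initialState k g) := by
  have hYm : Measurable (initialY g) := (initialY_strictMono hg).monotone.measurable
  have hmu : Measurable fun y => g y ^ 2 / (1 + g y ^ 2) := by fun_prop
  have hmw : Measurable fun y => g y / (1 + g y ^ 2) := by fun_prop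
  have hmk : Measurable k := hk.continuous.measurable
  have hpos : ∀ y, 0 < 1 + g y ^ 2 := fun y => by positivity
  constructor
  · have h1 := IsPrim.id.congr_deriv (g := fun y => (g y ^ 2 + 1) * (1 - g y ^ 2 / (1 + g y ^ 2)))
      (Eventually.of_forall fun y => by have := (hpos y).ne'; field_simp; ring)
    have h2 := h1.comp_initialY hg hgm (measurable_const.sub hmu) (c := 1) fun y => by
      have h3 : 0 ≤ g y ^ 2 / (1 + g y ^ 2) := by positivity
      have h4 : g y ^ 2 / (1 + g y ^ 2) ≤ 1 := by
        rw [div_le_one (hpos y)]; linarith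
      rw [abs_le]
      constructor <;> linarith
    simpa [initialState] using h2
  · have h1 := hk.congr_deriv (g := fun y => (g y ^ 2 + 1) * (g y / (1 + g y ^ 2)))
      (Eventually.of_forall fun y => by have := (hpos y).ne'; field_simp; ring)
    exact h1.comp_initialY hg hgm hmw (c := 1) fun y => by
      rw [abs_div, abs_of_pos (hpos y), div_le_one (hpos y), ← sq_abs (g y)]
      nlinarith [sq_nonneg (|g y| - 1), abs_nonneg (g y)]
  · exact hmu.comp hYm
  · exact hmw.comp hYm
  · intro ξ
    have := (hpos (initialY g ξ)).ne'
    simp only [initialState]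
    field_simp
  · refine (integrable_comp_initialY hg hgm hmu).2 (hg.integrable_sq.congr
      (Eventually.of_forall fun y => ?_))
    have := (hpos y).ne'
    field_simp
    ring
  · obtain ⟨B, hB⟩ := hk.exists_bound hk2.integrable_sq hg.integrable_sq
    refine (integrable_comp_initialY hg hgm (hmk.pow_const 2)).2 ?_
    have h1 : Integrable fun y => g y ^ 2 * k y ^ 2 :=
      hg.integrable_sq.mul_bdd (c := B ^ 2) (hmk.pow_const 2).aestronglyMeasurable
        (Eventually.of_forall fun y => by
          rw [Real.norm_eq_abs, abs_pow]; exact pow_le_pow_left₀ (abs_nonneg _) (hB y) 2)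
    refine (h1.add hk2.integrable_sq).congr (Eventually.of_forall fun y => ?_)
    simp only [Pi.add_apply]
    ring
  · intro ξ
    rfl

theorem integral_energyDensity_initialState :
    ∫ ξ, energyDensity (initialState k g) ξ = energy k g := by
  have hmk : Measurable k := hk.continuous.measurable
  have h := integral_comp_initialY hg hgm (u := fun y => k y ^ 2 * 1 * (1 - g y ^ 2 / (1 + g y ^ 2))
    + 1 * (g y ^ 2 / (1 + g y ^ 2))) (by fun_prop)
  refine h.trans (integral_congr_ae (Eventually.of_forall fun y => ?_))
  have : 1 + g y ^ 2 ≠ 0 := by positivity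
  simp only
  field_simp
  ring

end

/-- The initial data depend, up to null sets, only on the classes of `k̄` and `k̄_x` modulo null
sets. -/
theorem initialState_aeEq {k k' g g' : ℝ → ℝ} (hg' : MemLp g' 2 volume)
    (hk : k =ᵐ[volume] k') (hg : g =ᵐ[volume] g') :
    (initialState k g).AEEq (initialState k' g') ∧
      (initialState k g).Z = (initialState k' g').Z := by
  have hY := initialY_congr hg
  have hk' := ae_comp_initialY hg' hk
  have hg'' := ae_comp_initialY hg' hg
  have hZ : (initialState k g).Z = (initialState k' g').Z := by
    simp only [initialState, hY]
  refine ⟨⟨by rw [hZ], ?_, ?_, ?_, by rfl⟩, hZ⟩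
  · filter_upwards [hk'] with ξ h
    simp only [initialState, hY, h]
  · filter_upwards [hg''] with ξ h
    simp only [initialState, hY, h]
  · filter_upwards [hg''] with ξ h
    simp only [initialState, hY, h]

theorem energy_congr {k k' g g' : ℝ → ℝ} (hk : k =ᵐ[volume] k') (hg : g =ᵐ[volume] g') :
    energy k g = energy k' g' := by
  refine integral_congr_ae ?_
  filter_upwards [hk, hg] with x h1 h2
  rw [h1, h2]

/-! ### Bounds in the norms of the state space -/

theorem interNorm_le_sobolevNorm (f : ℝ → ℝ) : interNorm f ≤ sobolevNorm f :=
  le_iInf₂ fun _ _ => le_self_add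

theorem IsPrim.sobolevNorm_le {F f : ℝ → ℝ} (h : IsPrim F f) :
    sobolevNorm F ≤ interNorm F + interNorm f :=
  iInf₂_le f h.hasWeakDeriv

theorem interNorm_le_mul {f m : ℝ → ℝ} {c : ℝ} (hm : ∀ ξ, 0 ≤ m ξ) (h : ∀ ξ, |f ξ| ≤ c * m ξ) :
    interNorm f ≤ ENNReal.ofReal c * interNorm m := by
  have h' : ∀ᵐ ξ, ‖f ξ‖ ≤ c * ‖m ξ‖ := Eventually.of_forall fun ξ => by
    rw [Real.norm_of_nonneg (hm ξ)]; exact h ξ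
  rw [interNorm, interNorm, mul_add]
  exact add_le_add (eLpNorm_le_mul_eLpNorm_of_ae_le_mul h' 2)
    (eLpNorm_le_mul_eLpNorm_of_ae_le_mul h' ⊤)

theorem ae_abs_le_of_eLpNorm_top_le {f : ℝ → ℝ} {M : ℝ≥0∞} (hM : M < ⊤)
    (h : eLpNorm f ⊤ volume ≤ M) : ∀ᵐ ξ, |f ξ| ≤ M.toReal := by
  rw [eLpNorm_exponent_top] at h
  filter_upwards [ae_le_eLpNormEssSup (f := f) (μ := volume)] with ξ hξ
  have h1 := ENNReal.toReal_mono hM.ne (hξ.trans h)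
  rwa [toReal_enorm, Real.norm_eq_abs] at h1

theorem Admissible.interNorm_domFun_lt_top {X₀ : State} (h₀ : Admissible X₀) :
    interNorm (domFun X₀) < ⊤ := by
  obtain ⟨B, -, hB⟩ := h₀.exists_bound_domFun
  have hm := h₀.measurable_domFun.aestronglyMeasurable (μ := volume)
  refine ENNReal.add_lt_top.2 ⟨((memLp_two_iff_integrable_sq hm).2 h₀.integrable_domFun_sq).2,
    (memLp_top_of_bound hm B (Eventually.of_forall fun ξ => ?_)).2⟩
  rw [Real.norm_of_nonneg (domFun_nonneg X₀ ξ)]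
  exact hB ξ

section

variable {p : Params} {X₀ : State} {T R : ℝ} {X : ℝ → State}

/-- Classical solutions are bounded in the state space: every component and every weak derivative is
at most a multiple of `domFun`. -/
theorem ClassicalOn.exists_omegaNorm_le (hlam : 0 < p.lam) (h₀ : Admissible X₀)
    (hX : ClassicalOn p X₀ T R X) : ∃ M : ℝ≥0∞, M < ⊤ ∧
      ∀ t ∈ Icc 0 T, omegaNorm ((X t).relZ X₀.Z) ≤ M := by
  obtain ⟨C, hC, hdom⟩ := hX.exists_domAt hlam h₀
  have hN := h₀.interNorm_domFun_lt_top
  have hm := domFun_nonneg X₀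
  set N := interNorm (domFun X₀)
  have hfin : ∀ c : ℝ, ENNReal.ofReal c * N < ⊤ := fun c =>
    ENNReal.mul_lt_top ENNReal.ofReal_lt_top hN
  refine ⟨(ENNReal.ofReal C * N + ENNReal.ofReal (3 * C) * N) +
    (ENNReal.ofReal C * N + ENNReal.ofReal (C * R) * N) + ENNReal.ofReal C * N +
    ENNReal.ofReal C * N + ENNReal.ofReal R, ?_, fun t ht => ?_⟩
  · simp only [ENNReal.add_lt_top]
    exact ⟨⟨⟨⟨⟨hfin _, hfin _⟩, hfin _, hfin _⟩, hfin _⟩, hfin _⟩, ENNReal.ofReal_lt_top⟩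
  obtain ⟨hy, hK⟩ := hX.isPrim hlam h₀ ht
  have hZ : IsPrim (fun ξ => (X t).Z ξ - X₀.Z ξ)
      (fun ξ => (X t).Q ξ * (1 - (X t).V ξ) - (1 - X₀.V ξ)) := by
    have h := (hy.sub h₀.isPrim_Y).add_const (-(p.Γ * t))
    have e : (fun ξ => charY p t (X t) ξ - (X₀.Z ξ + ξ) + -(p.Γ * t)) =
        fun ξ => (X t).Z ξ - X₀.Z ξ := by
      funext ξ; simp only [charY]; ring
    rwa [e] at h
  have h0 : (0 : ℝ) ∈ Icc 0 T := ⟨le_rfl, ht.1.trans ht.2⟩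
  have hZ' : ∀ ξ, |(X t).Q ξ * (1 - (X t).V ξ) - (1 - X₀.V ξ)| ≤ 3 * C * domFun X₀ ξ := by
    intro ξ
    have hd := hdom t ht ξ
    have hd0 := (hdom 0 h0 ξ).V
    rw [hX.initial] at hd0
    have hV := V_mem_of_constraint (hX.constraint h₀ ht ξ)
    have e : (X t).Q ξ * (1 - (X t).V ξ) - (1 - X₀.V ξ) =
        ((X t).Q ξ - 1) * (1 - (X t).V ξ) - (X t).V ξ + X₀.V ξ := by ring
    have h1 : |((X t).Q ξ - 1) * (1 - (X t).V ξ)| ≤ C * domFun X₀ ξ := by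
      rw [abs_mul]
      refine (mul_le_of_le_one_right (abs_nonneg _) ?_).trans hd.Q
      rw [abs_le]
      constructor <;> linarith [hV.1, hV.2.1]
    rw [e]
    refine (abs_add_le _ _).trans ((add_le_add ((abs_sub _ _).trans (add_le_add h1 hd.V))
      hd0).trans_eq ?_)
    ring
  have hWQ : ∀ ξ, |(X t).W ξ * (X t).Q ξ| ≤ C * R * domFun X₀ ξ := by
    intro ξ
    rw [abs_mul]
    refine (mul_le_mul (hdom t ht ξ).W (hX.bounded t ht ξ).Q (abs_nonneg _)
      (mul_nonneg hC.le (hm ξ))).trans_eq ?_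
    ring
  have hQ : eLpNorm (X t).Q ⊤ volume ≤ ENNReal.ofReal R := by
    rw [eLpNorm_exponent_top]
    exact eLpNormEssSup_le_of_ae_bound (Eventually.of_forall fun ξ => (hX.bounded t ht ξ).Q)
  have hin : ∀ {f : ℝ → ℝ} {c : ℝ}, (∀ ξ, |f ξ| ≤ c * domFun X₀ ξ) →
      interNorm f ≤ ENNReal.ofReal c * N := fun h => interNorm_le_mul hm h
  exact add_le_add (add_le_add (add_le_add (add_le_add
    (hZ.sobolevNorm_le.trans (add_le_add (hin fun ξ => (hdom t ht ξ).Z) (hin hZ')))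
    (hK.sobolevNorm_le.trans (add_le_add (hin fun ξ => (hdom t ht ξ).K) (hin hWQ))))
    (hin fun ξ => (hdom t ht ξ).V)) (hin fun ξ => (hdom t ht ξ).W)) hQ

theorem ClassicalOn.exists_sobolevNorm_le (hlam : 0 < p.lam) (h₀ : Admissible X₀)
    (hX : ClassicalOn p X₀ T R X) : ∃ M : ℝ≥0∞, M < ⊤ ∧ ∀ t ∈ Icc 0 T,
      sobolevNorm (lagP p t (X t)) ≤ M ∧ sobolevNorm (lagG p t (X t)) ≤ M := by
  obtain ⟨C, hC, hdom⟩ := hX.exists_domAt hlam h₀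
  have hN := h₀.interNorm_domFun_lt_top
  have hm := domFun_nonneg X₀
  set N := interNorm (domFun X₀)
  have hfin : ∀ c : ℝ, ENNReal.ofReal c * N < ⊤ := fun c =>
    ENNReal.mul_lt_top ENNReal.ofReal_lt_top hN
  refine ⟨ENNReal.ofReal C * N + ENNReal.ofReal (R * C + C) * N,
    ENNReal.add_lt_top.2 ⟨hfin _, hfin _⟩, fun t ht => ?_⟩
  obtain ⟨hP, hG⟩ := hX.isPrim_lagP_lagG hlam h₀ ht
  have hw : ∀ ξ x, |x| ≤ C * domFun X₀ ξ →
      |(X t).Q ξ * (1 - (X t).V ξ) * x| ≤ R * C * domFun X₀ ξ := by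
    intro ξ x hx
    have hw := hX.weight_mem hlam h₀ ht ξ
    rw [abs_mul, abs_of_nonneg hw.2.2.1, mul_assoc R C]
    exact mul_le_mul hw.2.2.2 hx (abs_nonneg _) (hw.2.2.1.trans hw.2.2.2)
  constructor
  · refine hP.sobolevNorm_le.trans (add_le_add (interNorm_le_mul hm fun ξ => (hdom t ht ξ).P)
      (interNorm_le_mul hm fun ξ => (hw ξ _ (hdom t ht ξ).G).trans ?_))
    rw [add_mul]
    exact le_add_of_nonneg_right (mul_nonneg hC.le (hm ξ))
  · refine hG.sobolevNorm_le.trans (add_le_add (interNorm_le_mul hm fun ξ => (hdom t ht ξ).G)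
      (interNorm_le_mul hm fun ξ => (abs_sub _ _).trans ?_))
    rw [add_mul]
    exact add_le_add (hw ξ _ (hdom t ht ξ).P) (hdom t ht ξ).source

/-! ### Solutions in the sense of the state space -/

theorem ClassicalOn.isSolutionOn (hlam : 0 < p.lam) (h₀ : Admissible X₀)
    (hX : ClassicalOn p X₀ T R X) {k kx : ℝ → ℝ} (hAE : (initialState k kx).AEEq X₀)
    (hZ : (initialState k kx).Z = X₀.Z) : IsSolutionOn p k kx T X := by
  obtain ⟨M, hM, hle⟩ := hX.exists_omegaNorm_le hlam h₀
  refine ⟨fun t ht => ?_, ⟨M, hM, by rwa [hZ]⟩, ?_, Eventually.of_forall fun ξ t ht =>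
    ⟨hX.deriv_Z ξ ht, hX.deriv_K ξ ht, hX.deriv_V ξ ht, hX.deriv_W ξ ht, hX.deriv_Q ξ ht⟩⟩
  · have hm := hX.meas t ht
    rw [hZ]
    exact ⟨(hm.Z.sub h₀.meas.Z).aestronglyMeasurable, hm.aesm.K, hm.aesm.V, hm.aesm.W, hm.aesm.Q,
      (hle t ht).trans_lt hM⟩
  · rw [hX.initial]
    exact ⟨hAE.1.symm, hAE.2.1.symm, hAE.2.2.1.symm, hAE.2.2.2.1.symm, hAE.2.2.2.2.symm⟩

/-- A solution that is bounded in the state space at each time is bounded at almost every point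
uniformly in time, because almost all of its paths are continuous. -/
theorem IsSolutionOn.ae_boundedAt {k kx : ℝ → ℝ} (h : IsSolutionOn p k kx T X)
    (hZ : (initialState k kx).Z = X₀.Z) :
    ∃ M : ℝ, ∀ᵐ ξ, ∀ t ∈ Icc 0 T, BoundedAt X₀ (X t) M ξ := by
  obtain ⟨M, hM, hle⟩ := h.bounded
  rw [hZ] at hle
  have hpt : ∀ t ∈ Icc 0 T, ∀ᵐ ξ, BoundedAt X₀ (X t) M.toReal ξ := by
    intro t ht
    have h0 := hle t ht
    simp only [omegaNorm] at h0
    have hQ := le_trans le_add_self h0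
    have h1 := le_trans le_self_add h0
    have hW := le_trans le_add_self h1
    have h2 := le_trans le_self_add h1
    have hV := le_trans le_add_self h2
    have h3 := le_trans le_self_add h2
    have hK := le_trans (interNorm_le_sobolevNorm _) (le_trans le_add_self h3)
    have hZ := le_trans (interNorm_le_sobolevNorm _) (le_trans le_self_add h3)
    filter_upwards [ae_abs_le_of_eLpNorm_top_le hM (le_trans le_add_self hZ),
      ae_abs_le_of_eLpNorm_top_le hM (le_trans le_add_self hK),
      ae_abs_le_of_eLpNorm_top_le hM (le_trans le_add_self hV),
      ae_abs_le_of_eLpNorm_top_le hM (le_trans le_add_self hW),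
      ae_abs_le_of_eLpNorm_top_le hM hQ] with ξ a1 a2 a3 a4 a5
    exact ⟨a1, a2, a3, a4, a5⟩
  obtain ⟨D, hDc, hDd⟩ := TopologicalSpace.exists_countable_dense (Icc (0 : ℝ) T)
  have hall : ∀ᵐ ξ, ∀ t ∈ D, BoundedAt X₀ (X t) M.toReal ξ :=
    (ae_ball_iff hDc).2 fun t _ => hpt t t.2
  refine ⟨M.toReal, ?_⟩
  filter_upwards [hall, h.equation] with ξ hξ heq t ht
  -- a bound on a dense set of times extends to all times by continuity
  have key : ∀ f : ℝ → ℝ, ContinuousOn f (Icc 0 T) → (∀ t ∈ D, |f t| ≤ M.toReal) →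
      |f t| ≤ M.toReal := by
    intro f hf hfD
    have hcl : IsClosed {t : Icc (0 : ℝ) T | |f t| ≤ M.toReal} :=
      isClosed_le (continuousOn_iff_continuous_domRestrict.1 hf).abs continuous_const
    have := hcl.closure_subset_iff.2 (show D ⊆ _ from fun t ht => hfD t ht)
    rw [hDd.closure_eq] at this
    exact this (mem_univ (⟨t, ht⟩ : Icc (0 : ℝ) T))
  exact ⟨key (fun s => (X s).Z ξ - X₀.Z ξ)
      (ContinuousOn.sub (fun s hs => (heq s hs).1.continuousWithinAt) continuousOn_const)
      fun s hs => (hξ s hs).Z,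
    key (fun s => (X s).K ξ) (fun s hs => (heq s hs).2.1.continuousWithinAt)
      fun s hs => (hξ s hs).K,
    key (fun s => (X s).V ξ) (fun s hs => (heq s hs).2.2.1.continuousWithinAt)
      fun s hs => (hξ s hs).V,
    key (fun s => (X s).W ξ) (fun s hs => (heq s hs).2.2.2.1.continuousWithinAt)
      fun s hs => (hξ s hs).W,
    key (fun s => (X s).Q ξ) (fun s hs => (heq s hs).2.2.2.2.continuousWithinAt)
      fun s hs => (hξ s hs).Q⟩

/-- Uniqueness among all solutions with values in the state space. -/
theorem ClassicalOn.aeEq_of_isSolutionOn (hlam : 0 < p.lam) (h₀ : Admissible X₀)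
    (hX : ClassicalOn p X₀ T R X) {k kx : ℝ → ℝ} (hAE : (initialState k kx).AEEq X₀)
    (hZ : (initialState k kx).Z = X₀.Z) {Y : ℝ → State} (hY : IsSolutionOn p k kx T Y) {t : ℝ}
    (ht : t ∈ Icc 0 T) : (Y t).AEEq (X t) := by
  obtain ⟨M, hM⟩ := hY.ae_boundedAt hZ
  obtain ⟨i1, i2, i3, i4, i5⟩ := hY.initial
  obtain ⟨j1, j2, j3, j4, j5⟩ := hAE
  set S : Set ℝ := {ξ | (∀ t ∈ Icc 0 T, BoundedAt X₀ (Y t) M ξ) ∧ SolvesAt p T Y ξ ∧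
    CloseAt (Y 0) X₀ 0 ξ} with hS
  have hSae : ∀ᵐ ξ, ξ ∈ S := by
    filter_upwards [hM, hY.equation, i1.trans j1, i2.trans j2, i3.trans j3, i4.trans j4,
      i5.trans j5] with ξ h1 h2 a1 a2 a3 a4 a5
    refine ⟨h1, fun s hs i => ?_, by simp [a1], by simp [a2], by simp [a3], by simp [a4],
      by simp [a5]⟩
    obtain ⟨d1, d2, d3, d4, d5⟩ := h2 s hs
    fin_cases i
    exacts [d1, d2, d3, d4, d5]
  have hYm : ∀ t ∈ Icc 0 T, (Y t).AESM := fun t ht => by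
    have hm := hY.memOmega t ht
    refine ⟨?_, hm.aesm_K, hm.aesm_V, hm.aesm_W, hm.aesm_Q⟩
    have h1 := hm.aesm_Z.add (h₀.meas.Z.aestronglyMeasurable (μ := volume))
    refine h1.congr (Eventually.of_forall fun ξ => ?_)
    simp [State.relZ, hZ]
  have key := closeAt_zero_of_solvesAt hlam h₀ (R := max M R) hSae hYm
    (fun t ht => (hX.meas t ht).aesm)
    (fun t ht ξ hξ => (hξ.1 t ht).mono (le_max_left _ _))
    (fun t ht ξ _ => (hX.bounded t ht ξ).mono (le_max_right _ _)) (fun ξ hξ => hξ.2.1)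
    (fun ξ _ => hX.equation ξ) (fun ξ hξ => by rw [hX.initial]; exact hξ.2.2) t ht
  have hz : ∀ {a b : ℝ}, |a - b| ≤ 0 → a = b := fun h => sub_eq_zero.1 (abs_nonpos_iff.1 h)
  refine ⟨?_, ?_, ?_, ?_, ?_⟩ <;> filter_upwards [hSae] with ξ hξ
  exacts [hz (key ξ hξ).Z, hz (key ξ hξ).K, hz (key ξ hξ).V, hz (key ξ hξ).W, hz (key ξ hξ).Q]

end

end LagrangianCH

end

theorem mainTheorem2 (p : LagrangianCH.Params) (hlam : 0 < p.lam) :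
    ∃ C : ℝ, 0 < C ∧
      ∀ k kx : ℝ → ℝ, MemLp k 2 volume → MemLp kx 2 volume →
        LagrangianCH.HasWeakDeriv k kx →
        ∃ X : ℝ → LagrangianCH.State,
          -- the global solution, bounded in the state space on bounded time intervals
          LagrangianCH.IsGlobalSolution p k kx X ∧
          -- every local solution is a restriction of it; in particular it is unique
          (∀ T : ℝ, 0 < T → ∀ Y : ℝ → LagrangianCH.State,
            LagrangianCH.IsSolutionOn p k kx T Y →
              ∀ t ∈ Icc 0 T, (Y t).AEEq (X t)) ∧
          -- the pointwise identities
          (∀ t : ℝ, 0 ≤ t →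
            (∀ᵐ ξ ∂(volume : Measure ℝ), (X t).W ξ ^ 2 + (X t).V ξ ^ 2 = (X t).V ξ) ∧
            LagrangianCH.HasWeakDeriv (LagrangianCH.charY p t (X t))
              (fun ξ => (X t).Q ξ * (1 - (X t).V ξ)) ∧
            LagrangianCH.HasWeakDeriv (X t).K (fun ξ => (X t).W ξ * (X t).Q ξ)) ∧
          -- conservation of the energy
          (∀ t : ℝ, 0 ≤ t →
            Integrable (LagrangianCH.energyDensity (X t)) volume ∧
            ∫ ξ, LagrangianCH.energyDensity (X t) ξ = LagrangianCH.energy k kx) ∧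
          -- a priori bounds on the nonlocal terms
          (∀ t : ℝ, 0 ≤ t → ∀ᵐ ξ ∂(volume : Measure ℝ),
            |LagrangianCH.lagP p t (X t) ξ|
              ≤ C * LagrangianCH.energyPoly (LagrangianCH.energy k kx) ∧
            |LagrangianCH.lagG p t (X t) ξ|
              ≤ C * LagrangianCH.energyPoly (LagrangianCH.energy k kx)) ∧
          (∀ T : ℝ, 0 < T → ∃ M : ℝ≥0∞, M < ⊤ ∧ ∀ t ∈ Icc 0 T,
            LagrangianCH.sobolevNorm (LagrangianCH.lagP p t (X t)) ≤ M ∧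
            LagrangianCH.sobolevNorm (LagrangianCH.lagG p t (X t)) ≤ M) ∧
          -- two-sided exponential bounds on `Q`
          (∀ t : ℝ, 0 ≤ t → ∀ᵐ ξ ∂(volume : Measure ℝ),
            Real.exp (-(C * (1 + LagrangianCH.energyPoly (LagrangianCH.energy k kx)) * t))
              ≤ (X t).Q ξ ∧
            (X t).Q ξ
              ≤ Real.exp (C * (1 + LagrangianCH.energyPoly (LagrangianCH.energy k kx)) * t)) := by
  refine ⟨LagrangianCH.aprioriConst p, LagrangianCH.aprioriConst_pos p,
    fun k kx hk hkx hweak => ?_⟩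
  -- pass to the continuous representative of `k` and an everywhere measurable one of `k_x`
  obtain ⟨k', hkk', hprim⟩ := hweak.exists_isPrim
  set g := hkx.aestronglyMeasurable.mk kx with hg
  have hgm : Measurable g := hkx.aestronglyMeasurable.stronglyMeasurable_mk.measurable
  have hkg : kx =ᵐ[volume] g := hkx.aestronglyMeasurable.ae_eq_mk
  have hg2 : MemLp g 2 volume := hkx.ae_eq hkg
  have hprim' := hprim.congr_deriv hkg
  have h₀ := LagrangianCH.admissible_initialState hg2 hgm hprim' (hk.ae_eq hkk')
  obtain ⟨hAE, hZ⟩ := LagrangianCH.initialState_aeEq hg2 hkk' hkg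
  have hE : ∫ ξ, LagrangianCH.energyDensity (LagrangianCH.initialState k' g) ξ =
      LagrangianCH.energy k kx :=
    (LagrangianCH.integral_energyDensity_initialState hg2 hgm hprim').trans
      (LagrangianCH.energy_congr hkk' hkg).symm
  obtain ⟨X, hX⟩ := h₀.exists_global hlam
  have hA : 0 ≤ LagrangianCH.energyPoly (LagrangianCH.energy k kx) :=
    LagrangianCH.energyPoly_nonneg (hE ▸ h₀.integral_energyDensity_nonneg)
  refine ⟨X, fun T hT => ?_, fun T hT Y hY t ht => ?_, fun t ht => ?_, fun t ht => ?_,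
    fun t ht => Eventually.of_forall fun ξ => ?_, fun T hT => ?_,
    fun t ht => Eventually.of_forall fun ξ => ?_⟩
  · obtain ⟨R, h⟩ := hX T hT.le
    exact h.isSolutionOn hlam h₀ hAE hZ
  · obtain ⟨R, h⟩ := hX T hT.le
    exact h.aeEq_of_isSolutionOn hlam h₀ hAE hZ hY ht
  · obtain ⟨R, h⟩ := hX t ht
    have ht' : t ∈ Icc 0 t := ⟨ht, le_rfl⟩
    obtain ⟨h1, h2⟩ := h.isPrim hlam h₀ ht'
    exact ⟨Eventually.of_forall (h.constraint h₀ ht'), h1.hasWeakDeriv, h2.hasWeakDeriv⟩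
  · obtain ⟨R, h⟩ := hX t ht
    rw [← hE]
    exact h.integral_energyDensity hlam h₀ ⟨ht, le_rfl⟩
  · obtain ⟨R, h⟩ := hX t ht
    have hle : (2 * LagrangianCH.coeffBound p + 1) *
        LagrangianCH.energyPoly (LagrangianCH.energy k kx) ≤
        LagrangianCH.aprioriConst p * LagrangianCH.energyPoly (LagrangianCH.energy k kx) := by
      refine mul_le_mul_of_nonneg_right ?_ hA
      have := LagrangianCH.coeffBound_nonneg p
      unfold LagrangianCH.aprioriConst
      linarith
    have h1 := h.abs_lagP_lagG_le hlam h₀ (t := t) ⟨ht, le_rfl⟩ ξ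
    rw [hE] at h1
    exact ⟨h1.1.trans hle, h1.2.trans hle⟩
  · obtain ⟨R, h⟩ := hX T hT.le
    exact h.exists_sobolevNorm_le hlam h₀
  · obtain ⟨R, h⟩ := hX t ht
    rw [← hE]
    exact h.exp_bounds_Q h₀ (fun s hs => h.abs_rateQ_le hlam h₀ ξ hs) ⟨ht, le_rfl⟩
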